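/- **Setting.** A finite fuzzy labeled graph $G=\langle V,E,L,\Sigma_V,\Sigma_E\rangle$ consists of a finite non-empty set $V$ of vertices, finite sets $\Sigma_V,\Sigma_E$ of vertex and edge labels, and functions $E:V\times\Sigma_E\times V\to[0,1]$ and $L:V\to(\Sigma_V\to[0,1])$. A non-empty relation $Z\subseteq V\times V$ is a (crisp) bisimulation of $G$ if $Z(x,x')$ implies (i) $L(x)=L(x')$; (ii) if $E(x,r,y)>0$ then there is $y'$ with $Z(y,y')$ and $E(x,r,y)\le E(x',r,y')$; (iii) if $E(x',r,y')>0$ then there is $y$ with $Z(y,y')$ and $E(x',r,y')\le E(x,r,y)$. The partition corresponding to the largest bisimulation is the set of equivalence classes of the bisimulation that contains all bisimulations (it exists and is an equivalence relation). A set $X\subseteq V$ is stable w.r.t. $\langle Y,r\rangle$ if $\sup_{y\in Y}E(x,r,y)$ is the same for all $x\in X$. $\mathrm{split}(X,\langle Y',Y,r\rangle)$ is the coarsest partition of $X$ whose blocks are stable w.r.t. $\langle Y',r\rangle$ and $\langle Y\setminus Y',r\rangle$, and $\mathrm{split}(\mathbb P,\langle Y',Y,r\rangle)=\bigcup_{X\in\mathbb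 P}\mathrm{split}(X,\langle Y',Y,r\rangle)$. $\mathbb P_0$ is the partition for the equivalence "$L(x)=L(x')$ and $\sup_{y\in V} E(x,r,y)=\sup_{y\in V} E(x',r,y)$ for all $r$". **CompCB.** Start with $\mathbb P=\mathbb P_0$ and $\mathbb Q_r=\{V\}$ for all $r\in\Sigma_E$; if $\mathbb P=\{V\}$, return $\mathbb P$. While some $\mathbb Q_r\ne\mathbb P$: choose such $r$, $Y\in\mathbb Q_r$ and $Y'\in\mathbb P$ with $Y'\subset Y$ and $|Y'|\le|Y|/2$; set $\mathbb P:=\mathrm{split}(\mathbb P,\langle Y',Y,r\rangle)$ and replace $Y$ in $\mathbb Q_r$ by $Y'$ and $Y\setminus Y'$. After the loop return $\mathbb P$. **CompCB2** is the following program on mutable objects (attributes are references, `Null` at first unless set otherwise). *Classes.* A Vertex has `block`, the list `comingEdges`, and a flag `processed` (at first false). An Edge has `label`, `origin`, `dest`, `degree`, `blockEdge`; its constructor adds it to `dest.comingEdges`. A BlockEdge is a map from degrees to positive integers (at first empty), with `departingBlockEdge` and `sourceBlockEdge`; `pushKey(d)`/`popKey(d)` increase/decrease the value of the key $d$ by 1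 (an absent key counts as 0, a key whose value becomes 0 is deleted; `popKey` requires the key to be present); `maxKey()` is the largest key, or 0 if there is none; `BlockEdge(bE)` sets `sourceBlockEdge` to `bE`. A Block of the global list $\mathbb P$ has the list `vertices`, a map `superBlocks` from $\Sigma_E$ to SuperBlocks, and maps `departingBlocks1`, `departingBlocks2` from degrees to vertex lists; the constructor Block(vl, m) sets `vertices` := vl, adds the block to $\mathbb P$, makes it the `block` of all vertices of vl, and for all $r$ sets `superBlocks[r]` := m[r] and adds the block to m[r]. `createBlock(vl)` is Block(vl, `bx.superBlocks`), where `bx` is the `block` of the first vertex of vl. A SuperPartition $\mathbb Q[r]$ consists of the lists `compound` and `simple` of its SuperBlocks with more than one, respectively at most one, block. A SuperBlock has a list of blocks and a reference to its super-partition; adding or removing a block moves it between these lists when its number of blocks becomes 2, respectively 1; `smallerBlock()` returns the smaller one of its first two blocks (either one if their sizes are equal). *Initialize.* Create a Vertex for each $x\in V$ and an Edge for each $(x,r,y)$ with $E(x,r,y)>0$, with this degree; $\mathbb P$ := empty list; for each $r$ create $\mathbb Q[r]$ with one empty super-block msb[r]; for all $x,r$ create an empty BlockEdge blockEdges[x,r];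 for each edge $e$ set `e.blockEdge` := blockEdges[origin of $e$, label of $e$] and call `pushKey(e.degree)` on it; divide the vertices into lists such that $x,x'$ are in the same list iff $L(x)=L(x')$ and blockEdges[x,r].maxKey() = blockEdges[x',r].maxKey() for all $r$; create Block(X, msb) for each of these lists X. *Main.* Initialize; if $\mathbb P$ has size 1, return $\mathbb P$. Set changed := true. While changed: set changed := false, and for each $r\in\Sigma_E$, while $\mathbb Q[r]$.compound is non-empty: let $Y$ be its first element and $Y'$ := $Y$.smallerBlock(); call Split$(Y',Y,r)$; changed := true. Return $\mathbb P$. *Split$(Y',Y,r)$.* Let vs be a copy of the vertex list of $Y'$. Each of the following four loops runs over all $y$ in vs and all edges $e$ in `y.comingEdges` with label $r$; $x$ denotes `e.origin` and bx denotes `x.block`. (1) bE := `e.blockEdge`; if `bE.departingBlockEdge` is Null, set it to a new BlockEdge(bE); then `bE.popKey(e.degree)` and `bE.departingBlockEdge.pushKey(e.degree)`. (2) If $x$ is not processed: let $d_1$, $d_2$ be the values of maxKey() of bE := `e.blockEdge` and of `bE.departingBlockEdge`; move $x$ from `bx.vertices` to the list `bx.departingBlocks2`[$d_2$] if $d_1\ge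 d_2$ and to `bx.departingBlocks1`[$d_1$] otherwise (creating the list if the key is absent); mark $x$ as processed. (3) Before the loop: remove the block $Y'$ from the super-block $Y$, create a new super-block sb in the super-partition of $Y$, add $Y'$ to sb, and set `Y'.superBlocks[r]` := sb. In the loop: `e.blockEdge` := `e.blockEdge.departingBlockEdge`; if not both departing maps of bx are empty: if `bx.vertices` is empty, remove the first key from `departingBlocks1` (if this map is empty, from `departingBlocks2`) and let its list become `bx.vertices`; call createBlock for the lists of all remaining keys of the two maps; clear both maps. (4) `x.processed` := false; with bE := `e.blockEdge` and sbE := `bE.sourceBlockEdge`, if sbE is not Null, set `sbE.departingBlockEdge` and `bE.sourceBlockEdge` to Null. **Theorem.** For every finite fuzzy labeled graph $G$ and every resolution of the choices that the program leaves open (the orders in which vertices, edges, edge labels and keys of maps are enumerated, the lists that represent the initial blocks, ties in `smallerBlock`), CompCB2 terminates on $G$ without dereferencing Null or violating a precondition of a method. The returned list $\mathbb P$ represents the partition corresponding to the largest bisimulation of $G$: the vertex sets of its blocks are exactly the blocks of that partition, and no vertex is listed twice. Moreover, CompCB2 simulates CompCB: let $\mathbb P$ stand for the set of the vertex sets of its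 blocks, and $\mathbb Q_r$ for the set of the vertex sets of the super-blocks of $\mathbb Q[r]$; then the values of $(\mathbb P,(\mathbb Q_r)_r)$ after Initialize and after each call of Split are, in order, the values of these variables at the start and after each iteration of the main loop in a complete run of CompCB. -/

import Mathlib

noncomputable section

namespace CrispBisim

/-! ## Fuzzy labeled graphs, bisimulations, partitions -/

/-- Fuzzy degrees: the real interval `[0,1]`. -/
abbrev Degree : Type := unitInterval

/-- A fuzzy labeled graph with vertices `V`, vertex labels `VL` and edge labels `EL`:
the fuzzy set `E` of labeled edges and the labeling function `L` of the vertices. -/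
structure FuzzyGraph (V VL EL : Type*) where
  E : V → EL → V → Degree
  L : V → VL → Degree

namespace FuzzyGraph

variable {V VL EL : Type*} (G : FuzzyGraph V VL EL)

/-- Crisp auto-bisimulations of `G`: non-empty relations with the three closure conditions. -/
def IsBisimulation (Z : V → V → Prop) : Prop :=
  (∃ x x', Z x x') ∧
  (∀ x x', Z x x' → G.L x = G.L x') ∧
  (∀ x x' r y, Z x x' → 0 < G.E x r y → ∃ y', Z y y' ∧ G.E x r y ≤ G.E x' r y') ∧
  (∀ x x' r y', Z x x' → 0 < G.E x' r y' → ∃ y, Z y y' ∧ G.E x' r y' ≤ G.E x r y)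

/-- `P` is the partition corresponding to the largest bisimulation of `G`: the largest (with
respect to inclusion) bisimulation exists, is an equivalence relation, and `P` is the set of
its equivalence classes. -/
def IsLargestBisimulationPartition (P : Set (Set V)) : Prop :=
  ∃ Z : Setoid V, IsGreatest {R : V → V → Prop | G.IsBisimulation R} (fun x y => Z x y) ∧
    P = Z.classes

/-- `sup E(x, r, Y)`, the supremum of `{E(x, r, y) | y ∈ Y}` in the complete lattice `[0,1]`. -/
def supE (x : V) (r : EL) (Y : Set V) : Degree := ⨆ y ∈ Y, G.E x r y

/-- The set `X` of vertices is stable with respect to `⟨Y, r⟩`. -/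
def Stable (X Y : Set V) (r : EL) : Prop :=
  ∀ x ∈ X, ∀ x' ∈ X, G.supE x r Y = G.supE x' r Y

/-- The equivalence relation that underlies the initial partition. -/
def initialSetoid : Setoid V where
  r x x' := G.L x = G.L x' ∧ ∀ r, G.supE x r Set.univ = G.supE x' r Set.univ
  iseqv :=
    { refl := fun _ => ⟨rfl, fun _ => rfl⟩
      symm := fun h => ⟨h.1.symm, fun r => (h.2 r).symm⟩
      trans := fun h h' => ⟨h.1.trans h'.1, fun r => (h.2 r).trans (h'.2 r)⟩ }

/-- The partition `ℙ₀`. -/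
def initialPartition : Set (Set V) := G.initialSetoid.classes

end FuzzyGraph

/-- `𝕏` is a partition of the set `X`. -/
def IsPartitionOf {V : Type*} (𝕏 : Set (Set V)) (X : Set V) : Prop :=
  ∅ ∉ 𝕏 ∧ 𝕏.PairwiseDisjoint id ∧ ⋃₀ 𝕏 = X

/-- `𝕏` is a refinement of `𝕐`. -/
def IsRefinement {V : Type*} (𝕏 𝕐 : Set (Set V)) : Prop :=
  ∀ X ∈ 𝕏, ∃ Y ∈ 𝕐, X ⊆ Y

/-- `𝕏 = split(X, ⟨Y', Y, r⟩)`: the coarsest partition of `X` each of whose blocks is stable with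
respect to both `⟨Y', r⟩` and `⟨Y \ Y', r⟩`. -/
def IsSplit {V VL EL : Type*} (G : FuzzyGraph V VL EL) (Y' Y : Set V) (r : EL) (X : Set V)
    (𝕏 : Set (Set V)) : Prop :=
  (IsPartitionOf 𝕏 X ∧ ∀ B ∈ 𝕏, G.Stable B Y' r ∧ G.Stable B (Y \ Y') r) ∧
  ∀ 𝕐 : Set (Set V), IsPartitionOf 𝕐 X → (∀ B ∈ 𝕐, G.Stable B Y' r ∧ G.Stable B (Y \ Y') r) →
    IsRefinement 𝕐 𝕏

/-- `P' = split(P, ⟨Y', Y, r⟩)`, the union of the sets `split(X, ⟨Y', Y, r⟩)` over `X ∈ P`. -/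
def IsSplitPartition {V VL EL : Type*} (G : FuzzyGraph V VL EL) (Y' Y : Set V) (r : EL)
    (P P' : Set (Set V)) : Prop :=
  ∃ 𝕏 : Set V → Set (Set V), (∀ X ∈ P, IsSplit G Y' Y r X (𝕏 X)) ∧ P' = ⋃ X ∈ P, 𝕏 X

/-! ## Loops

Big-step semantics of `while` and `foreach` loops.  The list records, in order, whatever the
executions of the body record.  A derivation is a finite (hence terminating) execution. -/

/-- `While guard body s t s'`: started in `s`, the loop terminates in `s'` with record `t`. -/
inductive While {σ τ : Type*} (guard : σ → Prop) (body : σ → List τ → σ → Prop) :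
    σ → List τ → σ → Prop
  | exit (s : σ) : ¬ guard s → While guard body s [] s
  | iter (s s' s'' : σ) (t t' : List τ) : guard s → body s t s' →
      While guard body s' t' s'' → While guard body s (t ++ t') s''

/-- `ForEach body l s t s'`: running `body a` for the successive `a` in `l`. -/
def ForEach {α σ τ : Type*} (body : α → σ → List τ → σ → Prop) :
    List α → σ → List τ → σ → Prop
  | [], s, t, s' => t = [] ∧ s' = s
  | a :: l, s, t, s' =>
      ∃ t₁ s₁ t₂, body a s t₁ s₁ ∧ ForEach body l s₁ t₂ s' ∧ t = t₁ ++ t₂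

/-! ## The abstract algorithm CompCB -/

/-- The variables `ℙ` and `ℚ_r` (`r` an edge label) of CompCB. -/
structure Config (V EL : Type*) where
  P : Set (Set V)
  Q : EL → Set (Set V)

namespace CompCB

variable {V VL EL : Type*} [DecidableEq EL] (G : FuzzyGraph V VL EL)

/-- `ℙ = ℙ₀` and `ℚ_r = {V}` for all `r`. -/
def start : Config V EL where
  P := G.initialPartition
  Q := fun _ => {Set.univ}

/-- One iteration of the main loop of CompCB. -/
def Step (c c' : Config V EL) : Prop :=
  ∃ (r : EL) (Y Y' : Set V),
    c.Q r ≠ c.P ∧ Y ∈ c.Q r ∧ Y' ∈ c.P ∧ Y' ⊂ Y ∧ 2 * Y'.ncard ≤ Y.ncard ∧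
    IsSplitPartition G Y' Y r c.P c'.P ∧
    c'.Q = Function.update c.Q r ((c.Q r \ {Y}) ∪ {Y', Y \ Y'})

/-- `Run G t c`: `t` is the list of the successive values of `(ℙ, ℚ)` (at the start and after
every iteration of the main loop) in a terminating run of CompCB that ends with the values `c`. -/
def Run (t : List (Config V EL)) (c : Config V EL) : Prop :=
  ((start G).P = {Set.univ} ∧ t = [start G] ∧ c = start G) ∨
  ((start G).P ≠ {Set.univ} ∧ ∃ t', t = start G :: t' ∧
    While (fun c => ∃ r, c.Q r ≠ c.P) (fun c t c' => Step G c c' ∧ t = [c']) (start G) t' c)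

end CompCB

/-! ## Objects and the state of CompCB2

Objects live in tables.  A vertex is addressed by its ID (so the static method `getVertex` is the
identity), an edge by the triple origin, label, destination (there is at most one edge for each
triple), the super-partition `ℚ[r]` by `r`, and all other objects by a natural number that is
handed out when the object is created.  A reference that may be `Null`, and the value of a map
whose key may be absent, is an `Option`.  Linked lists are `List`s of references.  There is only
one object of type `Partition`, the global variable `ℙ`. -/

structure Vertex (V EL : Type*) where
  block : Option ℕ
  comingEdges : List (V × EL × V)
  processed : Bool

structure Edge (V EL : Type*) where
  label : EL
  origin : V
  dest : V
  degree : Degree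
  blockEdge : Option ℕ

/-- The map `[0,1] → ℕ` of a block-edge is a multiset: the keys are its elements, and the value of
a key is its multiplicity. -/
structure BlockEdge where
  map : Multiset Degree
  departing : Option ℕ
  source : Option ℕ

/-- The biggest key, and `0` if there is none. -/
def BlockEdge.maxKey (b : BlockEdge) : Degree := b.map.fold max 0

/-- Maps from degrees to vertex lists. -/
abbrev DegreeMap (V : Type*) := Finmap (fun _ : Degree => List V)

structure Block (V EL : Type*) where
  vertices : List V
  superBlocks : EL → Option ℕ
  departing₁ : DegreeMap V
  departing₂ : DegreeMap V

structure SuperBlock (EL : Type*) where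
  blocks : List ℕ
  superPartition : Option EL

structure SuperPartition where
  compound : List ℕ
  simple : List ℕ

/-- The tables of objects (with the next free address where addresses are numbers), the global
variables `ℙ` and `changed`, and the local variables `msb` and `blockEdges` of the initialization
(`ℚ` is the table `superPartition`). -/
structure State (V EL : Type*) where
  vertex : V → Vertex V EL
  edge : V × EL × V → Edge V EL
  blockEdge : ℕ → BlockEdge
  nextBlockEdge : ℕ
  block : ℕ → Block V EL
  nextBlock : ℕ
  superBlock : ℕ → SuperBlock EL
  nextSuperBlock : ℕ
  superPartition : EL → SuperPartition
  partition : List ℕ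
  changed : Bool
  msb : EL → Option ℕ
  blockEdges : V → EL → Option ℕ

/-- Everything that the pseudocode leaves open: the orders in which vertices, edges, edge labels
and keys of maps are enumerated, the lists that represent the initial blocks, and the choice
between two blocks of the same size. -/
structure Choices {V VL EL : Type*} (G : FuzzyGraph V VL EL) where
  /-- all vertices, each once -/
  vertices : List V
  vertices_nodup : vertices.Nodup
  mem_vertices : ∀ x, x ∈ vertices
  /-- all edge labels, each once -/
  labels : List EL
  labels_nodup : labels.Nodup
  mem_labels : ∀ r, r ∈ labels
  /-- all edges (of nonzero degree), each once -/
  edges : List (V × EL × V)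
  edges_nodup : edges.Nodup
  mem_edges : ∀ x r y, (x, r, y) ∈ edges ↔ 0 < G.E x r y
  /-- a set of vertex lists such that two vertices belong to a common list iff they have the same
  label and the same keys -/
  classes : (V → EL → Option Degree) → List (List V)
  classes_nodup : ∀ key, (classes key).flatten.Nodup
  classes_nonempty : ∀ key, [] ∉ classes key
  mem_classes : ∀ key x x', (∃ X ∈ classes key, x ∈ X ∧ x' ∈ X) ↔
    G.L x = G.L x' ∧ ∀ r, key x r = key x' r
  /-- the order in which the keys of a map are enumerated -/
  keyOrder : State V EL → Finset Degree → List Degree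
  keyOrder_nodup : ∀ s K, (keyOrder s K).Nodup
  mem_keyOrder : ∀ s K d, d ∈ keyOrder s K ↔ d ∈ K
  /-- whether the first one of two blocks of equal size is taken as the smaller one -/
  preferFirst : State V EL → ℕ → ℕ → Bool

namespace CompCB2

variable {V VL EL : Type*}

/-- A command of the program; the result `none` means that the command crashes (by following a
`Null` reference, by looking up an absent key, or by violating the precondition of a method). -/
abbrev Cmd (V EL : Type*) := State V EL → Option (State V EL)

/-- `foreach a ∈ l do body a`, for commands. -/
def forEach {α : Type*} : List α → (α → Cmd V EL) → Cmd V EL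
  | [], _, s => some s
  | a :: l, body, s => (body a s).bind (forEach l body)

/-! ### Changing attributes of one object -/

def modVertex [DecidableEq V] (x : V) (f : Vertex V EL → Vertex V EL) (s : State V EL) :
    State V EL :=
  { s with vertex := Function.update s.vertex x (f (s.vertex x)) }

def modEdge [DecidableEq V] [DecidableEq EL] (e : V × EL × V) (f : Edge V EL → Edge V EL)
    (s : State V EL) : State V EL :=
  { s with edge := Function.update s.edge e (f (s.edge e)) }

def modBlockEdge (bE : ℕ) (f : BlockEdge → BlockEdge) (s : State V EL) : State V EL :=
  { s with blockEdge := Function.update s.blockEdge bE (f (s.blockEdge bE)) }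

def modBlock (b : ℕ) (f : Block V EL → Block V EL) (s : State V EL) : State V EL :=
  { s with block := Function.update s.block b (f (s.block b)) }

def modSuperBlock (sb : ℕ) (f : SuperBlock EL → SuperBlock EL) (s : State V EL) : State V EL :=
  { s with superBlock := Function.update s.superBlock sb (f (s.superBlock sb)) }

def modSuperPartition [DecidableEq EL] (r : EL) (f : SuperPartition → SuperPartition)
    (s : State V EL) : State V EL :=
  { s with superPartition := Function.update s.superPartition r (f (s.superPartition r)) }

/-! ### Constructors and methods -/

/-- The constructor `Vertex(id)`. -/
def newVertex [DecidableEq V] (x : V) (s : State V EL) : State V EL :=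
  modVertex x (fun _ => ⟨none, [], false⟩) s

/-- The constructor `Edge(r, x, y, d, Null)`. -/
def newEdge [DecidableEq V] [DecidableEq EL] (r : EL) (x y : V) (d : Degree) (s : State V EL) :
    State V EL :=
  modVertex y (fun v => { v with comingEdges := v.comingEdges ++ [(x, r, y)] })
    (modEdge (x, r, y) (fun _ => ⟨r, x, y, d, none⟩) s)

/-- The constructors `BlockEdge()` and `BlockEdge(bE)` (`source` is `Null` or `bE`).  The new
object gets the address `s.nextBlockEdge`. -/
def newBlockEdge (source : Option ℕ) (s : State V EL) : State V EL :=
  { modBlockEdge s.nextBlockEdge (fun _ => ⟨0, none, source⟩) s with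
    nextBlockEdge := s.nextBlockEdge + 1 }

def pushKey (bE : ℕ) (d : Degree) (s : State V EL) : State V EL :=
  modBlockEdge bE (fun b => { b with map := d ::ₘ b.map }) s

/-- The key has to be present. -/
def popKey (bE : ℕ) (d : Degree) : Cmd V EL := fun s =>
  if d ∈ (s.blockEdge bE).map then
    some (modBlockEdge bE (fun b => { b with map := b.map.erase d }) s)
  else none

/-- The constructor `SuperPartition()`, with the assignment of the new object to `ℚ[r]`. -/
def newSuperPartition [DecidableEq EL] (r : EL) (s : State V EL) : State V EL :=
  modSuperPartition r (fun _ => ⟨[], []⟩) s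

def addSuperBlock [DecidableEq EL] (r : EL) (sb : ℕ) (s : State V EL) : State V EL :=
  if 1 < (s.superBlock sb).blocks.length then
    modSuperPartition r (fun q => { q with compound := q.compound ++ [sb] }) s
  else
    modSuperPartition r (fun q => { q with simple := q.simple ++ [sb] }) s

/-- The constructor `SuperBlock(superPartition')`.  The new object gets the address
`s.nextSuperBlock`. -/
def newSuperBlock [DecidableEq EL] (r : EL) (s : State V EL) : State V EL :=
  addSuperBlock r s.nextSuperBlock
    { modSuperBlock s.nextSuperBlock (fun _ => ⟨[], some r⟩) s with
      nextSuperBlock := s.nextSuperBlock + 1 }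

/-- `sb.addBlock(b)`. -/
def addBlock [DecidableEq EL] (sb b : ℕ) : Cmd V EL := fun s =>
  let s := modSuperBlock sb (fun B => { B with blocks := B.blocks ++ [b] }) s
  if (s.superBlock sb).blocks.length = 2 then
    (s.superBlock sb).superPartition.bind fun r =>
      some (modSuperPartition r
        (fun q => { compound := q.compound ++ [sb], simple := q.simple.erase sb }) s)
  else some s

/-- `sb.removeBlock(b)`. -/
def removeBlock [DecidableEq EL] (sb b : ℕ) : Cmd V EL := fun s =>
  let s := modSuperBlock sb (fun B => { B with blocks := B.blocks.erase b }) s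
  if (s.superBlock sb).blocks.length = 1 then
    (s.superBlock sb).superPartition.bind fun r =>
      some (modSuperPartition r
        (fun q => { compound := q.compound.erase sb, simple := q.simple ++ [sb] }) s)
  else some s

/-- `createSuperBlock(sp, b, r)`, where `sp` is addressed by `sp`. -/
def createSuperBlock [DecidableEq EL] (sp : EL) (b : ℕ) (r : EL) : Cmd V EL := fun s =>
  let sb := s.nextSuperBlock
  (addBlock sb b (newSuperBlock sp s)).bind fun s =>
    some (modBlock b
      (fun B => { B with superBlocks := Function.update B.superBlocks r (some sb) }) s)

/-- `sb.smallerBlock()`: the smaller one of the first two blocks. -/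
def smallerBlock {G : FuzzyGraph V VL EL} (C : Choices G) (sb : ℕ) (s : State V EL) : Option ℕ :=
  match (s.superBlock sb).blocks with
  | b₁ :: b₂ :: _ =>
      if (s.block b₁).vertices.length < (s.block b₂).vertices.length then some b₁
      else if (s.block b₂).vertices.length < (s.block b₁).vertices.length then some b₂
      else if C.preferFirst s b₁ b₂ then some b₁ else some b₂
  | _ => none

/-- The constructor `Block(vertices', ℙ, superBlocks')`.  The new object gets the address
`s.nextBlock`. -/
def newBlock [DecidableEq V] [DecidableEq EL] {G : FuzzyGraph V VL EL} (C : Choices G)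
    (vl : List V) (superBlocks : Option (EL → Option ℕ)) : Cmd V EL := fun s =>
  let b := s.nextBlock
  let s := { modBlock b (fun _ => ⟨vl, fun _ => none, ∅, ∅⟩) s with
    nextBlock := s.nextBlock + 1
    partition := s.partition ++ [b] }
  (forEach vl (fun x s => some (modVertex x (fun v => { v with block := some b }) s)) s).bind
    fun s =>
      match superBlocks with
      | none => some s
      | some m =>
          forEach C.labels (fun r s =>
            (m r).bind fun sb =>
              addBlock sb b (modBlock b (fun B =>
                { B with superBlocks := Function.update B.superBlocks r (some sb) }) s)) s

/-- The static method `createBlock(vl)`. -/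
def createBlock [DecidableEq V] [DecidableEq EL] {G : FuzzyGraph V VL EL} (C : Choices G)
    (vl : List V) : Cmd V EL := fun s =>
  vl.head?.bind fun x =>
    (s.vertex x).block.bind fun bx =>
      newBlock C vl (some (s.block bx).superBlocks) s

/-! ### Initialization -/

/-- The state before the start of the program. -/
def blank : State V EL where
  vertex := fun _ => ⟨none, [], false⟩
  edge := fun e => ⟨e.2.1, e.1, e.2.2, 0, none⟩
  blockEdge := fun _ => ⟨0, none, none⟩
  nextBlockEdge := 0
  block := fun _ => ⟨[], fun _ => none, ∅, ∅⟩
  nextBlock := 0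
  superBlock := fun _ => ⟨[], none⟩
  nextSuperBlock := 0
  superPartition := fun _ => ⟨[], []⟩
  partition := []
  changed := false
  msb := fun _ => none
  blockEdges := fun _ _ => none

section Procedures

variable [DecidableEq V] [DecidableEq EL] {G : FuzzyGraph V VL EL} (C : Choices G)

/-- Construct the vertices. -/
def constructVertices : Cmd V EL :=
  forEach C.vertices fun x s => some (newVertex x s)

/-- Construct the edges. -/
def constructEdges : Cmd V EL :=
  forEach C.edges fun e s => some (newEdge e.2.1 e.1 e.2.2 (G.E e.1 e.2.1 e.2.2) s)

/-- Create `ℙ`, the super-partitions `ℚ[r]` and the super-blocks `msb[r]`. -/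
def constructPartitions : Cmd V EL := fun s =>
  forEach C.labels (fun r s =>
    let s := newSuperPartition r s
    let sb := s.nextSuperBlock
    let s := newSuperBlock r s
    some { s with msb := Function.update s.msb r (some sb) })
  { s with partition := [], msb := fun _ => none }

/-- Create the block-edges `blockEdges[x, r]`. -/
def constructBlockEdges : Cmd V EL := fun s =>
  forEach C.vertices (fun x => forEach C.labels fun r s =>
    let bE := s.nextBlockEdge
    let s := newBlockEdge none s
    some { s with
      blockEdges := Function.update s.blockEdges x
        (Function.update (s.blockEdges x) r (some bE)) })
  { s with blockEdges := fun _ _ => none }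

/-- Connect the edges to the block-edges and fill the latter. -/
def fillBlockEdges : Cmd V EL :=
  forEach C.edges fun e s =>
    let s := modEdge e
      (fun E => { E with blockEdge := s.blockEdges (s.edge e).origin (s.edge e).label }) s
    (s.edge e).blockEdge.bind fun bE => some (pushKey bE (s.edge e).degree s)

/-- Create the initial blocks. -/
def constructBlocks : Cmd V EL := fun s =>
  forEach
    (C.classes fun x r => (s.blockEdges x r).map fun bE => (s.blockEdge bE).maxKey)
    (fun X s => newBlock C X (some s.msb) s) s

/-- The procedure `Initialize(G)`. -/
def setUp : Cmd V EL := fun s =>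
  (constructVertices C s).bind fun s =>
  (constructEdges C s).bind fun s =>
  (constructPartitions C s).bind fun s =>
  (constructBlockEdges C s).bind fun s =>
  (fillBlockEdges C s).bind fun s =>
  constructBlocks C s

/-! ### Splitting -/

/-- `foreach y ∈ vs and e ∈ y.comingEdges do (if e.label ≠ r then continue); body e`. -/
def forComingEdges (vs : List V) (r : EL) (body : V × EL × V → Cmd V EL) : Cmd V EL :=
  forEach vs fun y s =>
    forEach (s.vertex y).comingEdges
      (fun e s => if (s.edge e).label ≠ r then some s else body e s) s

/-- The procedure `ComputeBlockEdges(vs, r)`. -/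
def computeBlockEdges (vs : List V) (r : EL) : Cmd V EL :=
  forComingEdges vs r fun e s =>
    (s.edge e).blockEdge.bind fun bE =>
    let s :=
      if (s.blockEdge bE).departing = none then
        modBlockEdge bE (fun b => { b with departing := some s.nextBlockEdge })
          (newBlockEdge (some bE) s)
      else s
    (s.blockEdge bE).departing.bind fun dbE =>
    (popKey bE (s.edge e).degree s).bind fun s =>
    some (pushKey dbE (s.edge e).degree s)

/-- Move `x` to the end of the list of the key `d`, which is created if `d` is absent. -/
def DegreeMap.put (m : DegreeMap V) (d : Degree) (x : V) : DegreeMap V :=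
  m.insert d ((m.lookup d).getD [] ++ [x])

/-- The procedure `ComputeSubblocks(vs, r)`. -/
def computeSubblocks (vs : List V) (r : EL) : Cmd V EL :=
  forComingEdges vs r fun e s =>
    let x := (s.edge e).origin
    (s.vertex x).block.bind fun bx =>
    if (s.vertex x).processed then some s else
    (s.edge e).blockEdge.bind fun bE =>
    (s.blockEdge bE).departing.bind fun dbE =>
    let d₁ := (s.blockEdge bE).maxKey
    let d₂ := (s.blockEdge dbE).maxKey
    let s :=
      if d₁ ≥ d₂ then
        modBlock bx (fun B => { B with
          vertices := B.vertices.erase x, departing₂ := DegreeMap.put B.departing₂ d₂ x }) s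
      else
        modBlock bx (fun B => { B with
          vertices := B.vertices.erase x, departing₁ := DegreeMap.put B.departing₁ d₁ x }) s
    some (modVertex x (fun v => { v with processed := true }) s)

/-- If the vertex list of the block `bx` is empty, leave one of the subblocks in it. -/
def keepOneSubblock (bx : ℕ) : Cmd V EL := fun s =>
  if (s.block bx).vertices = [] then
    if (s.block bx).departing₁ ≠ ∅ then
      (C.keyOrder s (s.block bx).departing₁.keys).head?.bind fun d =>
      ((s.block bx).departing₁.lookup d).bind fun vl =>
      some (modBlock bx
        (fun B => { B with vertices := vl, departing₁ := B.departing₁.erase d }) s)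
    else
      (C.keyOrder s (s.block bx).departing₂.keys).head?.bind fun d =>
      ((s.block bx).departing₂.lookup d).bind fun vl =>
      some (modBlock bx
        (fun B => { B with vertices := vl, departing₂ := B.departing₂.erase d }) s)
  else some s

/-- The procedure `DoSplitting(Y', vs, Y, r)`. -/
def doSplitting (Y' : ℕ) (vs : List V) (Y : ℕ) (r : EL) : Cmd V EL := fun s =>
  (removeBlock Y Y' s).bind fun s =>
  (s.superBlock Y).superPartition.bind fun sp =>
  (createSuperBlock sp Y' r s).bind fun s =>
  forComingEdges vs r (fun e s =>
    (s.edge e).blockEdge.bind fun bE =>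
    let s := modEdge e (fun E => { E with blockEdge := (s.blockEdge bE).departing }) s
    let x := (s.edge e).origin
    (s.vertex x).block.bind fun bx =>
    if ¬ ((s.block bx).departing₁ = ∅ ∧ (s.block bx).departing₂ = ∅) then
      (keepOneSubblock C bx s).bind fun s =>
      (forEach (C.keyOrder s (s.block bx).departing₁.keys) (fun d s =>
        ((s.block bx).departing₁.lookup d).bind fun vl => createBlock C vl s) s).bind fun s =>
      (forEach (C.keyOrder s (s.block bx).departing₂.keys) (fun d s =>
        ((s.block bx).departing₂.lookup d).bind fun vl => createBlock C vl s) s).bind fun s =>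
      some (modBlock bx (fun B => { B with departing₁ := ∅, departing₂ := ∅ }) s)
    else some s) s

/-- The procedure `ClearAuxiliaryInfo(vs, r)`. -/
def clearAuxiliaryInfo (vs : List V) (r : EL) : Cmd V EL :=
  forComingEdges vs r fun e s =>
    let s := modVertex (s.edge e).origin (fun v => { v with processed := false }) s
    (s.edge e).blockEdge.bind fun bE =>
    match (s.blockEdge bE).source with
    | none => some s
    | some sbE =>
        some (modBlockEdge bE (fun b => { b with source := none })
          (modBlockEdge sbE (fun b => { b with departing := none }) s))

/-- The procedure `Split(Y', Y, r)`. -/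
def split (Y' Y : ℕ) (r : EL) : Cmd V EL := fun s =>
  let vs := (s.block Y').vertices
  (computeBlockEdges vs r s).bind fun s =>
  (computeSubblocks vs r s).bind fun s =>
  (doSplitting C Y' vs Y r s).bind fun s =>
  clearAuxiliaryInfo vs r s

/-! ### The main program -/

/-- The body of the inner `while` loop: choose `Y` and `Y'`, call `Split(Y', Y, r)`, and set
`changed` to `true`. -/
def splitFirst (r : EL) : Cmd V EL := fun s =>
  (s.superPartition r).compound.head?.bind fun Y =>
  (smallerBlock C Y s).bind fun Y' =>
  (split C Y' Y r s).bind fun s =>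
  some { s with changed := true }

/-- The inner `while` loop for the edge label `r`; the state after every iteration is recorded. -/
def InnerLoop (r : EL) : State V EL → List (State V EL) → State V EL → Prop :=
  While (fun s => (s.superPartition r).compound ≠ [])
    (fun s t s' => splitFirst C r s = some s' ∧ t = [s'])

/-- The outer `while` loop. -/
def OuterLoop : State V EL → List (State V EL) → State V EL → Prop :=
  While (fun s => s.changed = true)
    (fun s t s' => ForEach (InnerLoop C) C.labels { s with changed := false } t s')

/-- `Run C t s`: CompCB2 (with its open choices resolved by `C`) terminates without a crash in the
state `s`, and `t` is the list of the states after the initialization and after every call of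
`Split`.  As `C` makes the program deterministic, the existence of such `t` and `s` means that the
program terminates. -/
def Run (t : List (State V EL)) (s : State V EL) : Prop :=
  ∃ s₀, setUp C blank = some s₀ ∧
    ((s₀.partition.length = 1 ∧ t = [s₀] ∧ s = s₀) ∨
     (s₀.partition.length ≠ 1 ∧ ∃ t', t = s₀ :: t' ∧
      OuterLoop C { s₀ with changed := true } t' s))

end Procedures

/-! ### What a state represents -/

/-- The vertex lists of the blocks of `ℙ`. -/
def output (s : State V EL) : List (List V) :=
  s.partition.map fun b => (s.block b).vertices

/-- The set of vertices of a block. -/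
def blockSet (s : State V EL) (b : ℕ) : Set V := {x | x ∈ (s.block b).vertices}

/-- The set of vertices of a super-block. -/
def superBlockSet (s : State V EL) (sb : ℕ) : Set V :=
  ⋃ b ∈ (s.superBlock sb).blocks, blockSet s b

/-- The values of the variables `ℙ` and `ℚ_r` of CompCB that a state represents. -/
def config (s : State V EL) : Config V EL where
  P := {X | ∃ b ∈ s.partition, X = blockSet s b}
  Q := fun r => {Y | ∃ sb ∈ (s.superPartition r).compound ++ (s.superPartition r).simple,
    Y = superBlockSet s sb}

end CompCB2

end CrispBisim

end

noncomputable section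

namespace CrispBisim

section

/-! ## Loops -/

/-! The mathematical core is partition refinement with two layers. Throughout the main loops, every
block of `ℙ` is stable with respect to every super-block of every `ℚ[r]`, vertices of a common block
have the same label, and every bisimulation relates only vertices of a common block. A bisimulation
`R` whose pairs stay within blocks respects `Y'` (a block) and `Y \ Y'` (a union of blocks), so
`R`-related vertices have equal suprema on both sets (`FuzzyGraph.IsBisimulation.supE_eq`) and no
split separates them. When all super-blocks have shrunk to single blocks, the blocks are stable with
respect to themselves. Since suprema over finite non-empty sets are attained, this makes "same
block" a bisimulation, and it already contains all others
(`FuzzyGraph.isLargestBisimulationPartition_classes`).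

What remains is that the program on objects performs these splits. Two edges share a block-edge
exactly if they agree in origin, label and super-block of the destination, and the map of the
block-edge is the multiset of the degrees of its edges. Hence the greatest key is the supremum over
that super-block (`BlockEdge.maxKey_eq_supE`). While `Y'` is removed from `Y`, the old block-edge
keeps the edges into `Y \ Y'` and the departing one receives those into `Y'`, so both suprema `a`
(on `Y \ Y'`) and `b` (on `Y'`) are at hand.

The program does not sort by the pair `(a, b)` but by a single degree: a vertex stays if `b = 0`,
goes to the second map under `b` if `b ≤ a`, and to the first map under `a` otherwise. This suffices
because stability with respect to `Y` fixes `max a b` within a block, so the smaller of the two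
degrees, together with the information which one it is, determines the other (`subblockKey_eq_iff`).

The moving of vertices is controlled by a key function `c` on vertices. The relation "same block and
same key" (`SameKernel`) does not change while departing lists are turned into blocks. Before this
the keys are the values of `subblockKey`, afterwards they are all `none`. Comparing both ends shows
that the new blocks are exactly the classes of the old blocks under equality of `a` and of `b`
(`split_spec`).

Each split separates two vertices that shared a super-block, so the number of triples `(r, x, x')`
with `x`, `x'` in one super-block of `ℚ[r]` decreases; this gives termination. Each split is also a
legal iteration of CompCB (`splitFirst_spec`), and the iterations compose along the loops through
`Simulates`. Finally, with the open choices fixed the program is deterministic, so the properties of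
the run that is constructed hold for every run. -/

theorem While.det {σ τ : Type*} {guard : σ → Prop} {body : σ → List τ → σ → Prop}
    (hb : ∀ s t₁ s₁ t₂ s₂, body s t₁ s₁ → body s t₂ s₂ → t₁ = t₂ ∧ s₁ = s₂)
    {s s₁ s₂ : σ} {t₁ t₂ : List τ} (h₁ : While guard body s t₁ s₁)
    (h₂ : While guard body s t₂ s₂) : t₁ = t₂ ∧ s₁ = s₂ := by
  induction h₁ generalizing t₂ s₂ with
  | exit s hg =>
    cases h₂ with
    | exit => exact ⟨rfl, rfl⟩
    | iter => contradiction
  | iter s s' s'' t t' hg hbd hw ih =>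
    cases h₂ with
    | exit => contradiction
    | iter _ u _ v v' _ hbd' hw' =>
      obtain ⟨rfl, rfl⟩ := hb _ _ _ _ _ hbd hbd'
      obtain ⟨rfl, rfl⟩ := ih hw'
      exact ⟨rfl, rfl⟩

theorem ForEach.det {α σ τ : Type*} {body : α → σ → List τ → σ → Prop}
    (hb : ∀ a s t₁ s₁ t₂ s₂, body a s t₁ s₁ → body a s t₂ s₂ → t₁ = t₂ ∧ s₁ = s₂)
    {l : List α} {s s₁ s₂ : σ} {t₁ t₂ : List τ} (h₁ : ForEach body l s t₁ s₁)
    (h₂ : ForEach body l s t₂ s₂) : t₁ = t₂ ∧ s₁ = s₂ := by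
  induction l generalizing s t₁ t₂ with
  | nil =>
    obtain ⟨rfl, rfl⟩ := h₁
    obtain ⟨rfl, rfl⟩ := h₂
    exact ⟨rfl, rfl⟩
  | cons a l ih =>
    obtain ⟨_, _, _, hb₁, hl₁, rfl⟩ := h₁
    obtain ⟨_, _, _, hb₂, hl₂, rfl⟩ := h₂
    obtain ⟨rfl, rfl⟩ := hb _ _ _ _ _ _ hb₁ hb₂
    obtain ⟨rfl, rfl⟩ := ih hl₁ hl₂
    exact ⟨rfl, rfl⟩

variable {V VL EL : Type*}

/-! ## Suprema of degrees -/

namespace FuzzyGraph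

variable (G : FuzzyGraph V VL EL)

/-- The degree of an edge that is given as a triple. -/
abbrev degree (e : V × EL × V) : Degree := G.E e.1 e.2.1 e.2.2

variable {G}

theorem le_supE {x y : V} {r : EL} {Y : Set V} (hy : y ∈ Y) : G.E x r y ≤ G.supE x r Y :=
  le_iSup₂_of_le y hy le_rfl

theorem supE_le {x : V} {r : EL} {Y : Set V} {d : Degree} (h : ∀ y ∈ Y, G.E x r y ≤ d) :
    G.supE x r Y ≤ d :=
  iSup₂_le h

theorem supE_union (x : V) (r : EL) (Y Z : Set V) :
    G.supE x r (Y ∪ Z) = max (G.supE x r Y) (G.supE x r Z) := by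
  apply le_antisymm
  · refine supE_le fun y hy => ?_
    rcases hy with hy | hy
    · exact le_max_of_le_left (le_supE hy)
    · exact le_max_of_le_right (le_supE hy)
  · exact max_le (supE_le fun y hy => le_supE (Or.inl hy))
      (supE_le fun y hy => le_supE (Or.inr hy))

/-- Finiteness makes the supremum attained. This turns equality of suprema into an actual edge that
answers a given one, as the bisimulation conditions demand. -/
theorem exists_supE_le [Finite V] (x : V) (r : EL) {Y : Set V} (hY : Y.Nonempty) :
    ∃ y ∈ Y, G.supE x r Y ≤ G.E x r y := by
  obtain ⟨y, hy, h⟩ := Set.exists_max_image Y (G.E x r) Y.toFinite hY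
  exact ⟨y, hy, supE_le h⟩

/-- As `0` is the least degree, a supremum vanishes exactly if no edge of positive degree enters the
set. Only edges of positive degree are enumerated, so this identifies the vertices that the loops
over edges into `Y'` never meet. -/
theorem supE_ne_zero_iff (x : V) (r : EL) (Y : Set V) :
    G.supE x r Y ≠ 0 ↔ ∃ y ∈ Y, 0 < G.E x r y := by
  constructor
  · intro h
    by_contra! hc
    refine h (le_antisymm (supE_le hc) unitInterval.nonneg')
  · rintro ⟨y, hy, h⟩
    exact (h.trans_le (le_supE hy)).ne'

/-- Vertices related by a bisimulation whose related pairs do not leave `Y` have the same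
supremum on `Y`. -/
theorem IsBisimulation.supE_eq {R : V → V → Prop} (hR : G.IsBisimulation R) {Y : Set V}
    (hY : ∀ y y', R y y' → (y ∈ Y ↔ y' ∈ Y)) {x x' : V} (h : R x x') (r : EL) :
    G.supE x r Y = G.supE x' r Y := by
  obtain ⟨-, -, h₁, h₂⟩ := hR
  apply le_antisymm <;> refine supE_le fun y hy => ?_
  · rcases (show (0 : Degree) ≤ G.E x r y from unitInterval.nonneg').eq_or_lt with h0 | h0
    · rw [← h0]; exact unitInterval.nonneg'
    · obtain ⟨y', hyy, hle⟩ := h₁ x x' r y h h0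
      exact hle.trans (le_supE ((hY _ _ hyy).1 hy))
  · rcases (show (0 : Degree) ≤ G.E x' r y from unitInterval.nonneg').eq_or_lt with h0 | h0
    · rw [← h0]; exact unitInterval.nonneg'
    · obtain ⟨y', hyy, hle⟩ := h₂ x x' r y h h0
      exact hle.trans (le_supE ((hY _ _ hyy).2 hy))

/-- An equivalence relation that contains all bisimulations and is stable with respect to its
own classes is the largest bisimulation. -/
theorem isLargestBisimulationPartition_classes [Finite V] [Nonempty V] (A : Setoid V)
    (hL : ∀ x x', A x x' → G.L x = G.L x')
    (hA : ∀ x x', A x x' → ∀ r y, G.supE x r {z | A z y} = G.supE x' r {z | A z y})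
    (hmax : ∀ R, G.IsBisimulation R → ∀ x x', R x x' → A x x') :
    G.IsLargestBisimulationPartition A.classes := by
  refine ⟨A, ⟨⟨?_, hL, ?_, ?_⟩, fun R hR x x' h => hmax R hR x x' h⟩, rfl⟩
  · obtain ⟨x⟩ := ‹Nonempty V›
    exact ⟨x, x, A.refl x⟩
  -- An edge of greatest degree from `x'` into the class of `y` answers all edges from `x` into this
  -- class at once.
  · intro x x' r y h _
    obtain ⟨y', hy', hle⟩ := exists_supE_le (G := G) x' r (Y := {z | A z y}) ⟨y, A.refl y⟩
    refine ⟨y', A.symm hy', le_trans ?_ hle⟩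
    rw [← hA x x' h r y]
    exact le_supE (A.refl y)
  · intro x x' r y h _
    obtain ⟨y', hy', hle⟩ := exists_supE_le (G := G) x r (Y := {z | A z y}) ⟨y, A.refl y⟩
    refine ⟨y', hy', le_trans ?_ hle⟩
    rw [hA x x' h r y]
    exact le_supE (A.refl y)

end FuzzyGraph

/-- The classes of the refinement of an equivalence relation by the suprema on `Y'` and `Y \ Y'`
result by splitting. -/
theorem isSplitPartition_classes {G : FuzzyGraph V VL EL} {Y' Y : Set V} {r : EL}
    {A A' : Setoid V} (h : ∀ x x', A' x x' ↔ A x x' ∧ G.supE x r Y' = G.supE x' r Y' ∧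
      G.supE x r (Y \ Y') = G.supE x' r (Y \ Y')) :
    IsSplitPartition G Y' Y r A.classes A'.classes := by
  have hsub : ∀ x, {z | A' z x} ⊆ {z | A z x} := fun x z hz => ((h z x).1 hz).1
  refine ⟨fun X => {B | B ∈ A'.classes ∧ B ⊆ X}, ?_, ?_⟩
  · rintro _ ⟨x₀, rfl⟩
    refine ⟨⟨⟨fun hE => Setoid.empty_notMem_classes hE.1, ?_, ?_⟩, ?_⟩, ?_⟩
    · exact A'.isPartition_classes.pairwiseDisjoint.subset fun B hB => hB.1
    · ext x
      constructor
      · rintro ⟨B, ⟨-, hB⟩, hx⟩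
        exact hB hx
      · intro hx
        exact ⟨_, ⟨A'.mem_classes x, fun z hz => A.trans (hsub x hz) hx⟩, A'.refl x⟩
    · rintro _ ⟨⟨b, rfl⟩, -⟩
      exact ⟨fun x hx x' hx' => ((h x x').1 (A'.trans hx (A'.symm hx'))).2.1,
        fun x hx x' hx' => ((h x x').1 (A'.trans hx (A'.symm hx'))).2.2⟩
    -- Coarseness: two elements of a stable block of any competing partition are `A`-equivalent and
    -- agree in both suprema, so they lie in one class of `A'`.
    · intro 𝕐 h𝕐 hst B hB
      obtain ⟨x, hx⟩ : B.Nonempty := Set.nonempty_iff_ne_empty.2 fun hE => h𝕐.1 (hE ▸ hB)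
      have hBX : ∀ z ∈ B, A z x₀ := fun z hz => by
        have : z ∈ ⋃₀ 𝕐 := ⟨B, hB, hz⟩
        rw [h𝕐.2.2] at this
        exact this
      refine ⟨_, ⟨A'.mem_classes x, fun z hz => A.trans (hsub x hz) (hBX x hx)⟩, fun z hz => ?_⟩
      exact (h z x).2 ⟨A.trans (hBX z hz) (A.symm (hBX x hx)), (hst B hB).1 z hz x hx,
        (hst B hB).2 z hz x hx⟩
  · ext B
    simp only [Set.mem_iUnion, Set.mem_ofPred_eq, exists_prop]
    constructor
    · rintro ⟨x, rfl⟩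
      exact ⟨_, A.mem_classes x, A'.mem_classes x, hsub x⟩
    · rintro ⟨_, -, hB, -⟩
      exact hB

/-- The subblock of a vertex with suprema `b` on `Y'` and `a` on `Y \ Y'`: it stays in its block if
`b = 0`, and otherwise it is moved to the list with the given key of the second (`true`) or the
first (`false`) of the departing maps. -/
def subblockKey (a b : Degree) : Option (Bool × Degree) :=
  if b = 0 then none else if b ≤ a then some (true, b) else some (false, a)

/-- The maximum of `a` and `b` is known, so the smaller of them recovers the other. A vertex without
key has `b = 0`, hence `a` is the maximum; a key `(true, b)` means `b ≤ a`, so again `a` is the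
maximum; a key `(false, a)` means `a < b`, so `b` is the maximum. Keys of different shapes are never
equal. -/
theorem subblockKey_eq_iff {a b a' b' : Degree} (h : max a b = max a' b') :
    subblockKey a b = subblockKey a' b' ↔ b = b' ∧ a = a' := by
  constructor
  · intro hk
    have h0 : ∀ d : Degree, 0 ≤ d := fun _ => unitInterval.nonneg'
    have ha := h0 a
    have ha' := h0 a'
    unfold subblockKey at hk
    split_ifs at hk with h1 h2 h3 h4 h5 h6 <;>
      simp only [Option.some.injEq, Prod.mk.injEq, reduceCtorEq, false_and, true_and] at hk
    · subst h1 h2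
      simpa [max_eq_left ha, max_eq_left ha'] using h
    · subst hk
      simpa [max_eq_left h4, max_eq_left h6] using h
    · subst hk
      rw [max_eq_right (le_of_not_ge h4), max_eq_right (le_of_not_ge ‹_›)] at h
      exact ⟨h, rfl⟩
  · rintro ⟨rfl, rfl⟩
    rfl

/-! ## Multisets of degrees -/

variable {G : FuzzyGraph V VL EL}

open Classical in
/-- The degrees of the edges with the property `p`. -/
def degrees (C : Choices G) (p : V × EL × V → Prop) : Multiset Degree :=
  ((C.edges : Multiset (V × EL × V)).filter p).map G.degree

theorem degrees_congr (C : Choices G) {p q : V × EL × V → Prop}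
    (h : ∀ e ∈ C.edges, p e ↔ q e) : degrees C p = degrees C q := by
  classical
  unfold degrees
  rw [Multiset.filter_congr (fun e he => h e (by simpa using he))]

/-- The comparison takes place on edges, before passing to degrees: the edges form a multiset
without repetitions, so membership decides, whereas degrees may repeat. -/
theorem degrees_insert (C : Choices G) {p q : V × EL × V → Prop} {e : V × EL × V}
    (he : e ∈ C.edges) (hp : ¬ p e) (hq : ∀ e' ∈ C.edges, q e' ↔ p e' ∨ e' = e) :
    degrees C q = G.degree e ::ₘ degrees C p := by
  classical
  unfold degrees
  rw [← Multiset.map_cons]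
  congr 1
  have hnd : (C.edges : Multiset (V × EL × V)).Nodup := Multiset.coe_nodup.2 C.edges_nodup
  rw [Multiset.Nodup.ext (hnd.filter _) (Multiset.nodup_cons.2 ⟨by simp [hp], hnd.filter _⟩)]
  intro a
  simp only [Multiset.mem_filter, Multiset.mem_coe, Multiset.mem_cons]
  constructor
  · rintro ⟨ha, haq⟩
    rcases (hq a ha).1 haq with h | h
    · exact Or.inr ⟨ha, h⟩
    · exact Or.inl h
  · rintro (rfl | ⟨ha, h⟩)
    · exact ⟨he, (hq a he).2 (Or.inr rfl)⟩
    · exact ⟨ha, (hq a ha).2 (Or.inl h)⟩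

theorem degrees_eq_zero (C : Choices G) {p : V × EL × V → Prop} (h : ∀ e ∈ C.edges, ¬ p e) :
    degrees C p = 0 := by
  classical
  unfold degrees
  rw [Multiset.filter_eq_nil.2 (by simpa using h), Multiset.map_zero]

theorem BlockEdge.maxKey_le_iff (b : BlockEdge) (c : Degree) :
    b.maxKey ≤ c ↔ ∀ d ∈ b.map, d ≤ c := by
  unfold BlockEdge.maxKey
  induction b.map using Multiset.induction with
  | empty => simp
  | cons a m ih => simp [ih]

/-- Triples that are not enumerated as edges have degree `0` and contribute nothing to the supremum.
This matches the value `0` of `maxKey` for a map without keys. -/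
theorem BlockEdge.maxKey_eq_supE (C : Choices G) {b : BlockEdge} {p : V × EL × V → Prop}
    (hb : b.map = degrees C p) {x : V} {r : EL} {Y : Set V}
    (hp : ∀ e ∈ C.edges, p e ↔ e.1 = x ∧ e.2.1 = r ∧ e.2.2 ∈ Y) :
    b.maxKey = G.supE x r Y := by
  classical
  apply le_antisymm
  · rw [BlockEdge.maxKey_le_iff, hb]
    intro d hd
    simp only [degrees, Multiset.mem_map, Multiset.mem_filter, Multiset.mem_coe] at hd
    obtain ⟨e, ⟨he, hpe⟩, rfl⟩ := hd
    obtain ⟨rfl, rfl, hy⟩ := (hp e he).1 hpe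
    exact FuzzyGraph.le_supE hy
  · refine FuzzyGraph.supE_le fun y hy => ?_
    rcases (show (0 : Degree) ≤ G.E x r y from unitInterval.nonneg').eq_or_lt with h0 | h0
    · rw [← h0]; exact unitInterval.nonneg'
    · refine (BlockEdge.maxKey_le_iff b _).1 le_rfl _ ?_
      rw [hb]
      simp only [degrees, Multiset.mem_map, Multiset.mem_filter, Multiset.mem_coe]
      have he := (C.mem_edges x r y).2 h0
      exact ⟨_, ⟨he, (hp _ he).2 ⟨rfl, rfl, hy⟩⟩, rfl⟩

namespace CompCB2

/-! ## Rules for the loops of commands -/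

/-- The invariant is indexed by the prefix that has been processed. In the induction the first
element is absorbed into the invariant, so that prefixes are still taken from the start of the whole
list. -/
theorem forEach_spec {α : Type*} {l : List α} {body : α → Cmd V EL}
    (I : List α → State V EL → Prop) {s : State V EL} (h0 : I [] s)
    (hstep : ∀ D a R s, l = D ++ a :: R → I D s →
      ∃ s', body a s = some s' ∧ I (D ++ [a]) s') :
    ∃ s', forEach l body s = some s' ∧ I l s' := by
  induction l generalizing I s with
  | nil => exact ⟨s, rfl, h0⟩
  | cons a l ih =>
    obtain ⟨s₁, hs₁, hI⟩ := hstep [] a l s rfl h0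
    obtain ⟨s', hs', hI'⟩ := ih (fun D => I (a :: D)) hI fun D b R s hl hD =>
      hstep (a :: D) b R s (by rw [hl]; rfl) hD
    exact ⟨s', by simp [forEach, hs₁, hs'], hI'⟩

/-- The rule for loops over lists without repetitions. -/
theorem forEach_spec_nodup {α : Type*} {l : List α} (hl : l.Nodup) {body : α → Cmd V EL}
    (I : List α → State V EL → Prop) {s : State V EL} (h0 : I [] s)
    (hstep : ∀ D a s, a ∈ l → a ∉ D → D ⊆ l → I D s →
      ∃ s', body a s = some s' ∧ I (D ++ [a]) s') :
    ∃ s', forEach l body s = some s' ∧ I l s' := by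
  refine forEach_spec I h0 fun D a R s h hI => ?_
  subst h
  refine hstep D a s (by simp) (fun ha => ?_) (by simp) hI
  exact (List.nodup_append.1 hl).2.2 a ha a (by simp) rfl

variable [DecidableEq V] [DecidableEq EL]

/-- The edges with label `r` and destination in `vs`, as they are enumerated by the loops. -/
def arcs (C : Choices G) (vs : List V) (r : EL) : List (V × EL × V) :=
  vs.flatMap fun y => (C.edges.filter fun e => e.2.2 = y).filter fun e => e.2.1 = r

theorem mem_arcs {C : Choices G} {vs : List V} {r : EL} {e : V × EL × V} :
    e ∈ arcs C vs r ↔ e ∈ C.edges ∧ e.2.2 ∈ vs ∧ e.2.1 = r := by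
  simp only [arcs, List.mem_flatMap, List.mem_filter, decide_eq_true_eq]
  constructor
  · rintro ⟨y, hy, ⟨he, rfl⟩, hr⟩
    exact ⟨he, hy, hr⟩
  · rintro ⟨he, hy, hr⟩
    exact ⟨_, hy, ⟨he, rfl⟩, hr⟩

theorem arcs_nodup (C : Choices G) {vs : List V} (hvs : vs.Nodup) (r : EL) :
    (arcs C vs r).Nodup := by
  unfold arcs
  rw [List.nodup_flatMap]
  refine ⟨fun y _ => (C.edges_nodup.filter _).filter _, hvs.imp fun {y y'} hne e he he' => ?_⟩
  simp only [List.mem_filter, decide_eq_true_eq] at he he'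
  exact hne (he.1.2.symm.trans he'.1.2)

/-- The attributes that never change after the construction of the edges. -/
structure Static (C : Choices G) (s : State V EL) : Prop where
  coming : ∀ y, (s.vertex y).comingEdges = C.edges.filter fun e => e.2.2 = y
  label : ∀ e, (s.edge e).label = e.2.1
  origin : ∀ e, (s.edge e).origin = e.1
  degree : ∀ e, (s.edge e).degree = G.degree e

/-- Flattens the double loop into one loop over `arcs`. The invariant has to imply `Static` because
the incoming edges and the labels are read from the current state, not from the initial one. Edges
with another label change neither the state nor the filtered prefix. -/
theorem forComingEdges_spec {C : Choices G} {vs : List V} (hvs : vs.Nodup) {r : EL}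
    {body : V × EL × V → Cmd V EL} (I : List (V × EL × V) → State V EL → Prop)
    (hI : ∀ D s, I D s → Static C s) {s : State V EL} (h0 : I [] s)
    (hstep : ∀ D e s, e ∈ arcs C vs r → e ∉ D → D ⊆ arcs C vs r → I D s →
      ∃ s', body e s = some s' ∧ I (D ++ [e]) s') :
    ∃ s', forComingEdges vs r body s = some s' ∧ I (arcs C vs r) s' := by
  have hnd := arcs_nodup C hvs r
  refine forEach_spec (fun D s => I (arcs C D r) s) h0 fun D y R s hl hD => ?_
  rw [(hI _ _ hD).coming y]
  obtain ⟨s', hs', hI'⟩ := forEach_spec (l := C.edges.filter fun e => e.2.2 = y)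
    (body := fun e s => if (s.edge e).label ≠ r then some s else body e s)
    (fun D' s => I (arcs C D r ++ D'.filter fun e => e.2.1 = r) s) (s := s) (by simpa using hD)
    (fun D' e R' s hl' hI' => by
      have hsplit : arcs C vs r = (arcs C D r ++ D'.filter (fun e => e.2.1 = r)) ++
          (((e :: R').filter fun e => e.2.1 = r) ++ arcs C R r) := by
        rw [hl]
        simp only [arcs, List.flatMap_append, List.flatMap_cons, hl', List.filter_append,
          List.append_assoc]
      by_cases hr : e.2.1 = r
      · have hsplit' := hsplit
        rw [List.filter_cons_of_pos (by simpa using hr)] at hsplit'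
        obtain ⟨s', hs', hI''⟩ := hstep (arcs C D r ++ D'.filter fun e => e.2.1 = r) e s
          (by rw [hsplit']; simp)
          (fun he => by
            rw [hsplit'] at hnd
            exact (List.nodup_append.1 hnd).2.2 e he e (by simp) rfl)
          (by rw [hsplit]; exact List.subset_append_left _ _) hI'
        refine ⟨s', ?_, ?_⟩
        · rw [(hI _ _ hI').label e, if_neg (by simpa using hr), hs']
        · simpa [List.filter_append, hr] using hI''
      · refine ⟨s, ?_, ?_⟩
        · rw [(hI _ _ hI').label e, if_pos hr]
        · simpa [List.filter_append, hr] using hI')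
  refine ⟨s', hs', ?_⟩
  simpa [arcs, List.flatMap_append] using hI'

end CompCB2

end

section

namespace CompCB2

variable {V VL EL : Type*}

/-! ## Super-blocks -/

/-- The super-blocks of `ℚ[r]`. -/
def superBlocksOf (s : State V EL) (r : EL) : List ℕ :=
  (s.superPartition r).compound ++ (s.superPartition r).simple

/-- The partition, the super-partitions and the super-blocks fit together; `pending b r` says that
the attribute `superBlocks[r]` of the block `b` may still be unset. -/
structure SupInv (s : State V EL) (pending : ℕ → EL → Prop) : Prop where
  partition_nodup : s.partition.Nodup
  partition_lt : ∀ b ∈ s.partition, b < s.nextBlock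
  nodup : ∀ r, (superBlocksOf s r).Nodup
  lt : ∀ r, ∀ sb ∈ superBlocksOf s r, sb < s.nextSuperBlock
  superPartition : ∀ r, ∀ sb ∈ superBlocksOf s r, (s.superBlock sb).superPartition = some r
  blocks_nodup : ∀ r, ∀ sb ∈ superBlocksOf s r, (s.superBlock sb).blocks.Nodup
  mem_blocks : ∀ r, ∀ sb ∈ superBlocksOf s r, ∀ b, b ∈ (s.superBlock sb).blocks ↔
    b ∈ s.partition ∧ (s.block b).superBlocks r = some sb
  mem_compound : ∀ r, ∀ sb ∈ superBlocksOf s r,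
    (sb ∈ (s.superPartition r).compound ↔ 1 < (s.superBlock sb).blocks.length)
  exists_superBlock : ∀ b ∈ s.partition, ∀ r, ¬ pending b r →
    ∃ sb ∈ superBlocksOf s r, (s.block b).superBlocks r = some sb

theorem SupInv.eq_of_mem {s : State V EL} {pending : ℕ → EL → Prop} (h : SupInv s pending)
    {r r' : EL} {sb : ℕ} (hr : sb ∈ superBlocksOf s r) (hr' : sb ∈ superBlocksOf s r') :
    r = r' :=
  Option.some_injective _ ((h.superPartition r sb hr).symm.trans (h.superPartition r' sb hr'))

/-- The super-block of `ℚ[r]` that contains `x`. -/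
def superBlockOf (s : State V EL) (r : EL) (x : V) : Option ℕ :=
  (s.vertex x).block.bind fun b => (s.block b).superBlocks r

section

variable [DecidableEq EL]

/-- Adding a block to a super-block. -/
theorem addBlock_spec {s : State V EL} {pending pending' : ℕ → EL → Prop}
    (h : SupInv s pending) {r : EL} {b sb : ℕ} (hb : b ∈ s.partition)
    (hnone : (s.block b).superBlocks r = none) (hsb : sb ∈ superBlocksOf s r)
    (hp : ∀ b' r', pending b' r' → pending' b' r' ∨ (b' = b ∧ r' = r)) :
    ∃ SB SP, ∃ s', addBlock sb b (modBlock b (fun B =>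
        { B with superBlocks := Function.update B.superBlocks r (some sb) }) s) = some s' ∧
      s' = { modBlock b (fun B =>
        { B with superBlocks := Function.update B.superBlocks r (some sb) }) s with
          superBlock := SB, superPartition := SP } ∧
      SupInv s' pending' ∧ ∀ r', (superBlocksOf s' r').Perm (superBlocksOf s r') := by
  have hbn : b ∉ (s.superBlock sb).blocks := fun hm => by
    rw [h.mem_blocks r sb hsb b, hnone] at hm
    exact absurd hm.2 (by simp)
  set f : Block V EL → Block V EL := fun B =>
    { B with superBlocks := Function.update B.superBlocks r (some sb) } with hf
  set SB := Function.update s.superBlock sb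
    { s.superBlock sb with blocks := (s.superBlock sb).blocks ++ [b] } with hSB
  -- The two cases below differ only in the lists of the super-partition. It suffices that these are
  -- permuted and that `compound` still holds exactly the super-blocks with more than one block.
  have key : ∀ SP : EL → SuperPartition, ∀ s' : State V EL,
      s' = { modBlock b f s with superBlock := SB, superPartition := SP } →
      (∀ r', (superBlocksOf s' r').Perm (superBlocksOf s r')) →
      (∀ r', ∀ sb' ∈ superBlocksOf s r',
        (sb' ∈ (SP r').compound ↔ 1 < (SB sb').blocks.length)) → SupInv s' pending' := by
    rintro SP s' rfl hperm hcomp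
    have hmem := fun r' sb' => (hperm r').mem_iff (a := sb')
    constructor
    · exact h.partition_nodup
    · exact h.partition_lt
    · exact fun r' => (hperm r').nodup_iff.2 (h.nodup r')
    · exact fun r' sb' hs => h.lt r' sb' ((hmem _ _).1 hs)
    · intro r' sb' hs
      have := h.superPartition r' sb' ((hmem _ _).1 hs)
      by_cases he : sb' = sb
      · subst he; simpa [hSB] using this
      · simpa [hSB, he] using this
    · intro r' sb' hs
      have := h.blocks_nodup r' sb' ((hmem _ _).1 hs)
      by_cases he : sb' = sb
      · subst he
        simpa [hSB, List.nodup_append, this] using fun a ha (hab : a = b) => hbn (hab ▸ ha)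
      · simpa [hSB, he] using this
    · intro r' sb' hs b'
      have hm := h.mem_blocks r' sb' ((hmem _ _).1 hs) b'
      by_cases he : sb' = sb
      · subst he
        obtain rfl := h.eq_of_mem hsb ((hmem _ _).1 hs)
        by_cases hbb : b' = b
        · subst hbb; simp [hSB, hf, modBlock, hb]
        · simp [hSB, modBlock, hbb, hm]
      · by_cases hbb : b' = b
        · subst hbb
          by_cases hrr : r' = r
          · subst hrr
            simp [hSB, he, hf, modBlock, hm, hnone, Ne.symm he]
          · simp [hSB, he, hf, modBlock, hm, hrr]
        · simp [hSB, he, modBlock, hbb, hm]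
    · exact fun r' sb' hs => hcomp r' sb' ((hmem _ _).1 hs)
    · intro b' hb' r' hp'
      by_cases hbr : b' = b ∧ r' = r
      · obtain ⟨rfl, rfl⟩ := hbr
        exact ⟨sb, (hmem _ _).2 hsb, by simp [hf, modBlock]⟩
      · obtain ⟨sb', hs, he⟩ := h.exists_superBlock b' hb' r' fun hpp =>
          (hp _ _ hpp).elim hp' hbr
        refine ⟨sb', (hmem _ _).2 hs, ?_⟩
        by_cases hbb : b' = b
        · subst hbb
          have : r' ≠ r := fun h => hbr ⟨rfl, h⟩
          simpa [hf, modBlock, this] using he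
        · simpa [modBlock, hbb] using he
  have hsp := h.superPartition r sb hsb
  have hcomp := h.mem_compound r sb hsb
  have hother : ∀ r', r' ≠ r → ∀ sb' ∈ superBlocksOf s r', sb' ≠ sb := fun r' hr' sb' hs he =>
    hr' (h.eq_of_mem (he ▸ hs) hsb)
  -- The super-block changes its list exactly when the added block is its second one.
  by_cases hlen : (s.superBlock sb).blocks.length = 1
  · have hsimple : sb ∈ (s.superPartition r).simple :=
      (List.mem_append.1 hsb).resolve_left fun hc => by
        have := hcomp.1 hc
        omega
    have hperm : ∀ r', (superBlocksOf { modBlock b f s with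
        superBlock := SB
        superPartition := Function.update s.superPartition r
          { compound := (s.superPartition r).compound ++ [sb],
            simple := (s.superPartition r).simple.erase sb } } r').Perm (superBlocksOf s r') := by
      intro r'
      by_cases hrr : r' = r
      · subst hrr
        simp only [superBlocksOf, Function.update_self, List.append_assoc]
        exact (List.perm_cons_erase hsimple).symm.append_left _
      · simp [superBlocksOf, hrr]
    refine ⟨SB, _, _, ?_, rfl, key _ _ rfl hperm ?_, hperm⟩
    · simp [addBlock, modSuperBlock, modBlock, modSuperPartition, hSB, hlen, hsp]
    · intro r' sb' hs
      by_cases he : sb' = sb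
      · subst he
        obtain rfl := h.eq_of_mem hsb hs
        simp [hSB, hlen]
      · have := h.mem_compound r' sb' hs
        by_cases hrr : r' = r
        · subst hrr; simp [hSB, he, this]
        · simp [hSB, he, hrr, this]
  -- With no block or at least two blocks before, the added block does not affect whether there is
  -- more than one.
  · have hperm : ∀ r', (superBlocksOf { modBlock b f s with
        superBlock := SB, superPartition := s.superPartition } r').Perm (superBlocksOf s r') :=
      fun r' => List.Perm.refl _
    refine ⟨SB, s.superPartition, _, ?_, rfl, key _ _ rfl hperm ?_, hperm⟩
    · simp [addBlock, modSuperBlock, modBlock, hSB, hlen]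
    · intro r' sb' hs
      have := h.mem_compound r' sb' hs
      by_cases he : sb' = sb
      · subst he
        simp only [hSB, Function.update_self, List.length_append, List.length_singleton, this]
        obtain rfl := h.eq_of_mem hsb hs
        omega
      · simp [hSB, he, this]

variable [DecidableEq V]

theorem forEach_modVertex_block (vl : List V) (b : ℕ) (s : State V EL) :
    forEach vl (fun x s => some (modVertex x (fun v => { v with block := some b }) s)) s =
      some { s with vertex := fun x =>
        if x ∈ vl then { s.vertex x with block := some b } else s.vertex x } := by
  induction vl generalizing s with
  | nil => simp [forEach]
  | cons a l ih =>
    rw [forEach, Option.bind_some, ih]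
    simp only [modVertex, Option.some.injEq]
    congr 1
    funext x
    by_cases hx : x = a
    · subst hx; simp
    · simp [hx]

variable {G : FuzzyGraph V VL EL}

/-- While the constructor runs through the labels, the new block is in `ℙ` already but registered
with only some super-blocks; `pending` in `SupInv` exists for this interval. The tables of
super-blocks and super-partitions are left unspecified, since the invariant and the permutation are
all that is needed of them. -/
theorem newBlock_spec (C : Choices G) {s : State V EL} (h : SupInv s fun _ _ => False)
    (vl : List V) {m : EL → Option ℕ} (hm : ∀ r, ∃ sb ∈ superBlocksOf s r, m r = some sb) :
    ∃ SB SP, ∃ s', newBlock C vl (some m) s = some s' ∧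
      s' = { s with
        vertex := fun x =>
          if x ∈ vl then { s.vertex x with block := some s.nextBlock } else s.vertex x
        block := Function.update s.block s.nextBlock ⟨vl, m, ∅, ∅⟩
        nextBlock := s.nextBlock + 1
        partition := s.partition ++ [s.nextBlock]
        superBlock := SB
        superPartition := SP } ∧
      SupInv s' (fun _ _ => False) ∧ ∀ r, (superBlocksOf s' r).Perm (superBlocksOf s r) := by
  have hnew : s.nextBlock ∉ s.partition := fun hc => (h.partition_lt _ hc).false
  have hne : ∀ b ∈ s.partition, b ≠ s.nextBlock := fun b hb => (h.partition_lt _ hb).ne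
  set st : List EL → (ℕ → SuperBlock EL) → (EL → SuperPartition) → State V EL :=
    fun D SB SP => { s with
        vertex := fun x =>
          if x ∈ vl then { s.vertex x with block := some s.nextBlock } else s.vertex x
        block := Function.update s.block s.nextBlock
          ⟨vl, fun r => if r ∈ D then m r else none, ∅, ∅⟩
        nextBlock := s.nextBlock + 1
        partition := s.partition ++ [s.nextBlock]
        superBlock := SB
        superPartition := SP } with hst
  have := forEach_spec_nodup C.labels_nodup (body := fun r s' =>
      (m r).bind fun sb => addBlock sb s.nextBlock (modBlock s.nextBlock (fun B =>
        { B with superBlocks := Function.update B.superBlocks r (some sb) }) s'))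
    (fun D s' => (∃ SB SP, s' = st D SB SP) ∧
      SupInv s' (fun b r => b = s.nextBlock ∧ r ∉ D) ∧
      ∀ r, (superBlocksOf s' r).Perm (superBlocksOf s r))
    (s := st [] s.superBlock s.superPartition) ?_ ?_
  · obtain ⟨s', hs', ⟨SB, SP, rfl⟩, hinv, hperm⟩ := this
    refine ⟨SB, SP, _, ?_, ?_, ⟨hinv.1, hinv.2, hinv.3, hinv.4, hinv.5, hinv.6, hinv.7, hinv.8,
      fun b hb r _ => hinv.exists_superBlock b hb r fun hc => hc.2 (C.mem_labels r)⟩, hperm⟩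
    · simp only [newBlock, forEach_modVertex_block, Option.bind_some, modBlock]
      rw [← hs']
      simp only [hst, List.not_mem_nil, if_false]
      rfl
    · simp [hst, C.mem_labels]
  · refine ⟨⟨_, _, rfl⟩, ?_, fun r => List.Perm.refl _⟩
    constructor
    · simpa [hst, List.nodup_append, h.partition_nodup] using hne
    · intro b hb
      simp only [hst, List.mem_append, List.mem_singleton] at hb ⊢
      rcases hb with hb | rfl
      · exact (h.partition_lt b hb).trans (Nat.lt_succ_self _)
      · exact Nat.lt_succ_self _
    · exact h.nodup
    · exact h.lt
    · exact h.superPartition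
    · exact h.blocks_nodup
    · intro r sb hs b
      refine (h.mem_blocks r sb hs b).trans ?_
      by_cases hb : b = s.nextBlock
      · subst hb; simp [hst, hnew]
      · simp [hst, hb]
    · exact h.mem_compound
    · intro b hb r hp
      have hbn : b ≠ s.nextBlock := fun hc => hp ⟨hc, by simp⟩
      simp only [hst, List.mem_append, List.mem_singleton, hbn, or_false] at hb
      obtain ⟨sb, hs, he⟩ := h.exists_superBlock b hb r (by simp)
      exact ⟨sb, hs, by simpa [hst, hbn] using he⟩
  · rintro D r s' hr hrD - ⟨⟨SB, SP, rfl⟩, hinv, hperm⟩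
    obtain ⟨sb, hsb, hmr⟩ := hm r
    obtain ⟨SB', SP', s', hs', rfl, hinv', hperm'⟩ := addBlock_spec (r := r) (b := s.nextBlock)
      (pending' := fun b r' => b = s.nextBlock ∧ r' ∉ D ++ [r]) hinv (by simp [hst])
      (by simp [hst, hrD]) ((hperm r).mem_iff.2 hsb) (by
        rintro b' r' ⟨rfl, h'⟩
        by_cases hrr : r' = r
        · exact Or.inr ⟨rfl, hrr⟩
        · exact Or.inl ⟨rfl, by simp [h', hrr]⟩)
    refine ⟨_, by rw [hmr, Option.bind_some, hs'], ⟨SB', SP', ?_⟩, hinv',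
      fun r' => (hperm' r').trans (hperm r')⟩
    simp only [hst, modBlock, Function.update_self, Function.update_idem]
    congr 2
    simp only [Block.mk.injEq, true_and, and_true]
    funext r'
    by_cases hrr : r' = r
    · subst hrr; simp [hmr]
    · simp [hrr]

end

/-! ## Blocks -/

/-- The blocks and their departing maps fit together: `c x` is `none` if `x` belongs to the vertex
list of its block, and otherwise the key of the list (given by `dep`) to which it was moved. -/
structure BlkInv (s : State V EL) (c : V → Option (Bool × Degree))
    (dep : ℕ → Bool × Degree → Option (List V)) : Prop where
  exists_block : ∀ x, ∃ b ∈ s.partition, (s.vertex x).block = some b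
  vertices_nodup : ∀ b ∈ s.partition, (s.block b).vertices.Nodup
  mem_vertices : ∀ b ∈ s.partition, ∀ x, x ∈ (s.block b).vertices ↔
    (s.vertex x).block = some b ∧ c x = none
  dep_ne_nil : ∀ b ∈ s.partition, ∀ k l, dep b k = some l → l ≠ []
  dep_nodup : ∀ b ∈ s.partition, ∀ k l, dep b k = some l → l.Nodup
  mem_dep : ∀ b ∈ s.partition, ∀ k l, dep b k = some l →
    ∀ x, x ∈ l ↔ (s.vertex x).block = some b ∧ c x = some k
  of_dep_eq_none : ∀ b ∈ s.partition, ∀ k, dep b k = none →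
    ∀ x, (s.vertex x).block = some b → c x ≠ some k
  nonempty : ∀ b ∈ s.partition, ∃ x, (s.vertex x).block = some b

/-- The departing maps of the blocks. -/
def departing (s : State V EL) (b : ℕ) (k : Bool × Degree) : Option (List V) :=
  if k.1 = true then (s.block b).departing₂.lookup k.2 else (s.block b).departing₁.lookup k.2

/-- What is not changed by splitting blocks inside of their super-blocks. -/
structure Frame (s s' : State V EL) : Prop where
  edge : s'.edge = s.edge
  blockEdge : s'.blockEdge = s.blockEdge
  nextBlockEdge : s'.nextBlockEdge = s.nextBlockEdge
  nextSuperBlock : s'.nextSuperBlock = s.nextSuperBlock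
  coming : ∀ x, (s'.vertex x).comingEdges = (s.vertex x).comingEdges
  processed : ∀ x, (s'.vertex x).processed = (s.vertex x).processed
  superBlockOf : ∀ r x, superBlockOf s' r x = superBlockOf s r x
  perm : ∀ r, (superBlocksOf s' r).Perm (superBlocksOf s r)

theorem Frame.refl (s : State V EL) : Frame s s :=
  ⟨rfl, rfl, rfl, rfl, fun _ => rfl, fun _ => rfl, fun _ _ => rfl, fun _ => List.Perm.refl _⟩

theorem Frame.trans {s s' s'' : State V EL} (h : Frame s s') (h' : Frame s' s'') : Frame s s'' :=
  ⟨h'.1.trans h.1, h'.2.trans h.2, h'.3.trans h.3, h'.4.trans h.4,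
    fun x => (h'.5 x).trans (h.5 x), fun x => (h'.6 x).trans (h.6 x),
    fun r x => (h'.7 r x).trans (h.7 r x), fun r => (h'.8 r).trans (h.8 r)⟩

/-- Blocks together with keys of departing maps induce the same equivalence relation. -/
def SameKernel (s s' : State V EL) (c c' : V → Option (Bool × Degree)) : Prop :=
  ∀ x x', ((s'.vertex x).block = (s'.vertex x').block ∧ c' x = c' x') ↔
    ((s.vertex x).block = (s.vertex x').block ∧ c x = c x')

theorem SameKernel.trans {s s' s'' : State V EL} {c c' c'' : V → Option (Bool × Degree)}
    (h : SameKernel s s' c c') (h' : SameKernel s' s'' c' c'') : SameKernel s s'' c c'' :=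
  fun x x' => (h' x x').trans (h x x')

variable [DecidableEq V]

/-- The keys of the vertices after the list `l` was made the vertex list of a block. -/
def settle (c : V → Option (Bool × Degree)) (l : List V) (x : V) : Option (Bool × Degree) :=
  if x ∈ l then none else c x

/-- Keeping one of the subblocks in a block whose vertex list is empty. -/
theorem BlkInv.keep {s s' : State V EL} {c : V → Option (Bool × Degree)}
    {dep dep' : ℕ → Bool × Degree → Option (List V)} (h : BlkInv s c dep) {bx : ℕ}
    (hbx : bx ∈ s.partition) {k : Bool × Degree} {l : List V} (hl : dep bx k = some l)
    (hnil : (s.block bx).vertices = []) (hv : s'.vertex = s.vertex)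
    (hp : s'.partition = s.partition)
    (hb : ∀ b, b ≠ bx → (s'.block b).vertices = (s.block b).vertices)
    (hb' : (s'.block bx).vertices = l)
    (hd : ∀ b ∈ s.partition, ∀ k', (b = bx ∧ k' = k ∧ dep' b k' = none) ∨
      (¬ (b = bx ∧ k' = k) ∧ dep' b k' = dep b k')) :
    BlkInv s' (settle c l) dep' ∧ SameKernel s s' c (settle c l) := by
  have hmem := h.mem_dep bx hbx k l hl
  -- Every vertex of `bx` carries a key, as the vertex list is empty. So resetting the keys of `l`
  -- to `none` does not merge `l` with other vertices of `bx`.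
  have hno : ∀ x, (s.vertex x).block = some bx → c x ≠ none := fun x hx hc => by
    have := (h.mem_vertices bx hbx x).2 ⟨hx, hc⟩
    simp [hnil] at this
  refine ⟨?_, ?_⟩
  · constructor
    · rw [hv, hp]; exact h.exists_block
    · intro b hbp
      rw [hp] at hbp
      by_cases hbb : b = bx
      · subst hbb; rw [hb']; exact h.dep_nodup b hbp k l hl
      · rw [hb b hbb]; exact h.vertices_nodup b hbp
    · intro b hbp x
      rw [hp] at hbp
      by_cases hbb : b = bx
      · subst hbb
        rw [hb', hmem, hv]
        constructor
        · rintro ⟨h1, h2⟩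
          exact ⟨h1, by simp [settle, (hmem x).2 ⟨h1, h2⟩]⟩
        · rintro ⟨h1, h2⟩
          unfold settle at h2
          split_ifs at h2 with hx
          · exact (hmem x).1 hx
          · exact absurd h2 (hno x h1)
      · rw [hb b hbb, h.mem_vertices b hbp x, hv]
        refine and_congr_right fun h1 => ?_
        have : x ∉ l := fun hx => hbb (Option.some_injective _ (h1.symm.trans ((hmem x).1 hx).1))
        simp [settle, this]
    · intro b hbp k' l' h'
      rw [hp] at hbp
      rcases hd b hbp k' with ⟨-, -, h0⟩ | ⟨-, h0⟩
      · simp [h0] at h'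
      · exact h.dep_ne_nil b hbp k' l' (h0 ▸ h')
    · intro b hbp k' l' h'
      rw [hp] at hbp
      rcases hd b hbp k' with ⟨-, -, h0⟩ | ⟨-, h0⟩
      · simp [h0] at h'
      · exact h.dep_nodup b hbp k' l' (h0 ▸ h')
    · intro b hbp k' l' h' x
      rw [hp] at hbp
      rcases hd b hbp k' with ⟨-, -, h0⟩ | ⟨hne, h0⟩
      · simp [h0] at h'
      · rw [h.mem_dep b hbp k' l' (h0 ▸ h') x, hv]
        refine and_congr_right fun h1 => ?_
        unfold settle
        split_ifs with hx
        · obtain ⟨h2, h3⟩ := (hmem x).1 hx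
          refine iff_of_false (fun h4 => hne ⟨?_, ?_⟩) (by simp)
          · exact Option.some_injective _ (h1.symm.trans h2)
          · exact Option.some_injective _ (h4.symm.trans h3)
        · rfl
    · intro b hbp k' h' x hx hc
      rw [hp] at hbp
      rw [hv] at hx
      unfold settle at hc
      split_ifs at hc with hxl
      rcases hd b hbp k' with ⟨rfl, rfl, -⟩ | ⟨-, h0⟩
      · exact hxl ((hmem x).2 ⟨hx, hc⟩)
      · exact h.of_dep_eq_none b hbp k' (h0 ▸ h') x hx hc
    · rw [hv, hp]; exact h.nonempty
  · intro x x'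
    rw [hv]
    refine and_congr_right fun h1 => ?_
    unfold settle
    split_ifs with hx hx' hx'
    · simp [((hmem x).1 hx).2, ((hmem x').1 hx').2]
    · obtain ⟨h2, h3⟩ := (hmem x).1 hx
      have h4 := hno x' (h1 ▸ h2)
      refine iff_of_false (fun h => h4 h.symm) fun h => hx' ((hmem x').2 ⟨h1 ▸ h2, h ▸ h3⟩)
    · obtain ⟨h2, h3⟩ := (hmem x').1 hx'
      have h4 := hno x (h1 ▸ h2)
      refine iff_of_false (fun h => h4 h) fun h => hx ((hmem x).2 ⟨h1 ▸ h2, h ▸ h3⟩)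
    · rfl

/-- Making one of the subblocks a new block. -/
theorem BlkInv.create {s s' : State V EL} {c : V → Option (Bool × Degree)}
    {dep dep' : ℕ → Bool × Degree → Option (List V)} (h : BlkInv s c dep) {bx : ℕ}
    (hbx : bx ∈ s.partition) {k : Bool × Degree} {l : List V} (hl : dep bx k = some l)
    (hne : (s.block bx).vertices ≠ []) {n : ℕ} (hn : n ∉ s.partition)
    (hv : ∀ x, (s'.vertex x).block = if x ∈ l then some n else (s.vertex x).block)
    (hp : s'.partition = s.partition ++ [n])
    (hb : ∀ b ∈ s.partition, (s'.block b).vertices = (s.block b).vertices)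
    (hb' : (s'.block n).vertices = l) (hn' : ∀ k, dep' n k = none)
    (hd : ∀ b ∈ s.partition, ∀ k', (b = bx ∧ k' = k ∧ dep' b k' = none) ∨
      (¬ (b = bx ∧ k' = k) ∧ dep' b k' = dep b k')) :
    BlkInv s' (settle c l) dep' ∧ SameKernel s s' c (settle c l) := by
  have hmem := h.mem_dep bx hbx k l hl
  have hmp : ∀ b, b ∈ s'.partition → b ≠ n → b ∈ s.partition := fun b hbp hbn => by
    rw [hp] at hbp
    simpa [hbn] using hbp
  -- The address `n` is unused before. Therefore the new block separates `l` from all other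
  -- vertices, just as the key `k` and the block `bx` did before.
  have hvn : ∀ x, (s.vertex x).block ≠ some n := fun x hx => by
    obtain ⟨b, hb, he⟩ := h.exists_block x
    rw [hx] at he
    exact hn (Option.some_injective _ he ▸ hb)
  have hvn' : ∀ x, (s'.vertex x).block = some n ↔ x ∈ l := fun x => by
    rw [hv]
    split_ifs with hx <;> simp [hx, hvn]
  have hvb : ∀ b ≠ n, ∀ x, (s'.vertex x).block = some b ↔ x ∉ l ∧ (s.vertex x).block = some b :=
    fun b hbn x => by
      rw [hv]
      split_ifs with hx
      · simp [hx, Ne.symm hbn]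
      · simp [hx]
  refine ⟨?_, ?_⟩
  · constructor
    · intro x
      by_cases hx : x ∈ l
      · exact ⟨n, by simp [hp], (hvn' x).2 hx⟩
      · obtain ⟨b, hb, he⟩ := h.exists_block x
        exact ⟨b, by simp [hp, hb], by rw [hv, if_neg hx, he]⟩
    · intro b hbp
      by_cases hbn : b = n
      · subst hbn; rw [hb']; exact h.dep_nodup bx hbx k l hl
      · rw [hb b (hmp b hbp hbn)]; exact h.vertices_nodup b (hmp b hbp hbn)
    · intro b hbp x
      by_cases hbn : b = n
      · subst hbn
        rw [hb', hvn']
        exact ⟨fun hx => ⟨hx, by simp [settle, hx]⟩, fun hx => hx.1⟩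
      · rw [hb b (hmp b hbp hbn), h.mem_vertices b (hmp b hbp hbn) x, hvb b hbn]
        by_cases hx : x ∈ l
        · simp [hx, ((hmem x).1 hx).2]
        · simp [hx, settle]
    · intro b hbp k' l' h'
      by_cases hbn : b = n
      · subst hbn; simp [hn'] at h'
      · rcases hd b (hmp b hbp hbn) k' with ⟨-, -, h0⟩ | ⟨-, h0⟩
        · simp [h0] at h'
        · exact h.dep_ne_nil b (hmp b hbp hbn) k' l' (h0 ▸ h')
    · intro b hbp k' l' h'
      by_cases hbn : b = n
      · subst hbn; simp [hn'] at h'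
      · rcases hd b (hmp b hbp hbn) k' with ⟨-, -, h0⟩ | ⟨-, h0⟩
        · simp [h0] at h'
        · exact h.dep_nodup b (hmp b hbp hbn) k' l' (h0 ▸ h')
    · intro b hbp k' l' h' x
      by_cases hbn : b = n
      · subst hbn; simp [hn'] at h'
      · rcases hd b (hmp b hbp hbn) k' with ⟨-, -, h0⟩ | ⟨hne, h0⟩
        · simp [h0] at h'
        · rw [h.mem_dep b (hmp b hbp hbn) k' l' (h0 ▸ h') x, hvb b hbn]
          by_cases hx : x ∈ l
          · obtain ⟨h2, h3⟩ := (hmem x).1 hx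
            refine iff_of_false (fun h4 => hne ⟨?_, ?_⟩) (fun h4 => h4.1.1 hx)
            · exact Option.some_injective _ (h4.1.symm.trans h2)
            · exact Option.some_injective _ (h4.2.symm.trans h3)
          · simp [settle, hx]
    · intro b hbp k' h' x hx hc
      unfold settle at hc
      split_ifs at hc with hxl
      by_cases hbn : b = n
      · subst hbn; exact hxl ((hvn' x).1 hx)
      · have hx := ((hvb b hbn x).1 hx).2
        rcases hd b (hmp b hbp hbn) k' with ⟨rfl, rfl, -⟩ | ⟨-, h0⟩
        · exact hxl ((hmem x).2 ⟨hx, hc⟩)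
        · exact h.of_dep_eq_none b (hmp b hbp hbn) k' (h0 ▸ h') x hx hc
    · intro b hbp
      by_cases hbn : b = n
      · subst hbn
        obtain ⟨x, hx⟩ := List.exists_mem_of_ne_nil l (h.dep_ne_nil bx hbx k l hl)
        exact ⟨x, (hvn' x).2 hx⟩
      · by_cases hbb : b = bx
        · subst hbb
          -- The block `bx` keeps the vertices of its non-empty vertex list: these have no key,
          -- while those that leave have the key `k`.
          obtain ⟨x, hx⟩ := List.exists_mem_of_ne_nil _ hne
          obtain ⟨h1, h2⟩ := (h.mem_vertices b hbx x).1 hx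
          exact ⟨x, (hvb b hbn x).2 ⟨fun hxl => by simp [((hmem x).1 hxl).2] at h2, h1⟩⟩
        · obtain ⟨x, hx⟩ := h.nonempty b (hmp b hbp hbn)
          exact ⟨x, (hvb b hbn x).2 ⟨fun hxl =>
            hbb (Option.some_injective _ (hx.symm.trans ((hmem x).1 hxl).1)), hx⟩⟩
  · intro x x'
    rw [hv, hv]
    unfold settle
    split_ifs with hx hx' hx'
    · obtain ⟨h2, h3⟩ := (hmem x).1 hx
      obtain ⟨h2', h3'⟩ := (hmem x').1 hx'
      simp [h2, h3, h2', h3']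
    · refine iff_of_false (fun h => hvn x' h.1.symm) fun h => hx' ?_
      rw [hmem, ← h.1, ← h.2, ← hmem]
      exact hx
    · refine iff_of_false (fun h => hvn x h.1) fun h => hx ?_
      rw [hmem, h.1, h.2, ← hmem]
      exact hx'
    · rfl

end CompCB2

end

/-! ### Splitting a single block along its departing lists -/

section

namespace CompCB2

variable {V VL EL : Type*}

theorem SupInv.congr {s s' : State V EL} {pending : ℕ → EL → Prop} (h : SupInv s pending)
    (h1 : s'.partition = s.partition) (h2 : s'.nextBlock = s.nextBlock)
    (h3 : s'.superPartition = s.superPartition) (h4 : s'.superBlock = s.superBlock)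
    (h5 : s'.nextSuperBlock = s.nextSuperBlock)
    (h6 : ∀ b, (s'.block b).superBlocks = (s.block b).superBlocks) : SupInv s' pending := by
  have h7 : superBlocksOf s' = superBlocksOf s := by unfold superBlocksOf; rw [h3]
  constructor
  · rw [h1]; exact h.1
  · rw [h1, h2]; exact h.2
  · rw [h7]; exact h.3
  · rw [h7, h5]; exact h.4
  · rw [h7, h4]; exact h.5
  · rw [h7, h4]; exact h.6
  · simp only [h7, h4, h1, h6]; exact h.7
  · rw [h7, h3, h4]; exact h.8
  · simp only [h1, h7, h6]; exact h.9

/-- The entries need to agree only for blocks of `ℙ`. Replacing `dep` by `dep'` serves to pass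
between `departing` and `remaining`. -/
theorem BlkInv.congr {s s' : State V EL} {c : V → Option (Bool × Degree)}
    {dep dep' : ℕ → Bool × Degree → Option (List V)} (h : BlkInv s c dep)
    (h1 : ∀ x, (s'.vertex x).block = (s.vertex x).block) (h2 : s'.partition = s.partition)
    (h3 : ∀ b ∈ s.partition, (s'.block b).vertices = (s.block b).vertices)
    (h4 : ∀ b ∈ s.partition, dep' b = dep b) : BlkInv s' c dep' := by
  constructor
  · simp only [h1, h2]; exact h.1
  · rw [h2]; exact fun b hb => h3 b hb ▸ h.2 b hb
  · simp only [h1, h2]; exact fun b hb => h3 b hb ▸ h.3 b hb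
  · rw [h2]; exact fun b hb => h4 b hb ▸ h.4 b hb
  · rw [h2]; exact fun b hb => h4 b hb ▸ h.5 b hb
  · simp only [h1, h2]; exact fun b hb => h4 b hb ▸ h.6 b hb
  · simp only [h1, h2]; exact fun b hb => h4 b hb ▸ h.7 b hb
  · simp only [h1, h2]; exact h.8

open Classical in
/-- The lists in the departing maps, without those of the block `bx` whose keys are in `done`. -/
def remaining (s : State V EL) (bx : ℕ) (done : Bool × Degree → Prop) (b : ℕ)
    (k : Bool × Degree) : Option (List V) :=
  if b = bx ∧ done k then none else departing s b k

theorem remaining_of_done {s : State V EL} {bx : ℕ} {done : Bool × Degree → Prop}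
    {k : Bool × Degree} (h : done k) : remaining s bx done bx k = none :=
  if_pos ⟨rfl, h⟩

theorem remaining_of_not {s : State V EL} {b bx : ℕ} {done : Bool × Degree → Prop}
    {k : Bool × Degree} (h : ¬ (b = bx ∧ done k)) :
    remaining s bx done b k = departing s b k :=
  if_neg h

variable [DecidableEq V]

/-- The state `s'` is reached from `s` while the block `bx` is being split; the subblocks with the
keys in `done` have been taken from its departing maps `m₁` and `m₂`. -/
structure Splitting (s : State V EL) (c : V → Option (Bool × Degree)) (bx : ℕ)
    (m₁ m₂ : DegreeMap V) (done : Bool × Degree → Prop) (s' : State V EL)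
    (c' : V → Option (Bool × Degree)) : Prop where
  frame : Frame s s'
  sup : SupInv s' fun _ _ => False
  blk : BlkInv s' c' (remaining s' bx done)
  kernel : SameKernel s s' c c'
  mem : bx ∈ s'.partition
  key : ∀ x, c' x = none ∨ c' x = c x
  block : ∀ x, (s.vertex x).block = some bx → (s'.vertex x).block = some bx ∨ c' x = none
  ne_nil : (s'.block bx).vertices ≠ []
  departing₁ : (s'.block bx).departing₁ = m₁
  departing₂ : (s'.block bx).departing₂ = m₂

section

variable [DecidableEq EL] {G : FuzzyGraph V VL EL}

/-- The first vertex of the list still refers to `bx`, so the new block copies the map `superBlocks`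
of `bx` and no vertex changes its super-block. The departing maps of `bx` are not touched; that the
list has been consumed is recorded in `done'` alone. -/
theorem Splitting.create (C : Choices G) {s s' : State V EL}
    {c c' : V → Option (Bool × Degree)} {bx : ℕ} {m₁ m₂ : DegreeMap V}
    {done done' : Bool × Degree → Prop} (h : Splitting s c bx m₁ m₂ done s' c')
    {k : Bool × Degree} (hk : ¬ done k) {l : List V} (hl : departing s' bx k = some l)
    (hdone : ∀ k', done' k' ↔ done k' ∨ k' = k) :
    ∃ s'' c'', createBlock C l s' = some s'' ∧ Splitting s c bx m₁ m₂ done' s'' c'' := by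
  have hnew : s'.nextBlock ∉ s'.partition := fun hc => (h.sup.partition_lt _ hc).false
  have hl' : remaining s' bx done bx k = some l := by
    rw [remaining_of_not (fun hc => hk hc.2), hl]
  have hmem := h.blk.mem_dep bx h.mem k l hl'
  have hne := h.blk.dep_ne_nil bx h.mem k l hl'
  obtain ⟨a, l₀, rfl⟩ := List.exists_cons_of_ne_nil hne
  have ha := ((hmem a).1 (by simp)).1
  obtain ⟨SB, SP, s'', hs'', he, hsup, hperm⟩ := newBlock_spec C h.sup (a :: l₀)
    (m := (s'.block bx).superBlocks) fun r => h.sup.exists_superBlock bx h.mem r id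
  have hblock : ∀ b ∈ s'.partition, s''.block b = s'.block b := fun b hb => by
    rw [he]
    exact Function.update_of_ne (h.sup.partition_lt b hb).ne _ _
  have hblockn : s''.block s'.nextBlock = ⟨a :: l₀, (s'.block bx).superBlocks, ∅, ∅⟩ := by
    rw [he]
    exact Function.update_self _ _ _
  have hv : ∀ x, (s''.vertex x).block =
      if x ∈ a :: l₀ then some s'.nextBlock else (s'.vertex x).block := fun x => by
    rw [he]
    dsimp only
    split_ifs <;> rfl
  have hdep : ∀ b ∈ s'.partition, departing s'' b = departing s' b := fun b hb => by
    unfold departing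
    rw [hblock b hb]
  obtain ⟨hblk, hker⟩ := h.blk.create (s' := s'') (dep' := remaining s'' bx done') h.mem hl'
    h.ne_nil hnew hv (by rw [he]) (fun b hb => by rw [hblock b hb]) (by rw [hblockn])
    (fun k' => by
      rw [remaining_of_not (fun hc => (h.sup.partition_lt bx h.mem).ne hc.1.symm)]
      simp [departing, hblockn])
    (fun b hb k' => by
      by_cases hc : b = bx ∧ k' = k
      · obtain ⟨rfl, rfl⟩ := hc
        exact Or.inl ⟨rfl, rfl, remaining_of_done ((hdone _).2 (Or.inr rfl))⟩
      · refine Or.inr ⟨hc, ?_⟩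
        unfold remaining
        rw [hdep b hb]
        congr 1
        rw [hdone]
        exact propext ⟨fun h => ⟨h.1, h.2.resolve_right fun hk => hc ⟨h.1, hk⟩⟩,
          fun h => ⟨h.1, Or.inl h.2⟩⟩)
  refine ⟨s'', settle c' (a :: l₀), ?_, h.frame.trans ⟨by rw [he], by rw [he], by rw [he],
    by rw [he], ?_, ?_, ?_, hperm⟩, hsup, hblk, h.kernel.trans hker, ?_, ?_, ?_, ?_, ?_, ?_⟩
  · simp only [createBlock, List.head?_cons, Option.bind_some, ha]
    exact hs''
  · intro x
    rw [he]
    dsimp only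
    split_ifs <;> rfl
  · intro x
    rw [he]
    dsimp only
    split_ifs <;> rfl
  · intro r x
    unfold superBlockOf
    rw [hv]
    split_ifs with hx
    · rw [((hmem x).1 hx).1]
      simp [hblockn]
    · obtain ⟨b, hb, hxb⟩ := h.blk.exists_block x
      simp [hxb, hblock b hb]
  · rw [he]
    simp [h.mem]
  · intro x
    unfold settle
    split_ifs
    · exact Or.inl rfl
    · exact h.key x
  · intro x hx
    rw [hv]
    unfold settle
    split_ifs
    · exact Or.inr rfl
    · exact h.block x hx
  · rw [hblock bx h.mem]; exact h.ne_nil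
  · rw [hblock bx h.mem]; exact h.departing₁
  · rw [hblock bx h.mem]; exact h.departing₂

/-- Changes of the vertex list and the departing maps of the block `bx` only. -/
theorem frame_modBlock (s : State V EL) (bx : ℕ) {f : Block V EL → Block V EL}
    (hf : ∀ B, (f B).superBlocks = B.superBlocks) : Frame s (modBlock bx f s) := by
  refine ⟨rfl, rfl, rfl, rfl, fun _ => rfl, fun _ => rfl, fun r x => ?_, fun _ => .refl _⟩
  unfold superBlockOf
  refine congrArg _ (funext fun b => ?_)
  by_cases hb : b = bx
  · subst hb; simp [modBlock, hf]
  · simp [modBlock, hb]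

theorem SupInv.modBlock {s : State V EL} {pending : ℕ → EL → Prop} (h : SupInv s pending)
    (bx : ℕ) {f : Block V EL → Block V EL} (hf : ∀ B, (f B).superBlocks = B.superBlocks) :
    SupInv (modBlock bx f s) pending := by
  refine h.congr rfl rfl rfl rfl rfl fun b => ?_
  by_cases hb : b = bx
  · subst hb; simp [CompCB2.modBlock, hf]
  · simp [CompCB2.modBlock, hb]

/-- The result of leaving the subblock with the key `k` in the block `bx`. -/
theorem Splitting.of_keep {s : State V EL} {c : V → Option (Bool × Degree)}
    (hs : SupInv s fun _ _ => False) (hB : BlkInv s c (departing s)) {bx : ℕ}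
    (hbx : bx ∈ s.partition) (hnil : (s.block bx).vertices = []) {k : Bool × Degree} {l : List V}
    (hl : departing s bx k = some l) {f : Block V EL → Block V EL}
    (hf : ∀ B, (f B).superBlocks = B.superBlocks) (hv : ∀ B, (f B).vertices = l)
    (hdep : ∀ k', departing (modBlock bx f s) bx k' =
      if k' = k then none else departing s bx k') :
    Splitting s c bx (f (s.block bx)).departing₁ (f (s.block bx)).departing₂ (fun _ => False)
      (modBlock bx f s) (settle c l) := by
  have hrem : remaining (modBlock bx f s) bx (fun _ => False) = departing (modBlock bx f s) := by
    funext b k'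
    exact remaining_of_not fun h => h.2
  have hother : ∀ b, b ≠ bx → (modBlock bx f s).block b = s.block b := fun b hb => by
    simp [modBlock, hb]
  have hself : (modBlock bx f s).block bx = f (s.block bx) := by simp [modBlock]
  obtain ⟨hblk, hker⟩ := hB.keep (s' := modBlock bx f s)
    (dep' := departing (modBlock bx f s)) hbx hl hnil rfl rfl
    (fun b hb => by rw [hother b hb]) (by rw [hself, hv]) (fun b hb k' => by
      by_cases hbb : b = bx
      · subst hbb
        rw [hdep]
        by_cases hk : k' = k <;> simp [hk]
      · refine Or.inr ⟨fun h => hbb h.1, ?_⟩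
        unfold departing
        rw [hother b hbb])
  refine ⟨frame_modBlock s bx hf, hs.modBlock bx hf, hrem ▸ hblk, hker, hbx, fun x => ?_,
    fun x hx => Or.inl hx, ?_, by rw [hself], by rw [hself]⟩
  · unfold settle
    split_ifs
    · exact Or.inl rfl
    · exact Or.inr rfl
  · rw [hself, hv]
    exact hB.dep_ne_nil bx hbx k l hl

theorem exists_head_keyOrder (C : Choices G) (s : State V EL) {m : DegreeMap V} (hm : m ≠ ∅) :
    ∃ d l, (C.keyOrder s m.keys).head? = some d ∧ m.lookup d = some l := by
  have hex : ∃ d, d ∈ m := by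
    by_contra! hc
    refine hm (Finmap.ext_lookup fun d => ?_)
    rw [Finmap.lookup_empty, Finmap.lookup_eq_none]
    exact hc d
  obtain ⟨d₀, hd₀⟩ := hex
  have hd₀' := (C.mem_keyOrder s m.keys d₀).2 (Finmap.mem_keys.2 hd₀)
  obtain ⟨d, l, hdl⟩ := List.exists_cons_of_ne_nil (List.ne_nil_of_mem hd₀')
  have hd : d ∈ m := Finmap.mem_keys.1 ((C.mem_keyOrder s m.keys d).1 (by rw [hdl]; simp))
  obtain ⟨vl, hvl⟩ := Finmap.mem_iff.1 hd
  exact ⟨d, vl, by rw [hdl]; rfl, hvl⟩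

/-- Its purpose is the non-empty vertex list in `Splitting`: once it is secured, creating further
blocks never leaves `bx` without vertices. If the list is empty at first, one of the departing maps
has a key, and the lists in these maps are non-empty. -/
theorem keepOneSubblock_spec (C : Choices G) {s : State V EL} {c : V → Option (Bool × Degree)}
    (hs : SupInv s fun _ _ => False) (hB : BlkInv s c (departing s)) {bx : ℕ}
    (hbx : bx ∈ s.partition)
    (hne : ¬ ((s.block bx).departing₁ = ∅ ∧ (s.block bx).departing₂ = ∅)) :
    ∃ s' c' m₁ m₂, keepOneSubblock C bx s = some s' ∧
      Splitting s c bx m₁ m₂ (fun _ => False) s' c' := by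
  unfold keepOneSubblock
  by_cases hnil : (s.block bx).vertices = []
  · rw [if_pos hnil]
    by_cases h1 : (s.block bx).departing₁ = ∅
    · rw [if_neg (by simpa using h1)]
      obtain ⟨d, l, hd, hl⟩ := exists_head_keyOrder C s fun h2 => hne ⟨h1, h2⟩
      rw [hd, Option.bind_some, hl, Option.bind_some]
      refine ⟨_, _, _, _, rfl, Splitting.of_keep hs hB hbx hnil (k := (true, d)) (l := l)
        (by simpa [departing] using hl) (fun _ => rfl) (fun _ => rfl) fun k' => ?_⟩
      obtain ⟨b, d'⟩ := k'
      by_cases hd' : d' = d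
      · subst hd'; cases b <;> simp [departing, modBlock]
      · cases b <;> simp [departing, modBlock, hd', Finmap.lookup_erase_ne]
    · rw [if_pos (by simpa using h1)]
      obtain ⟨d, l, hd, hl⟩ := exists_head_keyOrder C s h1
      rw [hd, Option.bind_some, hl, Option.bind_some]
      refine ⟨_, _, _, _, rfl, Splitting.of_keep hs hB hbx hnil (k := (false, d)) (l := l)
        (by simpa [departing] using hl) (fun _ => rfl) (fun _ => rfl) fun k' => ?_⟩
      obtain ⟨b, d'⟩ := k'
      by_cases hd' : d' = d
      · subst hd'; cases b <;> simp [departing, modBlock]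
      · cases b <;> simp [departing, modBlock, hd', Finmap.lookup_erase_ne]
  · rw [if_neg hnil]
    refine ⟨s, c, _, _, rfl, Frame.refl s, hs, ?_, fun _ _ => Iff.rfl, hbx, fun _ => Or.inr rfl,
      fun _ hx => Or.inl hx, hnil, rfl, rfl⟩
    exact hB.congr (fun _ => rfl) rfl (fun _ _ => rfl) fun b _ => funext fun k =>
      remaining_of_not fun h => h.2

/-- The part of `DoSplitting` that splits the block `bx`. -/
def splitBlock (C : Choices G) (bx : ℕ) : Cmd V EL := fun s =>
  if ¬ ((s.block bx).departing₁ = ∅ ∧ (s.block bx).departing₂ = ∅) then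
    (keepOneSubblock C bx s).bind fun s =>
    (forEach (C.keyOrder s (s.block bx).departing₁.keys) (fun d s =>
      ((s.block bx).departing₁.lookup d).bind fun vl => createBlock C vl s) s).bind fun s =>
    (forEach (C.keyOrder s (s.block bx).departing₂.keys) (fun d s =>
      ((s.block bx).departing₂.lookup d).bind fun vl => createBlock C vl s) s).bind fun s =>
    some (modBlock bx (fun B => { B with departing₁ := ∅, departing₂ := ∅ }) s)
  else some s

/-- The maps of `bx` stay fixed during both loops, and `done` collects the keys that have been
turned into blocks. In the end no list is left for `bx`, so a vertex that started in `bx` either has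
moved to a new block or has no key; in both cases its key is `none`. -/
theorem splitBlock_spec (C : Choices G) {s : State V EL} {c : V → Option (Bool × Degree)}
    (hs : SupInv s fun _ _ => False) (hB : BlkInv s c (departing s)) {bx : ℕ}
    (hbx : bx ∈ s.partition) :
    ∃ s' c', splitBlock C bx s = some s' ∧ Frame s s' ∧ SupInv s' (fun _ _ => False) ∧
      BlkInv s' c' (departing s') ∧ SameKernel s s' c c' ∧ (∀ x, c' x = none ∨ c' x = c x) ∧
      ∀ x, (s.vertex x).block = some bx → c' x = none := by
  unfold splitBlock
  by_cases hne : (s.block bx).departing₁ = ∅ ∧ (s.block bx).departing₂ = ∅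
  · rw [if_neg (not_not.2 hne)]
    refine ⟨s, c, rfl, Frame.refl s, hs, hB, fun _ _ => Iff.rfl, fun _ => Or.inr rfl,
      fun x hx => ?_⟩
    cases hc : c x with
    | none => rfl
    | some k =>
      refine absurd hc (hB.of_dep_eq_none bx hbx k ?_ x hx)
      simp [departing, hne.1, hne.2]
  · rw [if_pos hne]
    obtain ⟨s₁, c₁, m₁, m₂, hs₁, h₁⟩ := keepOneSubblock_spec C hs hB hbx hne
    obtain ⟨s₂, hs₂, c₂, h₂⟩ := forEach_spec_nodup (C.keyOrder_nodup s₁ m₁.keys)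
      (body := fun d s => ((s.block bx).departing₁.lookup d).bind fun vl => createBlock C vl s)
      (fun D s' => ∃ c', Splitting s c bx m₁ m₂ (fun k => k.1 = false ∧ k.2 ∈ D) s' c')
      (s := s₁) ⟨c₁, by simpa using h₁⟩ (by
        rintro D d s' hd hdD - ⟨c', h'⟩
        obtain ⟨vl, hvl⟩ := Finmap.mem_iff.1 (Finmap.mem_keys.1 ((C.mem_keyOrder _ _ _).1 hd))
        obtain ⟨s'', c'', hs'', h''⟩ := h'.create C (k := (false, d)) (l := vl)
          (done' := fun k => k.1 = false ∧ k.2 ∈ D ++ [d]) (by simpa using hdD)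
          (by simpa [departing, h'.departing₁] using hvl) (by
            rintro ⟨b, d'⟩
            cases b <;> simp)
        exact ⟨s'', by rw [h'.departing₁, hvl, Option.bind_some, hs''], c'', h''⟩)
    -- All keys of `m₁` have been consumed and the other degrees have no list in it, so the first
    -- map may count as done altogether.
    have h₂' : Splitting s c bx m₁ m₂ (fun k => k.1 = false ∨ k.2 ∈ ([] : List Degree)) s₂ c₂ := by
      refine { h₂ with blk := h₂.blk.congr (fun _ => rfl) rfl (fun _ _ => rfl) ?_ }
      refine fun b _ => funext fun k => ?_
      by_cases hc : b = bx ∧ k.1 = false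
      · obtain ⟨rfl, hk⟩ := hc
        rw [remaining_of_done (Or.inl hk)]
        by_cases hk' : k.2 ∈ m₁
        · exact (remaining_of_done
            ⟨hk, (C.mem_keyOrder _ _ _).2 (Finmap.mem_keys.2 hk')⟩).symm
        · rw [remaining_of_not fun h => hk'
            (Finmap.mem_keys.1 ((C.mem_keyOrder _ _ _).1 h.2.2))]
          simp [departing, hk, h₂.departing₁, Finmap.lookup_eq_none.2 hk']
      · rw [remaining_of_not fun h => hc ⟨h.1, h.2.resolve_right (by simp)⟩,
          remaining_of_not fun h => hc ⟨h.1, h.2.1⟩]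
    obtain ⟨s₃, hs₃, c₃, h₃⟩ := forEach_spec_nodup (C.keyOrder_nodup s₂ m₂.keys)
      (body := fun d s => ((s.block bx).departing₂.lookup d).bind fun vl => createBlock C vl s)
      (fun D s' => ∃ c', Splitting s c bx m₁ m₂ (fun k => k.1 = false ∨ k.2 ∈ D) s' c')
      (s := s₂) ⟨c₂, h₂'⟩ (by
        rintro D d s' hd hdD - ⟨c', h'⟩
        obtain ⟨vl, hvl⟩ := Finmap.mem_iff.1 (Finmap.mem_keys.1 ((C.mem_keyOrder _ _ _).1 hd))
        obtain ⟨s'', c'', hs'', h''⟩ := h'.create C (k := (true, d)) (l := vl)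
          (done' := fun k => k.1 = false ∨ k.2 ∈ D ++ [d]) (by simpa using hdD)
          (by simpa [departing, h'.departing₂] using hvl) (by
            rintro ⟨b, d'⟩
            cases b <;> simp)
        exact ⟨s'', by rw [h'.departing₂, hvl, Option.bind_some, hs''], c'', h''⟩)
    rw [hs₁, Option.bind_some, h₁.departing₁, hs₂, Option.bind_some, h₂.departing₂, hs₃,
      Option.bind_some]
    have hrem : ∀ k, remaining s₃ bx
        (fun k => k.1 = false ∨ k.2 ∈ C.keyOrder s₂ m₂.keys) bx k = none := fun k => by
      by_cases hk : k.1 = false ∨ k.2 ∈ C.keyOrder s₂ m₂.keys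
      · exact remaining_of_done hk
      · rw [remaining_of_not fun h => hk h.2]
        simp only [not_or, Bool.not_eq_false, C.mem_keyOrder, Finmap.mem_keys] at hk
        simp [departing, hk.1, h₃.departing₂, Finmap.lookup_eq_none.2 hk.2]
    refine ⟨_, c₃, rfl, h₃.frame.trans (frame_modBlock _ _ fun _ => rfl),
      h₃.sup.modBlock _ fun _ => rfl, ?_, h₃.kernel.trans fun _ _ => Iff.rfl, h₃.key,
      fun x hx => ?_⟩
    · refine h₃.blk.congr (fun _ => rfl) rfl (fun b _ => ?_) fun b _ => funext fun k => ?_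
      · by_cases hb : b = bx
        · subst hb; simp [modBlock]
        · simp [modBlock, hb]
      · by_cases hb : b = bx
        · subst hb
          rw [hrem]
          simp [departing, modBlock]
        · rw [remaining_of_not fun h => hb h.1]
          simp [departing, modBlock, hb]
    · rcases h₃.block x hx with h | h
      · cases hc : c₃ x with
        | none => rfl
        | some k => exact absurd hc (h₃.blk.of_dep_eq_none bx h₃.mem k (hrem k) x h)
      · exact h

end

end CompCB2

end

section

namespace CompCB2

variable {V VL EL : Type*} {G : FuzzyGraph V VL EL}

/-! ## Computing the block-edges -/

/-- The edges and the block-edges fit together. -/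
structure EdgeInv (C : Choices G) (s : State V EL) : Prop where
  exists_blockEdge : ∀ e ∈ C.edges, ∃ bE < s.nextBlockEdge, (s.edge e).blockEdge = some bE
  blockEdge_eq_iff : ∀ e ∈ C.edges, ∀ e' ∈ C.edges,
    (s.edge e).blockEdge = (s.edge e').blockEdge ↔ e.1 = e'.1 ∧ e.2.1 = e'.2.1 ∧
      superBlockOf s e.2.1 e.2.2 = superBlockOf s e.2.1 e'.2.2
  map : ∀ e ∈ C.edges, ∀ bE, (s.edge e).blockEdge = some bE →
    (s.blockEdge bE).map = degrees C fun e' => (s.edge e').blockEdge = some bE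
  departing : ∀ e ∈ C.edges, ∀ bE, (s.edge e).blockEdge = some bE →
    (s.blockEdge bE).departing = none
  source : ∀ e ∈ C.edges, ∀ bE, (s.edge e).blockEdge = some bE →
    (s.blockEdge bE).source = none

/-- The state `s'` is reached from `s` by moving the edges in `D` to departing block-edges, which
exist for the block-edges with the property `T`. -/
structure Departed (C : Choices G) (s : State V EL) (D : List (V × EL × V)) (T : ℕ → Prop)
    (s' : State V EL) : Prop where
  eq : s' = { s with blockEdge := s'.blockEdge, nextBlockEdge := s'.nextBlockEdge }
  le : s.nextBlockEdge ≤ s'.nextBlockEdge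
  map : ∀ e ∈ C.edges, ∀ bE, (s.edge e).blockEdge = some bE → (s'.blockEdge bE).map =
    degrees C fun e' => (s.edge e').blockEdge = some bE ∧ e' ∉ D
  source : ∀ e ∈ C.edges, ∀ bE, (s.edge e).blockEdge = some bE →
    (s'.blockEdge bE).source = none
  departing : ∀ e ∈ C.edges, ∀ bE, (s.edge e).blockEdge = some bE →
    ((s'.blockEdge bE).departing ≠ none ↔ T bE)
  new : ∀ e ∈ C.edges, ∀ bE dbE, (s.edge e).blockEdge = some bE →
    (s'.blockEdge bE).departing = some dbE →
    s.nextBlockEdge ≤ dbE ∧ dbE < s'.nextBlockEdge ∧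
    (s'.blockEdge dbE).map = (degrees C fun e' => (s.edge e').blockEdge = some bE ∧ e' ∈ D) ∧
    (s'.blockEdge dbE).source = some bE ∧ (s'.blockEdge dbE).departing = none

/-- Creating a departing block-edge. -/
theorem Departed.create {C : Choices G} {s s' : State V EL} {D : List (V × EL × V)}
    {T T' : ℕ → Prop} (h : Departed C s D T s') (hs : EdgeInv C s) {e : V × EL × V}
    (he : e ∈ C.edges) {bE : ℕ} (hbE : (s.edge e).blockEdge = some bE)
    (hnone : (s'.blockEdge bE).departing = none)
    (hD : ∀ e ∈ D, ∀ bE, (s.edge e).blockEdge = some bE → T bE)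
    (hT : ∀ b, T' b ↔ T b ∨ b = bE) :
    Departed C s D T' (modBlockEdge bE (fun b => { b with departing := some s'.nextBlockEdge })
      (newBlockEdge (some bE) s')) := by
  set s'' := modBlockEdge bE (fun b => { b with departing := some s'.nextBlockEdge })
      (newBlockEdge (some bE) s') with hs''
  -- Block-edges of edges have addresses from before the loop, so they differ from all block-edges
  -- that the loop creates.
  have hlt : ∀ e ∈ C.edges, ∀ b, (s.edge e).blockEdge = some b → b < s.nextBlockEdge :=
    fun e he b hb => by
      obtain ⟨b', hb', hh⟩ := hs.exists_blockEdge e he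
      rw [hb] at hh
      exact Option.some_injective _ hh ▸ hb'
  have hne : bE ≠ s'.nextBlockEdge := ((hlt e he bE hbE).trans_le h.le).ne
  have hself : s''.blockEdge bE =
      { s'.blockEdge bE with departing := some s'.nextBlockEdge } := by
    simp [hs'', modBlockEdge, newBlockEdge, hne]
  have hnew : s''.blockEdge s'.nextBlockEdge = ⟨0, none, some bE⟩ := by
    simp [hs'', modBlockEdge, newBlockEdge, hne.symm]
  have hother : ∀ b, b ≠ bE → b ≠ s'.nextBlockEdge → s''.blockEdge b = s'.blockEdge b :=
    fun b h1 h2 => by simp [hs'', modBlockEdge, newBlockEdge, h1, h2]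
  have hold : ∀ e ∈ C.edges, ∀ b, (s.edge e).blockEdge = some b → b ≠ s'.nextBlockEdge :=
    fun e he b hb => ((hlt e he b hb).trans_le h.le).ne
  have hnext : s''.nextBlockEdge = s'.nextBlockEdge + 1 := rfl
  constructor
  · exact congrArg (fun t : State V EL => { t with
      blockEdge := s''.blockEdge, nextBlockEdge := s''.nextBlockEdge }) h.eq
  · rw [hnext]; exact h.le.trans (Nat.le_succ _)
  · intro e' he' b hb
    rw [← h.map e' he' b hb]
    by_cases hbb : b = bE
    · subst hbb; rw [hself]
    · rw [hother b hbb (hold e' he' b hb)]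
  · intro e' he' b hb
    rw [← h.source e' he' b hb]
    by_cases hbb : b = bE
    · subst hbb; rw [hself]
    · rw [hother b hbb (hold e' he' b hb)]
  · intro e' he' b hb
    rw [hT]
    by_cases hbb : b = bE
    · subst hbb; simp [hself]
    · rw [hother b hbb (hold e' he' b hb), h.departing e' he' b hb]
      simp [hbb]
  · intro e' he' b d hb hd
    by_cases hbb : b = bE
    · subst hbb
      rw [hself] at hd
      obtain rfl : s'.nextBlockEdge = d := Option.some_injective _ hd
      refine ⟨h.le, by rw [hnext]; exact Nat.lt_succ_self _, ?_, by rw [hnew], by rw [hnew]⟩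
      -- The new map is rightly empty: an edge of `D` that belongs to this block-edge would have led
      -- to a departing block-edge earlier.
      rw [hnew, degrees_eq_zero]
      rintro e'' he'' ⟨h1, h2⟩
      exact (h.departing e' he' b hb).2 (hD e'' h2 b h1) hnone
    · rw [hother b hbb (hold e' he' b hb)] at hd
      obtain ⟨h1, h2, h3, h4, h5⟩ := h.new e' he' b d hb hd
      have hd' : d ≠ bE := ((hlt e he bE hbE).trans_le h1).ne'
      rw [hother d hd' h2.ne, hnext]
      exact ⟨h1, h2.trans (Nat.lt_succ_self _), h3, h4, h5⟩

/-- Moving an edge from its block-edge to the departing block-edge. -/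
theorem Departed.move {C : Choices G} {s s' : State V EL} {D : List (V × EL × V)}
    {T : ℕ → Prop} (h : Departed C s D T s') (hs : EdgeInv C s) {e : V × EL × V}
    (he : e ∈ C.edges) (heD : e ∉ D) {bE dbE : ℕ} (hbE : (s.edge e).blockEdge = some bE)
    (hdbE : (s'.blockEdge bE).departing = some dbE) :
    ∃ s₁, popKey bE (G.degree e) s' = some s₁ ∧
      Departed C s (D ++ [e]) T (pushKey dbE (G.degree e) s₁) := by
  have hlt : ∀ e ∈ C.edges, ∀ b, (s.edge e).blockEdge = some b → b < s.nextBlockEdge :=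
    fun e he b hb => by
      obtain ⟨b', hb', hh⟩ := hs.exists_blockEdge e he
      rw [hb] at hh
      exact Option.some_injective _ hh ▸ hb'
  obtain ⟨hd1, hd2, hd3, hd4, hd5⟩ := h.new e he bE dbE hbE hdbE
  have hne : bE ≠ dbE := ((hlt e he bE hbE).trans_le hd1).ne
  -- As `e` has not been moved yet, its degree is still present. This is the precondition of
  -- `popKey`, and erasing one copy leaves the degrees of the remaining edges.
  have hmap : (s'.blockEdge bE).map = G.degree e ::ₘ
      degrees C fun e' => (s.edge e').blockEdge = some bE ∧ e' ∉ D ++ [e] := by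
    rw [h.map e he bE hbE]
    refine degrees_insert C he (by simp) fun e' _ => ?_
    by_cases hee : e' = e
    · subst hee; simp [hbE, heD]
    · simp [hee]
  have hpop : popKey bE (G.degree e) s' = some (modBlockEdge bE
      (fun b => { b with map := b.map.erase (G.degree e) }) s') := by
    simp [popKey, hmap]
  refine ⟨_, hpop, ?_⟩
  set s'' := pushKey dbE (G.degree e) (modBlockEdge bE
      (fun b => { b with map := b.map.erase (G.degree e) }) s') with hs''
  have hself : s''.blockEdge bE = 
      ⟨degrees C fun e' => (s.edge e').blockEdge = some bE ∧ e' ∉ D ++ [e],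
        (s'.blockEdge bE).departing, (s'.blockEdge bE).source⟩ := by
    simp [hs'', pushKey, modBlockEdge, hne, hmap]
  have hnew : s''.blockEdge dbE =
      { s'.blockEdge dbE with map := G.degree e ::ₘ (s'.blockEdge dbE).map } := by
    simp [hs'', pushKey, modBlockEdge, hne.symm]
  have hother : ∀ b, b ≠ bE → b ≠ dbE → s''.blockEdge b = s'.blockEdge b :=
    fun b h1 h2 => by simp [hs'', pushKey, modBlockEdge, h1, h2]
  have hold : ∀ e ∈ C.edges, ∀ b, (s.edge e).blockEdge = some b → b ≠ dbE :=
    fun e he b hb => ((hlt e he b hb).trans_le hd1).ne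
  have hnext : s''.nextBlockEdge = s'.nextBlockEdge := rfl
  constructor
  · exact congrArg (fun t : State V EL => { t with
      blockEdge := s''.blockEdge, nextBlockEdge := s''.nextBlockEdge }) h.eq
  · exact h.le
  · intro e' he' b hb
    by_cases hbb : b = bE
    · subst hbb; rw [hself]
    · rw [hother b hbb (hold e' he' b hb), h.map e' he' b hb]
      refine degrees_congr C fun e'' _ => and_congr_right fun h1 => ?_
      have : e'' ≠ e := fun hc => hbb (by
        rw [hc, hbE] at h1
        exact (Option.some_injective _ h1).symm)
      simp [this]
  · intro e' he' b hb
    rw [← h.source e' he' b hb]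
    by_cases hbb : b = bE
    · subst hbb; rw [hself]
    · rw [hother b hbb (hold e' he' b hb)]
  · intro e' he' b hb
    rw [← h.departing e' he' b hb]
    by_cases hbb : b = bE
    · subst hbb; rw [hself]
    · rw [hother b hbb (hold e' he' b hb)]
  · intro e' he' b d hb hd
    by_cases hbb : b = bE
    · subst hbb
      rw [hself] at hd
      obtain rfl : dbE = d := Option.some_injective _ (hdbE.symm.trans hd)
      rw [hnew]
      refine ⟨hd1, hd2, ?_, hd4, hd5⟩
      dsimp only
      rw [hd3]
      refine (degrees_insert C he (by simp [heD]) fun e'' _ => ?_).symm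
      by_cases hee : e'' = e
      · subst hee; simp [hbE]
      · simp [hee]
    · rw [hother b hbb (hold e' he' b hb)] at hd
      obtain ⟨h1, h2, h3, h4, h5⟩ := h.new e' he' b d hb hd
      have hd' : d ≠ bE := ((hlt e he bE hbE).trans_le h1).ne'
      -- Different block-edges have different departing block-edges, because `source` leads back.
      have hd'' : d ≠ dbE := fun hc => hbb (by
        rw [hc, hd4] at h4
        exact (Option.some_injective _ h4).symm)
      rw [hother d hd' hd'']
      refine ⟨h1, h2, ?_, h4, h5⟩
      rw [h3]
      refine degrees_congr C fun e'' _ => and_congr_right fun h1 => ?_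
      have : e'' ≠ e := fun hc => hbb (by
        rw [hc, hbE] at h1
        exact (Option.some_injective _ h1).symm)
      simp [this]

variable [DecidableEq V] [DecidableEq EL]

/-- A departing block-edge is created by the first edge that needs it, so at every moment it exists
exactly for the block-edges of the edges met so far. -/
theorem computeBlockEdges_spec (C : Choices G) {s : State V EL} (hS : Static C s)
    (hs : EdgeInv C s) {vs : List V} (hvs : vs.Nodup) (r : EL) :
    ∃ s', computeBlockEdges vs r s = some s' ∧ Departed C s (arcs C vs r)
      (fun bE => ∃ e ∈ arcs C vs r, (s.edge e).blockEdge = some bE) s' := by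
  refine forComingEdges_spec hvs (fun D s' => Departed C s D
      (fun bE => ∃ e ∈ D, (s.edge e).blockEdge = some bE) s') ?_ ?_ ?_
  · intro D s' h
    rw [h.eq]
    exact ⟨hS.1, hS.2, hS.3, hS.4⟩
  · refine ⟨rfl, le_rfl, ?_, hs.source, ?_, ?_⟩
    · intro e he bE hbE
      rw [hs.map e he bE hbE]
      simp
    · intro e he bE hbE
      simp [hs.departing e he bE hbE]
    · intro e he bE dbE hbE hd
      simp [hs.departing e he bE hbE] at hd
  · intro D e s' hmem heD hDL h
    have he := (mem_arcs.1 hmem).1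
    obtain ⟨bE, -, hbE⟩ := hs.exists_blockEdge e he
    have hedge : s'.edge = s.edge := by rw [h.eq]
    have hdeg : (s'.edge e).degree = G.degree e := by rw [hedge, hS.degree]
    -- The existence of the departing block-edge is settled first: here `e` counts for `T` already,
    -- but not yet for `D`.
    obtain ⟨s₁, dbE, hif, hdbE, h₁⟩ : ∃ s₁ dbE, (if (s'.blockEdge bE).departing = none then
          modBlockEdge bE (fun b => { b with departing := some s'.nextBlockEdge })
            (newBlockEdge (some bE) s')
        else s') = s₁ ∧ (s₁.blockEdge bE).departing = some dbE ∧ Departed C s D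
          (fun b => ∃ e' ∈ D ++ [e], (s.edge e').blockEdge = some b) s₁ := by
      by_cases hn : (s'.blockEdge bE).departing = none
      · rw [if_pos hn]
        refine ⟨_, s'.nextBlockEdge, rfl, by simp [modBlockEdge], h.create hs he hbE hn
          (fun e he bE hbE => ⟨e, he, hbE⟩) fun b => ?_⟩
        simp only [List.mem_append, List.mem_singleton]
        constructor
        · rintro ⟨e', h1 | rfl, h2⟩
          · exact Or.inl ⟨e', h1, h2⟩
          · exact Or.inr (Option.some_injective _ (h2.symm.trans hbE))
        · rintro (⟨e', h1, h2⟩ | rfl)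
          · exact ⟨e', Or.inl h1, h2⟩
          · exact ⟨e, Or.inr rfl, hbE⟩
      · rw [if_neg hn]
        obtain ⟨dbE, hd⟩ := Option.ne_none_iff_exists'.1 hn
        refine ⟨s', dbE, rfl, hd, { h with departing := fun e' he' b hb => ?_ }⟩
        rw [h.departing e' he' b hb]
        have := (h.departing e he bE hbE).1 hn
        simp only [List.mem_append, List.mem_singleton]
        constructor
        · rintro ⟨e', h1, h2⟩
          exact ⟨e', Or.inl h1, h2⟩
        · rintro ⟨e', h1 | rfl, h2⟩
          · exact ⟨e', h1, h2⟩
          · rw [hbE] at h2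
            exact Option.some_injective _ h2 ▸ this
    have hdeg₁ : (s₁.edge e).degree = G.degree e := by rw [h₁.eq]; exact hS.degree e
    obtain ⟨s₂, hpop, h₂⟩ := h₁.move hs he heD hbE hdbE
    have hpop' : popKey bE (s₁.edge e).degree s₁ = some s₂ := by rw [hdeg₁, hpop]
    have hdeg₂ : (s₂.edge e).degree = G.degree e := by
      have := congrArg (fun s => (State.edge s e).degree) h₂.eq
      exact this.trans (hS.degree e)
    refine ⟨_, ?_, h₂⟩
    rw [hedge, hbE, Option.bind_some, hif]
    dsimp only
    rw [hdbE, Option.bind_some, hpop', Option.bind_some, hdeg₂]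

/-! ## Computing the subblocks -/

/-- The key of the departing list to which a vertex is moved. -/
def departingKey (d₁ d₂ : Degree) : Bool × Degree :=
  if d₁ ≥ d₂ then (true, d₂) else (false, d₁)

/-- The vertex had no key, so it is not in the list that it joins and no repetition arises. The
update `f` is kept abstract so that one argument serves both departing maps. -/
theorem BlkInv.move {s : State V EL} {c : V → Option (Bool × Degree)}
    (h : BlkInv s c (CompCB2.departing s)) {bx : ℕ} {x : V}
    (hx : (s.vertex x).block = some bx) (hc : c x = none) {k : Bool × Degree}
    {f : Block V EL → Block V EL}
    (hf : (f (s.block bx)).vertices = (s.block bx).vertices.erase x)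
    (hdep : ∀ k', CompCB2.departing (modBlock bx f s) bx k' =
      if k' = k then some ((CompCB2.departing s bx k).getD [] ++ [x])
      else CompCB2.departing s bx k') :
    BlkInv (modBlock bx f s) (Function.update c x (some k))
      (CompCB2.departing (modBlock bx f s)) := by
  have hother : ∀ b, b ≠ bx → (modBlock bx f s).block b = s.block b := fun b hb => by
    simp [modBlock, hb]
  have hdother : ∀ b, b ≠ bx →
      CompCB2.departing (modBlock bx f s) b = CompCB2.departing s b := fun b hb => by
    unfold CompCB2.departing; rw [hother b hb]
  have hself : ((modBlock bx f s).block bx).vertices = (s.block bx).vertices.erase x := by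
    simp [modBlock, hf]
  have hcx : ∀ b ≠ bx, ∀ z, (s.vertex z).block = some b → z ≠ x := fun b hb z hz hzx =>
    hb (Option.some_injective _ (by rw [← hz, hzx, hx]))
  have hbx : bx ∈ s.partition := by
    obtain ⟨b, hb, he⟩ := h.exists_block x
    rw [hx] at he
    exact Option.some_injective _ he ▸ hb
  have hget : ∀ z, z ∈ (CompCB2.departing s bx k).getD [] ↔
      (s.vertex z).block = some bx ∧ c z = some k := fun z => by
    cases hd : CompCB2.departing s bx k with
    | none =>
      simpa using fun h1 => h.of_dep_eq_none bx hbx k hd z h1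
    | some l => simpa using h.mem_dep bx hbx k l hd z
  have hgetnd : ((CompCB2.departing s bx k).getD []).Nodup := by
    cases hd : CompCB2.departing s bx k with
    | none => simp
    | some l => exact h.dep_nodup bx hbx k l hd
  constructor
  · exact h.exists_block
  · intro b hb
    by_cases hbb : b = bx
    · subst hbb; rw [hself]; exact (h.vertices_nodup b hb).erase _
    · rw [hother b hbb]; exact h.vertices_nodup b hb
  · intro b hb z
    by_cases hbb : b = bx
    · subst hbb
      rw [hself, (h.vertices_nodup b hb).mem_erase_iff, h.mem_vertices b hb z]
      by_cases hzx : z = x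
      · subst hzx; simp
      · simp [hzx, modBlock]
    · rw [hother b hbb, h.mem_vertices b hb z]
      refine and_congr_right fun h1 => ?_
      rw [Function.update_of_ne (hcx b hbb z h1)]
  · intro b hb k' l hl
    by_cases hbb : b = bx
    · subst hbb
      rw [hdep] at hl
      split_ifs at hl with hk
      · rw [← Option.some_injective _ hl]; simp
      · exact h.dep_ne_nil b hb k' l hl
    · rw [hdother b hbb] at hl; exact h.dep_ne_nil b hb k' l hl
  · intro b hb k' l hl
    by_cases hbb : b = bx
    · subst hbb
      rw [hdep] at hl
      split_ifs at hl with hk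
      · rw [← Option.some_injective _ hl, List.nodup_append]
        refine ⟨hgetnd, by simp, ?_⟩
        rintro z hz z' hz' rfl
        rw [List.mem_singleton.1 hz', hget, hc] at hz
        exact absurd hz.2 (by simp)
      · exact h.dep_nodup b hb k' l hl
    · rw [hdother b hbb] at hl; exact h.dep_nodup b hb k' l hl
  · intro b hb k' l hl z
    by_cases hbb : b = bx
    · subst hbb
      rw [hdep] at hl
      split_ifs at hl with hk
      · subst hk
        rw [← Option.some_injective _ hl, List.mem_append, hget, List.mem_singleton]
        by_cases hzx : z = x
        · subst hzx; simp [modBlock, hx]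
        · simp [hzx, modBlock]
      · rw [h.mem_dep b hb k' l hl]
        by_cases hzx : z = x
        · subst hzx; simp [hc, Ne.symm hk]
        · simp [hzx, modBlock]
    · rw [hdother b hbb] at hl
      rw [h.mem_dep b hb k' l hl]
      refine and_congr_right fun h1 => ?_
      rw [Function.update_of_ne (hcx b hbb z h1)]
  · intro b hb k' hl z hz
    by_cases hbb : b = bx
    · subst hbb
      rw [hdep] at hl
      split_ifs at hl with hk
      by_cases hzx : z = x
      · subst hzx; simpa using Ne.symm hk
      · rw [Function.update_of_ne hzx]; exact h.of_dep_eq_none b hb k' hl z hz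
    · rw [hdother b hbb] at hl
      rw [Function.update_of_ne (hcx b hbb z hz)]
      exact h.of_dep_eq_none b hb k' hl z hz
  · exact h.nonempty

/-- By `hκ` the key depends on the origin only, so the first edge of a vertex decides, and the flag
`processed` rightly skips the others. During the loop the flag is set exactly for the origins of the
edges met so far. -/
theorem computeSubblocks_spec (C : Choices G) {s : State V EL} (hS : Static C s)
    (hB : BlkInv s (fun _ => none) (departing s)) (hP : ∀ x, (s.vertex x).processed = false)
    {vs : List V} (hvs : vs.Nodup) {r : EL} {κ : V → Bool × Degree}
    (hκ : ∀ e ∈ arcs C vs r, ∃ bE dbE, (s.edge e).blockEdge = some bE ∧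
      (s.blockEdge bE).departing = some dbE ∧
      κ e.1 = departingKey (s.blockEdge bE).maxKey (s.blockEdge dbE).maxKey) :
    ∃ s', computeSubblocks vs r s = some s' ∧
      s' = { s with vertex := s'.vertex, block := s'.block } ∧
      (∀ x, (s'.vertex x).block = (s.vertex x).block) ∧
      (∀ x, (s'.vertex x).comingEdges = (s.vertex x).comingEdges) ∧
      (∀ b, (s'.block b).superBlocks = (s.block b).superBlocks) ∧
      (∀ x, (s'.vertex x).processed = true → ∃ e ∈ arcs C vs r, e.1 = x) ∧
      BlkInv s' (fun x => if ∃ e ∈ arcs C vs r, e.1 = x then some (κ x) else none)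
        (departing s') := by
  have key := forComingEdges_spec hvs (s := s)
    (body := fun e s =>
      let x := (s.edge e).origin
      (s.vertex x).block.bind fun bx =>
      if (s.vertex x).processed then some s else
      (s.edge e).blockEdge.bind fun bE =>
      (s.blockEdge bE).departing.bind fun dbE =>
      let d₁ := (s.blockEdge bE).maxKey
      let d₂ := (s.blockEdge dbE).maxKey
      let s :=
        if d₁ ≥ d₂ then
          modBlock bx (fun B => { B with
            vertices := B.vertices.erase x, departing₂ := DegreeMap.put B.departing₂ d₂ x }) s
        else
          modBlock bx (fun B => { B with
            vertices := B.vertices.erase x, departing₁ := DegreeMap.put B.departing₁ d₁ x }) s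
      some (modVertex x (fun v => { v with processed := true }) s))
    (C := C) (r := r)
    (fun D s' => s' = { s with vertex := s'.vertex, block := s'.block } ∧
      (∀ x, (s'.vertex x).block = (s.vertex x).block) ∧
      (∀ x, (s'.vertex x).comingEdges = (s.vertex x).comingEdges) ∧
      (∀ b, (s'.block b).superBlocks = (s.block b).superBlocks) ∧
      (∀ x, (s'.vertex x).processed = true ↔ ∃ e ∈ D, e.1 = x) ∧
      BlkInv s' (fun x => if ∃ e ∈ D, e.1 = x then some (κ x) else none) (departing s'))
    ?_ ?_ ?_
  · obtain ⟨s', hs', h1, h2, h3, h4, h5, h6⟩ := key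
    exact ⟨s', hs', h1, h2, h3, h4, fun x => (h5 x).1, h6⟩
  · rintro D s' ⟨h1, -, h3, -⟩
    have hedge : s'.edge = s.edge := by rw [h1]
    exact ⟨fun y => (h3 y).trans (hS.1 y), fun e => by rw [hedge, hS.2], fun e => by
      rw [hedge, hS.3], fun e => by rw [hedge, hS.4]⟩
  · exact ⟨rfl, fun _ => rfl, fun _ => rfl, fun _ => rfl, by simp [hP], by simpa using hB⟩
  · rintro D e s' hmem heD hDL ⟨h1, h2, h3, h4, h5, h6⟩
    obtain ⟨bE, dbE, hbE, hdbE, hk⟩ := hκ e hmem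
    obtain ⟨bx, hbx, hbe⟩ := hB.exists_block e.1
    have hedge : s'.edge = s.edge := by rw [h1]
    have hbedge : s'.blockEdge = s.blockEdge := by rw [h1]
    simp only [hedge, hS.origin e, h2, hbe, Option.bind_some, hbE, hbedge, hdbE]
    by_cases hp : (s'.vertex e.1).processed = true
    · rw [if_pos hp]
      have hex := (h5 e.1).1 hp
      have hiff : ∀ x, (∃ e' ∈ D ++ [e], e'.1 = x) ↔ ∃ e' ∈ D, e'.1 = x := fun x => by
        simp only [List.mem_append, List.mem_singleton]
        constructor
        · rintro ⟨e', h | rfl, rfl⟩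
          · exact ⟨e', h, rfl⟩
          · exact hex
        · rintro ⟨e', h, rfl⟩
          exact ⟨e', Or.inl h, rfl⟩
      exact ⟨s', rfl, h1, h2, h3, h4, fun x => by rw [hiff, h5], by simpa only [hiff] using h6⟩
    · rw [if_neg hp]
      have hnex : ¬ ∃ e' ∈ D, e'.1 = e.1 := fun h => hp ((h5 _).2 h)
      have hiff : ∀ x, (∃ e' ∈ D ++ [e], e'.1 = x) ↔ (∃ e' ∈ D, e'.1 = x) ∨ x = e.1 := fun x => by
        simp only [List.mem_append, List.mem_singleton]
        constructor
        · rintro ⟨e', h | rfl, rfl⟩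
          · exact Or.inl ⟨e', h, rfl⟩
          · exact Or.inr rfl
        · rintro (⟨e', h, rfl⟩ | rfl)
          · exact ⟨e', Or.inl h, rfl⟩
          · exact ⟨e, Or.inr rfl, rfl⟩
      refine ⟨_, rfl, ?_⟩
      set f : Block V EL → Block V EL :=
        if (s.blockEdge bE).maxKey ≥ (s.blockEdge dbE).maxKey then
          fun B => { B with
            vertices := B.vertices.erase e.1
            departing₂ := DegreeMap.put B.departing₂ (s.blockEdge dbE).maxKey e.1 }
        else
          fun B => { B with
            vertices := B.vertices.erase e.1
            departing₁ := DegreeMap.put B.departing₁ (s.blockEdge bE).maxKey e.1 } with hf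
      have hif : (if (s.blockEdge bE).maxKey ≥ (s.blockEdge dbE).maxKey then
          modBlock bx (fun B => { B with
            vertices := B.vertices.erase e.1
            departing₂ := DegreeMap.put B.departing₂ (s.blockEdge dbE).maxKey e.1 }) s'
          else modBlock bx (fun B => { B with
            vertices := B.vertices.erase e.1
            departing₁ := DegreeMap.put B.departing₁ (s.blockEdge bE).maxKey e.1 }) s') =
          modBlock bx f s' := by
        rw [hf]; split_ifs <;> rfl
      rw [hif]
      have hfv : ∀ B, (f B).vertices = B.vertices.erase e.1 := fun B => by
        rw [hf]; split_ifs <;> rfl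
      have hfs : ∀ B, (f B).superBlocks = B.superBlocks := fun B => by
        rw [hf]; split_ifs <;> rfl
      have hmove := h6.move (f := f) (k := κ e.1) ((h2 e.1).trans hbe) (by simp [hnex])
        (hfv _) (by
          rintro ⟨b, d⟩
          rw [hk, hf]
          unfold departingKey
          split_ifs with h7 h8 h8
          · obtain ⟨rfl, rfl⟩ := Prod.mk.inj h8
            simp [departing, modBlock, DegreeMap.put]
          · cases b with
            | false => simp [departing, modBlock]
            | true =>
              have : d ≠ (s.blockEdge dbE).maxKey := fun h => h8 (by rw [h])
              simp [departing, modBlock, DegreeMap.put, Finmap.lookup_insert_of_ne, this]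
          · obtain ⟨rfl, rfl⟩ := Prod.mk.inj h8
            simp [departing, modBlock, DegreeMap.put]
          · cases b with
            | true => simp [departing, modBlock]
            | false =>
              have : d ≠ (s.blockEdge bE).maxKey := fun h => h8 (by rw [h])
              simp [departing, modBlock, DegreeMap.put, Finmap.lookup_insert_of_ne, this])
      have hvert : ∀ x, (modVertex e.1 (fun v => { v with processed := true })
          (modBlock bx f s')).vertex x = if x = e.1 then { s'.vertex x with processed := true }
            else s'.vertex x := fun x => by
        by_cases hx : x = e.1
        · subst hx; simp [modVertex, modBlock]
        · simp [modVertex, modBlock, hx]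
      refine ⟨by rw [h1]; rfl, fun x => ?_, fun x => ?_, fun b => ?_, fun x => ?_, ?_⟩
      · rw [hvert, ← h2 x]; split_ifs <;> rfl
      · rw [hvert, ← h3 x]; split_ifs <;> rfl
      · rw [← h4 b]
        by_cases hb : b = bx
        · subst hb; simp [modVertex, modBlock, hfs]
        · simp [modVertex, modBlock, hb]
      · rw [hvert, hiff, ← h5 x]
        by_cases hx : x = e.1 <;> simp [hx]
      · have hc : (fun x => if ∃ e' ∈ D ++ [e], e'.1 = x then some (κ x) else none) =
            Function.update (fun x => if ∃ e' ∈ D, e'.1 = x then some (κ x) else none) e.1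
              (some (κ e.1)) := by
          funext x
          by_cases hx : x = e.1
          · subst hx
            rw [Function.update_self, if_pos ((hiff _).2 (Or.inr rfl))]
          · rw [Function.update_of_ne hx]
            exact if_congr ((hiff x).trans (or_iff_left hx)) rfl rfl
        rw [hc]
        refine hmove.congr (fun x => ?_) rfl (fun _ _ => rfl) fun _ _ => rfl
        rw [hvert]
        split_ifs <;> rfl

/-! ## Clearing the auxiliary information -/

/-- Several edges may share a departing block-edge: the first one clears both references and the
later ones find `source` empty. Hence the loop maintains that wherever `source` has been reset, the
reference `departing` of the former source has been reset too. -/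
theorem clearAuxiliaryInfo_spec (C : Choices G) {s : State V EL} (hS : Static C s)
    {vs : List V} (hvs : vs.Nodup) {r : EL}
    (hE : ∀ e ∈ arcs C vs r, ∃ bE, (s.edge e).blockEdge = some bE) :
    ∃ s', clearAuxiliaryInfo vs r s = some s' ∧
      s' = { s with vertex := s'.vertex, blockEdge := s'.blockEdge } ∧
      (∀ x, (s'.vertex x).block = (s.vertex x).block) ∧
      (∀ x, (s'.vertex x).comingEdges = (s.vertex x).comingEdges) ∧
      (∀ x, (s'.vertex x).processed = true →
        (s.vertex x).processed = true ∧ ∀ e ∈ arcs C vs r, e.1 ≠ x) ∧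
      (∀ b, (s'.blockEdge b).map = (s.blockEdge b).map) ∧
      (∀ b, (s.blockEdge b).source = none → (s'.blockEdge b).source = none) ∧
      (∀ b, (s.blockEdge b).departing = none → (s'.blockEdge b).departing = none) ∧
      ∀ e ∈ arcs C vs r, ∀ bE, (s.edge e).blockEdge = some bE →
        (s'.blockEdge bE).source = none ∧
        ∀ sbE, (s.blockEdge bE).source = some sbE → (s'.blockEdge sbE).departing = none := by
  have key := forComingEdges_spec hvs (s := s)
    (body := fun e s =>
      let s := modVertex (s.edge e).origin (fun v => { v with processed := false }) s
      (s.edge e).blockEdge.bind fun bE =>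
      match (s.blockEdge bE).source with
      | none => some s
      | some sbE =>
          some (modBlockEdge bE (fun b => { b with source := none })
            (modBlockEdge sbE (fun b => { b with departing := none }) s)))
    (C := C) (r := r)
    (fun D s' => s' = { s with vertex := s'.vertex, blockEdge := s'.blockEdge } ∧
      (∀ x, (s'.vertex x).block = (s.vertex x).block) ∧
      (∀ x, (s'.vertex x).comingEdges = (s.vertex x).comingEdges) ∧
      (∀ x, (s'.vertex x).processed = true →
        (s.vertex x).processed = true ∧ ∀ e ∈ D, e.1 ≠ x) ∧
      (∀ b, (s'.blockEdge b).map = (s.blockEdge b).map) ∧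
      (∀ b, (s'.blockEdge b).source = none ∨
        (s'.blockEdge b).source = (s.blockEdge b).source) ∧
      (∀ b, (s.blockEdge b).departing = none → (s'.blockEdge b).departing = none) ∧
      (∀ b sbE, (s.blockEdge b).source = some sbE → (s'.blockEdge b).source = none →
        (s'.blockEdge sbE).departing = none) ∧
      ∀ e ∈ D, ∀ bE, (s.edge e).blockEdge = some bE → (s'.blockEdge bE).source = none)
    ?_ ?_ ?_
  · obtain ⟨s', hs', h1, h2, h3, h4, h5, h6, h7, h8, h9⟩ := key
    refine ⟨s', hs', h1, h2, h3, h4, h5, fun b hb => ?_, h7, fun e he bE hbE =>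
      ⟨h9 e he bE hbE, fun sbE hsb => h8 bE sbE hsb (h9 e he bE hbE)⟩⟩
    rcases h6 b with h | h
    · exact h
    · rw [h, hb]
  · rintro D s' ⟨h1, -, h3, -⟩
    have hedge : s'.edge = s.edge := by rw [h1]
    exact ⟨fun y => (h3 y).trans (hS.1 y), fun e => by rw [hedge, hS.2], fun e => by
      rw [hedge, hS.3], fun e => by rw [hedge, hS.4]⟩
  · exact ⟨rfl, fun _ => rfl, fun _ => rfl, fun x hx => ⟨hx, by simp⟩, fun _ => rfl,
      fun _ => Or.inr rfl, fun _ h => h, fun b sbE h h' => by simp [h] at h', by simp⟩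
  · rintro D e s' hmem heD hDL ⟨h1, h2, h3, h4, h5, h6, h7, h8, h9⟩
    obtain ⟨bE, hbE⟩ := hE e hmem
    have hedge : s'.edge = s.edge := by rw [h1]
    have hvert : ∀ x, Function.update s'.vertex e.1 { s'.vertex e.1 with processed := false } x =
        if x = e.1 then { s'.vertex x with processed := false } else s'.vertex x := fun x => by
      by_cases hx : x = e.1
      · subst hx; simp
      · simp [hx]
    have hproc : ∀ x, (if x = e.1 then { s'.vertex x with processed := false }
          else s'.vertex x).processed = true →
        (s.vertex x).processed = true ∧ ∀ e' ∈ D ++ [e], e'.1 ≠ x := fun x hx => by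
      split_ifs at hx with hxe
      obtain ⟨h, h'⟩ := h4 x hx
      refine ⟨h, fun e' he' => ?_⟩
      rcases List.mem_append.1 he' with he' | he'
      · exact h' e' he'
      · rw [List.mem_singleton.1 he']; exact Ne.symm hxe
    have hblock : ∀ x, (if x = e.1 then { s'.vertex x with processed := false }
        else s'.vertex x).block = (s.vertex x).block := fun x => by
      rw [← h2]; split_ifs <;> rfl
    have hcoming : ∀ x, (if x = e.1 then { s'.vertex x with processed := false }
        else s'.vertex x).comingEdges = (s.vertex x).comingEdges := fun x => by
      rw [← h3]; split_ifs <;> rfl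
    simp only [modVertex, hedge, hS.origin e, hbE, Option.bind_some]
    cases hsrc : (s'.blockEdge bE).source with
    | none =>
      refine ⟨_, rfl, by rw [h1], ?_, ?_, ?_, h5, h6, h7, h8, fun e' he' b hb => ?_⟩
      · simpa only [hvert] using hblock
      · simpa only [hvert] using hcoming
      · simpa only [hvert] using hproc
      · rcases List.mem_append.1 he' with he' | he'
        · exact h9 e' he' b hb
        · rw [List.mem_singleton.1 he', hbE] at hb
          rw [← Option.some_injective _ hb]
          exact hsrc
    | some sbE =>
      have hsrc' : (s.blockEdge bE).source = some sbE := by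
        rcases h6 bE with h | h
        · simp [hsrc] at h
        · rw [← h, hsrc]
      set BE := Function.update (Function.update s'.blockEdge sbE
        { s'.blockEdge sbE with departing := none }) bE
        { (Function.update s'.blockEdge sbE
          { s'.blockEdge sbE with departing := none }) bE with source := none } with hBE
      have hmap : ∀ b, (BE b).map = (s'.blockEdge b).map := fun b => by
        by_cases h1 : b = bE
        · subst h1
          by_cases h2 : b = sbE
          · subst h2; simp [hBE]
          · simp [hBE, h2]
        · by_cases h2 : b = sbE
          · subst h2; simp [hBE, h1]
          · simp [hBE, h1, h2]
      have hsource : ∀ b, (BE b).source = if b = bE then none else (s'.blockEdge b).source :=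
        fun b => by
          by_cases h1 : b = bE
          · subst h1; simp [hBE]
          · by_cases h2 : b = sbE
            · subst h2; simp [hBE, h1]
            · simp [hBE, h1, h2]
      have hdep : ∀ b, (BE b).departing = if b = sbE then none else (s'.blockEdge b).departing :=
        fun b => by
          by_cases h1 : b = bE
          · subst h1
            by_cases h2 : b = sbE
            · subst h2; simp [hBE]
            · simp [hBE, h2]
          · by_cases h2 : b = sbE
            · subst h2; simp [hBE, h1]
            · simp [hBE, h1, h2]
      refine ⟨_, rfl, by rw [h1]; rfl, ?_, ?_, ?_, fun b => (hmap b).trans (h5 b), fun b => ?_,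
        fun b hb => ?_, fun b sb hb hb' => ?_, fun e' he' b hb => ?_⟩
      · simpa only [modBlockEdge, hvert] using hblock
      · simpa only [modBlockEdge, hvert] using hcoming
      · simpa only [modBlockEdge, hvert] using hproc
      · change (BE b).source = _ ∨ (BE b).source = _
        rw [hsource]
        split_ifs
        · exact Or.inl rfl
        · exact h6 b
      · change (BE b).departing = _
        rw [hdep, h7 b hb, ite_self]
      · change (BE b).source = _ at hb'
        change (BE sb).departing = _
        rw [hdep]
        rw [hsource] at hb'
        split_ifs with hsb
        · rfl
        · split_ifs at hb' with hbb
          · subst hbb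
            exact absurd (Option.some_injective _ (hb.symm.trans hsrc')) hsb
          · exact h8 b sb hb hb'
      · change (BE b).source = _
        rw [hsource]
        split_ifs with hbb
        · rfl
        · rcases List.mem_append.1 he' with he' | he'
          · exact h9 e' he' b hb
          · rw [List.mem_singleton.1 he', hbE] at hb
            exact absurd (Option.some_injective _ hb).symm hbb

end CompCB2

end

section

namespace CompCB2

variable {V VL EL : Type*} {G : FuzzyGraph V VL EL}

/-! ## Splitting -/

section

variable [DecidableEq EL]

/-- Moving a block from its super-block to a new one. -/
theorem createSuperBlock_spec {s : State V EL} (h : SupInv s fun _ _ => False) {r : EL}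
    {Y Y' : ℕ} (hY : Y ∈ superBlocksOf s r) (hY' : Y' ∈ (s.superBlock Y).blocks)
    (hlen : 1 < (s.superBlock Y).blocks.length) :
    ∃ s₁ s', removeBlock Y Y' s = some s₁ ∧ (s₁.superBlock Y).superPartition = some r ∧
      createSuperBlock r Y' r s₁ = some s' ∧
      s' = { s with
        block := Function.update s.block Y' { s.block Y' with
          superBlocks := Function.update (s.block Y').superBlocks r (some s.nextSuperBlock) }
        superBlock := s'.superBlock
        superPartition := s'.superPartition
        nextSuperBlock := s'.nextSuperBlock } ∧
      SupInv s' (fun _ _ => False) ∧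
      ∀ r' sb, sb ∈ superBlocksOf s' r' ↔
        sb ∈ superBlocksOf s r' ∨ (r' = r ∧ sb = s.nextSuperBlock) := by
  have hYn : Y ≠ s.nextSuperBlock := (h.lt r Y hY).ne
  have hn : ∀ r', ∀ sb ∈ superBlocksOf s r', sb ≠ s.nextSuperBlock := fun r' sb hs =>
    (h.lt r' sb hs).ne
  have hsp := h.superPartition r Y hY
  have hmem := fun r' sb hs b => h.mem_blocks r' sb hs b
  have hlen' : ((s.superBlock Y).blocks.erase Y').length =
      (s.superBlock Y).blocks.length - 1 := List.length_erase_of_mem hY'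
  obtain ⟨hY'p, hY'r⟩ := (hmem r Y hY Y').1 hY'
  set SB := Function.update (Function.update s.superBlock Y
    { s.superBlock Y with blocks := (s.superBlock Y).blocks.erase Y' }) s.nextSuperBlock
    ⟨[Y'], some r⟩ with hSB
  have hSBY : SB Y = { s.superBlock Y with blocks := (s.superBlock Y).blocks.erase Y' } := by
    simp [hSB, hYn]
  have hSBn : SB s.nextSuperBlock = ⟨[Y'], some r⟩ := by simp [hSB]
  have hSBo : ∀ sb, sb ≠ Y → sb ≠ s.nextSuperBlock → SB sb = s.superBlock sb :=
    fun sb h1 h2 => by simp [hSB, h1, h2]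
  -- The two cases below lead to the same objects up to the lists `SP` of the super-partition, so
  -- the invariant is derived once for all `SP` with the right members.
  have key : ∀ SP : EL → SuperPartition, ∀ s' : State V EL, s' = { s with
        block := Function.update s.block Y' { s.block Y' with
          superBlocks := Function.update (s.block Y').superBlocks r (some s.nextSuperBlock) }
        superBlock := SB
        superPartition := SP
        nextSuperBlock := s.nextSuperBlock + 1 } →
      (∀ r', (superBlocksOf s' r').Perm
        (superBlocksOf s r' ++ if r' = r then [s.nextSuperBlock] else [])) →
      (∀ r', ∀ sb ∈ superBlocksOf s r', (sb ∈ (SP r').compound ↔ 1 < (SB sb).blocks.length)) →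
      s.nextSuperBlock ∉ (SP r).compound →
      SupInv s' (fun _ _ => False) ∧ ∀ r' sb, sb ∈ superBlocksOf s' r' ↔
        sb ∈ superBlocksOf s r' ∨ (r' = r ∧ sb = s.nextSuperBlock) := by
    rintro SP s' hs' hperm hcomp hncomp
    have hmem' : ∀ r' sb, sb ∈ superBlocksOf s' r' ↔
        sb ∈ superBlocksOf s r' ∨ (r' = r ∧ sb = s.nextSuperBlock) := fun r' sb => by
      rw [(hperm r').mem_iff]
      by_cases hr : r' = r <;> simp [hr]
    refine ⟨?_, hmem'⟩
    have hsbY : ∀ r', (s'.block Y').superBlocks r' =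
        if r' = r then some s.nextSuperBlock else (s.block Y').superBlocks r' := fun r' => by
      rw [hs']
      by_cases hr : r' = r
      · subst hr; simp
      · simp [hr]
    have hsbo : ∀ b, b ≠ Y' → s'.block b = s.block b := fun b hb => by
      rw [hs']; simp [hb]
    have hSB' : s'.superBlock = SB := by rw [hs']
    have hpart : s'.partition = s.partition := by rw [hs']
    have hSP' : s'.superPartition = SP := by rw [hs']
    constructor
    · rw [hs']; exact h.partition_nodup
    · rw [hs']; exact h.partition_lt
    · intro r'
      rw [(hperm r').nodup_iff]
      by_cases hr : r' = r
      · subst hr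
        simpa [List.nodup_append, h.nodup] using hn r'
      · simpa [hr] using h.nodup r'
    · intro r' sb hs
      rw [hs']
      rcases (hmem' r' sb).1 hs with hs | ⟨-, rfl⟩
      · exact (h.lt r' sb hs).trans (Nat.lt_succ_self _)
      · exact Nat.lt_succ_self _
    · intro r' sb hs
      rw [hSB']
      rcases (hmem' r' sb).1 hs with hs | ⟨rfl, rfl⟩
      · rw [← h.superPartition r' sb hs]
        by_cases hsb : sb = Y
        · subst hsb; rw [hSBY]
        · rw [hSBo sb hsb (hn r' sb hs)]
      · rw [hSBn]
    · intro r' sb hs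
      rw [hSB']
      rcases (hmem' r' sb).1 hs with hs | ⟨rfl, rfl⟩
      · have := h.blocks_nodup r' sb hs
        by_cases hsb : sb = Y
        · subst hsb; rw [hSBY]; exact this.erase _
        · rw [hSBo sb hsb (hn r' sb hs)]; exact this
      · rw [hSBn]; simp
    · intro r' sb hs b
      rw [hSB', hpart]
      rcases (hmem' r' sb).1 hs with hs | ⟨rfl, rfl⟩
      · by_cases hsb : sb = Y
        · subst hsb
          obtain rfl := h.eq_of_mem hs hY
          rw [hSBY]
          dsimp only
          rw [(h.blocks_nodup r' sb hs).mem_erase_iff, hmem r' sb hs]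
          by_cases hb : b = Y'
          · subst hb; simp [hsbY, hYn.symm]
          · simp [hb, hsbo b hb]
        · rw [hSBo sb hsb (hn r' sb hs), hmem r' sb hs]
          by_cases hb : b = Y'
          · subst hb
            rw [hsbY]
            split_ifs with hr
            · subst hr
              simp [hY'r, Ne.symm hsb, (hn r' sb hs).symm]
            · rfl
          · rw [hsbo b hb]
      · rw [hSBn]
        by_cases hb : b = Y'
        · subst hb; simp [hsbY, hY'p]
        · simp only [List.mem_singleton, hb, hsbo b hb, false_iff, not_and]
          intro hbp hbs
          obtain ⟨sb, hs, he⟩ := h.exists_superBlock b hbp r' id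
          exact hn r' sb hs (Option.some_injective _ (he.symm.trans hbs))
    · intro r' sb hs
      rw [hSB', hSP']
      rcases (hmem' r' sb).1 hs with hs | ⟨rfl, rfl⟩
      · exact hcomp r' sb hs
      · rw [hSBn]
        simpa using hncomp
    · intro b hb r' _
      rw [hpart] at hb
      by_cases hbb : b = Y'
      · subst hbb
        rw [hsbY]
        split_ifs with hr
        · exact ⟨_, (hmem' _ _).2 (Or.inr ⟨hr, rfl⟩), rfl⟩
        · obtain ⟨sb, hs, he⟩ := h.exists_superBlock b hb r' id
          exact ⟨sb, (hmem' _ _).2 (Or.inl hs), he⟩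
      · rw [hsbo b hbb]
        obtain ⟨sb, hs, he⟩ := h.exists_superBlock b hb r' id
        exact ⟨sb, (hmem' _ _).2 (Or.inl hs), he⟩
  have hcY : Y ∈ (s.superPartition r).compound := (h.mem_compound r Y hY).2 hlen
  have hnc : s.nextSuperBlock ∉ (s.superPartition r).compound := fun hc =>
    hn r _ (List.mem_append_left _ hc) rfl
  -- With two blocks `Y` becomes simple; with more it remains compound. The new super-block has one
  -- block and stays simple in both cases.
  by_cases h2 : (s.superBlock Y).blocks.length = 2
  · have hrem : removeBlock Y Y' s = some { s with
        superBlock := Function.update s.superBlock Y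
          { s.superBlock Y with blocks := (s.superBlock Y).blocks.erase Y' }
        superPartition := Function.update s.superPartition r
          { compound := (s.superPartition r).compound.erase Y,
            simple := (s.superPartition r).simple ++ [Y] } } := by
      simp [removeBlock, modSuperBlock, modSuperPartition, hlen', h2, hsp]
    refine ⟨_, _, hrem, by simpa using hsp, ?_, rfl, key
      (Function.update s.superPartition r
          { compound := (s.superPartition r).compound.erase Y,
            simple := (s.superPartition r).simple ++ [Y] ++ [s.nextSuperBlock] })
      _ rfl (fun r' => ?_) (fun r' sb hs => ?_) ?_⟩
    · simp [createSuperBlock, newSuperBlock, addSuperBlock, addBlock, modSuperBlock,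
        modSuperPartition, modBlock, hSB]
    · by_cases hr : r' = r
      · subst hr
        simp only [superBlocksOf, Function.update_self, if_true]
        rw [← List.append_assoc, ← List.append_assoc]
        refine List.Perm.append_right _ ?_
        refine (List.perm_append_comm (l₂ := [Y])).trans ?_
        rw [List.singleton_append, ← List.cons_append]
        exact (List.perm_cons_erase hcY).symm.append_right _
      · simp [superBlocksOf, hr]
    · by_cases hr : r' = r
      · subst hr
        by_cases hsb : sb = Y
        · subst hsb
          have hnd := (List.nodup_append.1 (h.nodup r')).1
          simp [hSBY, hlen', h2, hnd.mem_erase_iff]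
        · rw [hSBo sb hsb (hn r' sb hs), ← h.mem_compound r' sb hs]
          simp [List.mem_erase_of_ne hsb]
      · have hsb : sb ≠ Y := fun hc => hr (h.eq_of_mem (hc ▸ hs) hY)
        rw [hSBo sb hsb (hn r' sb hs), ← h.mem_compound r' sb hs]
        simp [hr]
    · rw [Function.update_self]
      exact fun hc => hnc (List.mem_of_mem_erase hc)
  · have hrem : removeBlock Y Y' s = some { s with
        superBlock := Function.update s.superBlock Y
          { s.superBlock Y with blocks := (s.superBlock Y).blocks.erase Y' } } := by
      have : (s.superBlock Y).blocks.length - 1 ≠ 1 := by omega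
      simp [removeBlock, modSuperBlock, hlen', this]
    refine ⟨_, _, hrem, by simpa using hsp, ?_, rfl, key
      (Function.update s.superPartition r
          { compound := (s.superPartition r).compound,
            simple := (s.superPartition r).simple ++ [s.nextSuperBlock] })
      _ rfl (fun r' => ?_) (fun r' sb hs => ?_) ?_⟩
    · simp [createSuperBlock, newSuperBlock, addSuperBlock, addBlock, modSuperBlock,
        modSuperPartition, modBlock, hSB]
    · by_cases hr : r' = r
      · subst hr
        simp [superBlocksOf]
      · simp [superBlocksOf, hr]
    · have hc : sb ∈ (Function.update s.superPartition r
          { compound := (s.superPartition r).compound,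
            simple := (s.superPartition r).simple ++ [s.nextSuperBlock] } r').compound ↔
          sb ∈ (s.superPartition r').compound := by
        by_cases hr : r' = r
        · subst hr; simp
        · simp [hr]
      rw [hc, h.mem_compound r' sb hs]
      by_cases hsb : sb = Y
      · subst hsb
        rw [hSBY]
        dsimp only
        rw [hlen']
        omega
      · rw [hSBo sb hsb (hn r' sb hs)]
    · rw [Function.update_self]
      exact hnc

end

/-! ### The splitting loop, the invariant of the main loops, and the block-edges after a split -/

variable [DecidableEq V] [DecidableEq EL]

/-- The edges after those in `D` were connected to the departing block-edges. -/
def departEdges (s : State V EL) (D : List (V × EL × V)) (e : V × EL × V) : Edge V EL :=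
  if e ∈ D then { s.edge e with
    blockEdge := (s.edge e).blockEdge.bind fun bE => (s.blockEdge bE).departing }
  else s.edge e

/-- A key, once `none`, stays so, and processing an edge resets the keys of all vertices in the
block of its origin. When another edge leads to a block whose maps are empty, nothing is left to do.
So in the end no origin of an arc carries a key, while the kernel of blocks and keys is the initial
one. -/
theorem forComingEdges_splitBlock_spec (C : Choices G) {s : State V EL} (hS : Static C s)
    (hsup : SupInv s fun _ _ => False) {c : V → Option (Bool × Degree)}
    (hB : BlkInv s c (departing s)) {vs : List V} (hvs : vs.Nodup) {r : EL}
    (hE : ∀ e ∈ arcs C vs r, ∃ bE, (s.edge e).blockEdge = some bE) :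
    ∃ s', forComingEdges vs r (fun e s =>
        (s.edge e).blockEdge.bind fun bE =>
        let s := modEdge e (fun E => { E with blockEdge := (s.blockEdge bE).departing }) s
        let x := (s.edge e).origin
        (s.vertex x).block.bind fun bx => splitBlock C bx s) s = some s' ∧
      ∃ c', Frame { s with edge := departEdges s (arcs C vs r) } s' ∧
        SupInv s' (fun _ _ => False) ∧ BlkInv s' c' (departing s') ∧ SameKernel s s' c c' ∧
        (∀ x, c' x = none ∨ c' x = c x) ∧ ∀ e ∈ arcs C vs r, c' e.1 = none := by
  refine forComingEdges_spec hvs (fun D s' =>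
      ∃ c', Frame { s with edge := departEdges s D } s' ∧
        SupInv s' (fun _ _ => False) ∧ BlkInv s' c' (departing s') ∧ SameKernel s s' c c' ∧
        (∀ x, c' x = none ∨ c' x = c x) ∧ ∀ e ∈ D, c' e.1 = none) ?_ ?_ ?_
  · rintro D s' ⟨c', hF, -⟩
    have hedge : s'.edge = departEdges s D := hF.edge
    refine ⟨fun y => (hF.coming y).trans (hS.1 y), fun e => ?_, fun e => ?_, fun e => ?_⟩ <;>
      rw [hedge] <;> unfold departEdges <;> split_ifs
    exacts [hS.2 e, hS.2 e, hS.3 e, hS.3 e, hS.4 e, hS.4 e]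
  · have : departEdges s [] = s.edge := by
      funext e; simp [departEdges]
    refine ⟨c, ?_, hsup, hB, fun _ _ => Iff.rfl, fun _ => Or.inr rfl, by simp⟩
    rw [this]
    exact Frame.refl s
  · rintro D e s' hmem heD - ⟨c', hF, hsup', hB', hker, hkey, hD⟩
    obtain ⟨bE, hbE⟩ := hE e hmem
    have hedge : s'.edge = departEdges s D := hF.edge
    have hbE' : (s'.edge e).blockEdge = some bE := by
      rw [hedge, departEdges, if_neg heD, hbE]
    have hbe : s'.blockEdge = s.blockEdge := hF.blockEdge
    set s₁ := modEdge e (fun E => { E with blockEdge := (s'.blockEdge bE).departing }) s' with hs₁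
    have hedge₁ : s₁.edge = departEdges s (D ++ [e]) := by
      funext e'
      by_cases hee : e' = e
      · subst hee
        simp [hs₁, modEdge, departEdges, hbE, hedge, heD, hbe]
      · simp [hs₁, modEdge, departEdges, hee, hedge]
    have horig : (s₁.edge e).origin = e.1 := by
      rw [hedge₁, departEdges, if_pos (by simp)]
      exact hS.origin e
    obtain ⟨bx, hbx, hxb⟩ := hB'.exists_block e.1
    have hF₁ : Frame { s with edge := departEdges s (D ++ [e]) } s₁ :=
      ⟨hedge₁, hF.2, hF.3, hF.4, hF.5, hF.6, hF.7, hF.8⟩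
    obtain ⟨s'', c'', hs'', hF'', hsup'', hB'', hker'', hkey'', hbx''⟩ := splitBlock_spec C
      (s := s₁) (c := c') (hsup'.congr rfl rfl rfl rfl rfl fun _ => rfl)
      (hB'.congr (fun _ => rfl) rfl (fun _ _ => rfl) fun _ _ => rfl) hbx
    refine ⟨s'', ?_, c'', hF₁.trans hF'', hsup'', hB'', hker.trans hker'', fun x => ?_,
      fun e' he' => ?_⟩
    · rw [hbE', Option.bind_some]
      change (s₁.vertex (s₁.edge e).origin).block.bind (fun bx => splitBlock C bx s₁) = _
      rw [horig]
      change (s'.vertex e.1).block.bind (fun bx => splitBlock C bx s₁) = _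
      rw [hxb, Option.bind_some, hs'']
    · rcases hkey'' x with h | h
      · exact Or.inl h
      · rw [h]; exact hkey x
    · rcases List.mem_append.1 he' with he' | he'
      · rcases hkey'' e'.1 with h | h
        · exact h
        · rw [h, hD e' he']
      · rw [List.mem_singleton.1 he']
        exact hbx'' e.1 hxb

/-- The invariant of the main loops. -/
structure Inv (C : Choices G) (s : State V EL) : Prop where
  static : Static C s
  edge : EdgeInv C s
  sup : SupInv s fun _ _ => False
  blk : BlkInv s (fun _ => none) (departing s)
  processed : ∀ x, (s.vertex x).processed = false
  nonempty : ∀ r, ∀ sb ∈ superBlocksOf s r, ∃ x, superBlockOf s r x = some sb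
  stable : ∀ x x', (s.vertex x).block = (s.vertex x').block → ∀ r y,
    G.supE x r {z | superBlockOf s r z = superBlockOf s r y} =
      G.supE x' r {z | superBlockOf s r z = superBlockOf s r y}
  label : ∀ x x', (s.vertex x).block = (s.vertex x').block → G.L x = G.L x'
  coarse : ∀ R, G.IsBisimulation R → ∀ x x', R x x' → (s.vertex x).block = (s.vertex x').block

omit [DecidableEq V] [DecidableEq EL] in
theorem superBlockOf_eq_of_block_eq {s : State V EL} {x x' : V}
    (h : (s.vertex x).block = (s.vertex x').block) (r : EL) :
    superBlockOf s r x = superBlockOf s r x' := by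
  unfold superBlockOf; rw [h]

omit [DecidableEq V] [DecidableEq EL] in
-- Links the key that the program computes for the vertices it meets with the function that also
-- covers the vertices it never meets.
theorem subblockKey_of_ne_zero {a b : Degree} (hb : b ≠ 0) :
    subblockKey a b = some (departingKey a b) := by
  unfold subblockKey departingKey
  rw [if_neg hb]
  split_ifs <;> rfl

/-- The relation between the blocks and super-blocks before and after splitting. -/
structure SplitResult (G : FuzzyGraph V VL EL) (s s' : State V EL) (Y' Y : ℕ) (r : EL) :
    Prop where
  block_eq_iff : ∀ x x', (s'.vertex x).block = (s'.vertex x').block ↔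
    (s.vertex x).block = (s.vertex x').block ∧
    G.supE x r {y | (s.vertex y).block = some Y'} =
      G.supE x' r {y | (s.vertex y).block = some Y'} ∧
    G.supE x r ({y | superBlockOf s r y = some Y} \ {y | (s.vertex y).block = some Y'}) =
      G.supE x' r ({y | superBlockOf s r y = some Y} \ {y | (s.vertex y).block = some Y'})
  superBlockOf_of_ne : ∀ r' ≠ r, ∀ x, superBlockOf s' r' x = superBlockOf s r' x
  superBlockOf_of_notMem : ∀ x, (s.vertex x).block ≠ some Y' →
    superBlockOf s' r x = superBlockOf s r x
  superBlockOf_of_mem : ∀ x, (s.vertex x).block = some Y' →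
    superBlockOf s' r x = some s.nextSuperBlock
  fresh : ∀ x, superBlockOf s r x ≠ some s.nextSuperBlock

/-- The edges and block-edges after splitting. -/
theorem EdgeInv.of_departed {C : Choices G} {s s₁ s' : State V EL} (hs : EdgeInv C s)
    {L : List (V × EL × V)} (hD : Departed C s L (fun bE => ∃ e ∈ L,
      (s.edge e).blockEdge = some bE) s₁) (hL : ∀ e ∈ L, e ∈ C.edges)
    (hnext : s'.nextBlockEdge = s₁.nextBlockEdge)
    (hedge : ∀ e, (s'.edge e).blockEdge = if e ∈ L then
      (s.edge e).blockEdge.bind fun bE => (s₁.blockEdge bE).departing else (s.edge e).blockEdge)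
    (hsb : ∀ e ∈ C.edges, ∀ e' ∈ C.edges, e.2.1 = e'.2.1 →
      (superBlockOf s' e.2.1 e.2.2 = superBlockOf s' e.2.1 e'.2.2 ↔
        superBlockOf s e.2.1 e.2.2 = superBlockOf s e.2.1 e'.2.2 ∧ (e ∈ L ↔ e' ∈ L)))
    (hmap : ∀ b, (s'.blockEdge b).map = (s₁.blockEdge b).map)
    (hsource : ∀ b, (s₁.blockEdge b).source = none → (s'.blockEdge b).source = none)
    (hdep : ∀ b, (s₁.blockEdge b).departing = none → (s'.blockEdge b).departing = none)
    (hclear : ∀ e ∈ L, ∀ bE, (s'.edge e).blockEdge = some bE →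
        (s'.blockEdge bE).source = none ∧
        ∀ sbE, (s₁.blockEdge bE).source = some sbE → (s'.blockEdge sbE).departing = none) :
    EdgeInv C s' := by
  have hlt : ∀ e ∈ C.edges, ∀ b, (s.edge e).blockEdge = some b → b < s.nextBlockEdge :=
    fun e he b hb => by
      obtain ⟨b', hb', hh⟩ := hs.exists_blockEdge e he
      rw [hb] at hh
      exact Option.some_injective _ hh ▸ hb'
  have hin : ∀ e ∈ L, ∃ bE dbE, (s.edge e).blockEdge = some bE ∧
      (s₁.blockEdge bE).departing = some dbE ∧ (s'.edge e).blockEdge = some dbE := fun e he => by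
    obtain ⟨bE, -, hbE⟩ := hs.exists_blockEdge e (hL e he)
    obtain ⟨dbE, hd⟩ := Option.ne_none_iff_exists'.1
      ((hD.departing e (hL e he) bE hbE).2 ⟨e, he, hbE⟩)
    exact ⟨bE, dbE, hbE, hd, by rw [hedge, if_pos he, hbE, Option.bind_some, hd]⟩
  have hout : ∀ e ∉ L, (s'.edge e).blockEdge = (s.edge e).blockEdge := fun e he => by
    rw [hedge, if_neg he]
  -- Edges in `L` now refer to addresses handed out during the split, all other edges to older ones.
  have hmix : ∀ e ∈ L, ∀ e' ∈ C.edges, e' ∉ L →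
      (s'.edge e).blockEdge ≠ (s'.edge e').blockEdge := fun e he e' he' heL h => by
    obtain ⟨bE, dbE, h1, h2, h3⟩ := hin e he
    rw [h3, hout e' heL] at h
    exact ((hlt e' he' _ h.symm).trans_le (hD.new e (hL e he) bE dbE h1 h2).1).false
  -- Within `L`, the references `departing` and `source` give a bijection between old and new
  -- block-edges.
  have hboth : ∀ e ∈ L, ∀ e' ∈ L, (s'.edge e).blockEdge = (s'.edge e').blockEdge ↔
      (s.edge e).blockEdge = (s.edge e').blockEdge := fun e he e' he' => by
    obtain ⟨bE, dbE, h1, h2, h3⟩ := hin e he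
    obtain ⟨bE', dbE', h1', h2', h3'⟩ := hin e' he'
    have h4 := (hD.new e (hL e he) bE dbE h1 h2).2.2.2.1
    have h4' := (hD.new e' (hL e' he') bE' dbE' h1' h2').2.2.2.1
    rw [h3, h3', h1, h1']
    constructor
    · intro h
      obtain rfl := Option.some_injective _ h
      rw [← h4, ← h4']
    · intro h
      obtain rfl := Option.some_injective _ h
      rw [← h2, ← h2']
  constructor
  · intro e he
    by_cases heL : e ∈ L
    · obtain ⟨bE, dbE, h1, h2, h3⟩ := hin e heL
      exact ⟨dbE, hnext ▸ (hD.new e he bE dbE h1 h2).2.1, h3⟩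
    · obtain ⟨bE, h1, h2⟩ := hs.exists_blockEdge e he
      exact ⟨bE, hnext ▸ h1.trans_le hD.le, (hout e heL).trans h2⟩
  · intro e he e' he'
    have key : (s'.edge e).blockEdge = (s'.edge e').blockEdge ↔
        (s.edge e).blockEdge = (s.edge e').blockEdge ∧ (e ∈ L ↔ e' ∈ L) := by
      by_cases heL : e ∈ L <;> by_cases heL' : e' ∈ L
      · simpa [heL, heL'] using hboth e heL e' heL'
      · simpa [heL, heL'] using hmix e heL e' he' heL'
      · simpa [heL, heL'] using fun h => hmix e' heL' e he heL h.symm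
      · simp [heL, heL', hout]
    rw [key, hs.blockEdge_eq_iff e he e' he']
    constructor
    · rintro ⟨⟨h1, h2, h3⟩, h4⟩
      exact ⟨h1, h2, (hsb e he e' he' h2).2 ⟨h3, h4⟩⟩
    · rintro ⟨h1, h2, h3⟩
      obtain ⟨h3, h4⟩ := (hsb e he e' he' h2).1 h3
      exact ⟨⟨h1, h2, h3⟩, h4⟩
  · intro e he b hb
    rw [hmap]
    by_cases heL : e ∈ L
    · obtain ⟨bE, dbE, h1, h2, h3⟩ := hin e heL
      obtain rfl := Option.some_injective _ (h3.symm.trans hb)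
      rw [(hD.new e he bE dbE h1 h2).2.2.1]
      refine degrees_congr C fun e' he' => ?_
      by_cases heL' : e' ∈ L
      · rw [← h3, ← h1, eq_comm, ← hboth e heL e' heL']
        simp [heL', eq_comm]
      · refine iff_of_false (fun h => heL' h.2) fun h => hmix e heL e' he' heL' ?_
        rw [h3, h]
    · rw [hout e heL] at hb
      rw [hD.map e he b hb]
      refine degrees_congr C fun e' he' => ?_
      by_cases heL' : e' ∈ L
      · refine iff_of_false (fun h => h.2 heL') fun h => hmix e' heL' e he heL ?_
        rw [h, hout e heL, hb]
      · rw [hout e' heL']; simp [heL']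
  · intro e he b hb
    by_cases heL : e ∈ L
    · obtain ⟨bE, dbE, h1, h2, h3⟩ := hin e heL
      obtain rfl := Option.some_injective _ (h3.symm.trans hb)
      exact hdep _ (hD.new e he bE dbE h1 h2).2.2.2.2
    · rw [hout e heL] at hb
      cases hd : (s₁.blockEdge b).departing with
      | none => exact hdep b hd
      | some dbE =>
        -- A block-edge that keeps `e` may have lost other edges to a departing one. Such an edge
        -- `e'` lies in `L`, and clearing at `e'` has reset the reference. Block-edges that lost all
        -- their edges are of no concern to `EdgeInv`.
        obtain ⟨e', he', hb'⟩ := (hD.departing e he b hb).1 (by simp [hd])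
        obtain ⟨bE, dbE, h1, h2, h3⟩ := hin e' he'
        obtain rfl := Option.some_injective _ (h1.symm.trans hb')
        exact (hclear e' he' dbE h3).2 bE (hD.new e' (hL e' he') bE dbE h1 h2).2.2.2.1
  · intro e he b hb
    by_cases heL : e ∈ L
    · exact (hclear e heL b hb).1
    · rw [hout e heL] at hb
      exact hsource b (hD.source e he b hb)

end CompCB2

end

/-! ### One call of `Split` refines the blocks and preserves the invariant -/

section

namespace CompCB2

variable {V VL EL : Type*} {G : FuzzyGraph V VL EL} [DecidableEq V] [DecidableEq EL]

/-- The suprema that the block-edges provide for the edges into the block `Y'`. -/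
theorem Departed.maxKey_eq {C : Choices G} {s s₁ : State V EL} (h : Inv C s) {r : EL} {Y Y' : ℕ}
    {vs : List V} (hvs : ∀ x, x ∈ vs ↔ (s.vertex x).block = some Y')
    (hsub : ∀ x, (s.vertex x).block = some Y' → superBlockOf s r x = some Y)
    (hD : Departed C s (arcs C vs r) (fun bE => ∃ e ∈ arcs C vs r,
      (s.edge e).blockEdge = some bE) s₁) {e : V × EL × V} (he : e ∈ arcs C vs r) :
    ∃ bE dbE, (s.edge e).blockEdge = some bE ∧ (s₁.blockEdge bE).departing = some dbE ∧
      (s₁.blockEdge bE).maxKey = G.supE e.1 r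
        ({y | superBlockOf s r y = some Y} \ {y | (s.vertex y).block = some Y'}) ∧
      (s₁.blockEdge dbE).maxKey = G.supE e.1 r {y | (s.vertex y).block = some Y'} := by
  obtain ⟨heC, hey, her⟩ := mem_arcs.1 he
  obtain ⟨bE, -, hbE⟩ := h.edge.exists_blockEdge e heC
  obtain ⟨dbE, hdbE⟩ := Option.ne_none_iff_exists'.1
    ((hD.departing e heC bE hbE).2 ⟨e, he, hbE⟩)
  have hiff : ∀ e' ∈ C.edges, (s.edge e').blockEdge = some bE ↔
      e'.1 = e.1 ∧ e'.2.1 = r ∧ superBlockOf s r e'.2.2 = some Y := fun e' he' => by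
    rw [← hbE, h.edge.blockEdge_eq_iff e' he' e heC, her]
    refine and_congr_right fun _ => and_congr_right fun h2 => ?_
    rw [h2, hsub e.2.2 ((hvs _).1 hey)]
  have hL : ∀ e' ∈ C.edges, e'.2.1 = r →
      (e' ∈ arcs C vs r ↔ (s.vertex e'.2.2).block = some Y') := fun e' he' hr => by
    rw [mem_arcs, hvs]
    simp [he', hr]
  refine ⟨bE, dbE, hbE, hdbE, ?_, ?_⟩
  · refine BlockEdge.maxKey_eq_supE C (hD.map e heC bE hbE) fun e' he' => ?_
    rw [hiff e' he', and_assoc, and_assoc]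
    refine and_congr_right fun _ => and_congr_right fun hr => ?_
    rw [hL e' he' hr]
    rfl
  · refine BlockEdge.maxKey_eq_supE C (hD.new e heC bE dbE hbE hdbE).2.2.1 fun e' he' => ?_
    rw [hiff e' he', and_assoc, and_assoc]
    refine and_congr_right fun _ => and_congr_right fun hr => ?_
    rw [hL e' he' hr]
    exact ⟨fun h => h.2, fun h => ⟨hsub _ h, h⟩⟩

namespace SplitResult

variable {s s' : State V EL} {Y' Y : ℕ} {r : EL}

omit [DecidableEq V] [DecidableEq EL] in
-- With the next two lemmas this covers all super-blocks of the label after the split: `Y'`, `Y \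
-- Y'`, and the unchanged ones. Super-blocks are compared by address, so it is the freshness of the
-- new address that keeps `Y'` apart.
theorem superBlock_of_mem (hR : SplitResult G s s' Y' Y r) {y : V}
    (hy : (s.vertex y).block = some Y') :
    {z | superBlockOf s' r z = superBlockOf s' r y} = {z | (s.vertex z).block = some Y'} := by
  ext z
  simp only [Set.mem_ofPred_eq, hR.superBlockOf_of_mem y hy]
  refine ⟨fun hz => ?_, hR.superBlockOf_of_mem z⟩
  by_contra hc
  rw [hR.superBlockOf_of_notMem z hc] at hz
  exact hR.fresh z hz

omit [DecidableEq V] [DecidableEq EL] in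
theorem superBlock_of_mem_sdiff (hR : SplitResult G s s' Y' Y r) {y : V}
    (hy : (s.vertex y).block ≠ some Y') (hy' : superBlockOf s r y = some Y) :
    {z | superBlockOf s' r z = superBlockOf s' r y} =
      {y | superBlockOf s r y = some Y} \ {y | (s.vertex y).block = some Y'} := by
  ext z
  simp only [Set.mem_ofPred_eq, Set.mem_sdiff, hR.superBlockOf_of_notMem y hy, hy']
  by_cases hz : (s.vertex z).block = some Y'
  · rw [hR.superBlockOf_of_mem z hz, ← hy']
    exact iff_of_false (fun hc => hR.fresh y hc.symm) fun hc => hc.2 hz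
  · simp [hR.superBlockOf_of_notMem z hz, hz]

omit [DecidableEq V] [DecidableEq EL] in
theorem superBlock_of_notMem (hR : SplitResult G s s' Y' Y r)
    (hsub : ∀ x, (s.vertex x).block = some Y' → superBlockOf s r x = some Y) {y : V}
    (hy' : superBlockOf s r y ≠ some Y) :
    {z | superBlockOf s' r z = superBlockOf s' r y} =
      {z | superBlockOf s r z = superBlockOf s r y} := by
  have hy : (s.vertex y).block ≠ some Y' := fun hc => hy' (hsub y hc)
  ext z
  simp only [Set.mem_ofPred_eq, hR.superBlockOf_of_notMem y hy]
  by_cases hz : (s.vertex z).block = some Y'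
  · rw [hR.superBlockOf_of_mem z hz, hsub z hz]
    exact iff_of_false (fun hc => hR.fresh y hc.symm) fun hc => hy' hc.symm
  · rw [hR.superBlockOf_of_notMem z hz]

end SplitResult

/-- The properties of the blocks in the invariant are preserved by splitting. -/
theorem Inv.of_splitResult {C : Choices G} {s s' : State V EL} (h : Inv C s) {Y' Y : ℕ} {r : EL}
    (hsub : ∀ x, (s.vertex x).block = some Y' → superBlockOf s r x = some Y)
    (hR : SplitResult G s s' Y' Y r) (h1 : Static C s') (h2 : EdgeInv C s')
    (h3 : SupInv s' fun _ _ => False) (h4 : BlkInv s' (fun _ => none) (departing s'))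
    (h5 : ∀ x, (s'.vertex x).processed = false)
    (h6 : ∀ r, ∀ sb ∈ superBlocksOf s' r, ∃ x, superBlockOf s' r x = some sb) : Inv C s' := by
  refine ⟨h1, h2, h3, h4, h5, h6, fun x x' hx r' y => ?_,
    fun x x' hx => h.label x x' ((hR.block_eq_iff x x').1 hx).1, fun R hRb x x' hx =>
    (hR.block_eq_iff x x').2 ⟨h.coarse R hRb x x' hx, hRb.supE_eq (fun y y' hy => ?_) hx r,
      hRb.supE_eq (fun y y' hy => ?_) hx r⟩⟩
  -- Stability with respect to `Y'` and `Y \ Y'` is what the split enforces; for the other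
  -- super-blocks it is inherited, because new blocks are parts of old ones.
  · obtain ⟨hb, hs1, hs2⟩ := (hR.block_eq_iff x x').1 hx
    by_cases hr : r' = r
    · subst hr
      by_cases hy : (s.vertex y).block = some Y'
      · rw [hR.superBlock_of_mem hy, hs1]
      · by_cases hy' : superBlockOf s r' y = some Y
        · rw [hR.superBlock_of_mem_sdiff hy hy', hs2]
        · rw [hR.superBlock_of_notMem hsub hy', h.stable x x' hb]
    · simp only [hR.superBlockOf_of_ne r' hr]
      exact h.stable x x' hb r' y
  -- A bisimulation stays within blocks, so it respects the block `Y'`, and in the next case also `Y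
  -- \ Y'`, which is a union of blocks.
  · change _ = _ ↔ _ = _
    rw [h.coarse R hRb y y' hy]
  · have hb := h.coarse R hRb y y' hy
    simp only [Set.mem_sdiff, Set.mem_ofPred_eq, hb, superBlockOf_eq_of_block_eq hb]

/-- The four procedures are composed by following the key function `c`, given by `subblockKey` at
the two suprema. The splitting loop preserves "same block and same key" and removes all keys, so the
blocks afterwards are the old ones refined by `c`. By `subblockKey_eq_iff` this is the refinement by
both suprema. -/
theorem split_spec (C : Choices G) {s : State V EL} (h : Inv C s) {r : EL} {Y Y' : ℕ}
    (hY : Y ∈ superBlocksOf s r) (hY' : Y' ∈ (s.superBlock Y).blocks)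
    (hlen : 1 < (s.superBlock Y).blocks.length) :
    ∃ s', split C Y' Y r s = some s' ∧ Inv C s' ∧ SplitResult G s s' Y' Y r := by
  obtain ⟨hY'p, hY's⟩ := (h.sup.mem_blocks r Y hY Y').1 hY'
  set vs := (s.block Y').vertices with hvsdef
  have hvs : ∀ x, x ∈ vs ↔ (s.vertex x).block = some Y' := fun x => by
    rw [hvsdef, h.blk.mem_vertices Y' hY'p x]
    simp
  have hnd : vs.Nodup := h.blk.vertices_nodup Y' hY'p
  have hsub : ∀ x, (s.vertex x).block = some Y' → superBlockOf s r x = some Y := fun x hx => by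
    unfold superBlockOf
    rw [hx, Option.bind_some, hY's]
  have hfresh : ∀ r' x, superBlockOf s r' x ≠ some s.nextSuperBlock := fun r' x hx => by
    obtain ⟨b, hb, hxb⟩ := h.blk.exists_block x
    obtain ⟨sb, hs, he⟩ := h.sup.exists_superBlock b hb r' id
    unfold superBlockOf at hx
    rw [hxb, Option.bind_some, he] at hx
    exact (h.sup.lt r' sb hs).ne (Option.some_injective _ hx)
  set L := arcs C vs r with hL
  set Ys : Set V := {y | superBlockOf s r y = some Y}
  set Y's : Set V := {y | (s.vertex y).block = some Y'}
  -- the block-edges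
  obtain ⟨s₁, hs₁, hD⟩ := computeBlockEdges_spec C h.static h.edge hnd r
  have e₁ := hD.eq
  have hv₁ : s₁.vertex = s.vertex := by rw [e₁]
  have hedge₁ : s₁.edge = s.edge := by rw [e₁]
  have hblk₁ : s₁.block = s.block := by rw [e₁]
  have hS₁ : Static C s₁ := by
    refine ⟨?_, ?_, ?_, ?_⟩
    · rw [hv₁]; exact h.static.coming
    · rw [hedge₁]; exact h.static.label
    · rw [hedge₁]; exact h.static.origin
    · rw [hedge₁]; exact h.static.degree
  have hB₁ : BlkInv s₁ (fun _ => none) (departing s₁) :=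
    h.blk.congr (fun x => by rw [hv₁]) (by rw [e₁]) (fun b _ => by rw [hblk₁])
      fun b _ => by unfold departing; rw [hblk₁]
  -- the subblocks
  obtain ⟨s₂, hs₂, e₂, hv₂, hcom₂, hsb₂, hproc₂, hB₂⟩ := computeSubblocks_spec C hS₁ hB₁
    (by rw [hv₁]; exact h.processed) hnd (r := r)
    (κ := fun x => departingKey (G.supE x r (Ys \ Y's)) (G.supE x r Y's)) fun e he => by
      obtain ⟨bE, dbE, h1, h2, h3, h4⟩ := hD.maxKey_eq h hvs hsub he
      exact ⟨bE, dbE, by rw [hedge₁, h1], h2, by rw [h3, h4]⟩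
  -- A vertex that is not the origin of an arc has supremum `0` on `Y'`, for which `subblockKey` is
  -- `none` as well.
  have hc : (fun x => if ∃ e ∈ L, e.1 = x then
      some (departingKey (G.supE x r (Ys \ Y's)) (G.supE x r Y's)) else none) =
      fun x => subblockKey (G.supE x r (Ys \ Y's)) (G.supE x r Y's) := by
    funext x
    have hiff : (∃ e ∈ L, e.1 = x) ↔ G.supE x r Y's ≠ 0 := by
      rw [FuzzyGraph.supE_ne_zero_iff]
      constructor
      · rintro ⟨⟨x', r', y⟩, he, rfl⟩
        obtain ⟨h1, h2, rfl⟩ := mem_arcs.1 he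
        exact ⟨y, (hvs y).1 h2, (C.mem_edges _ _ _).1 h1⟩
      · rintro ⟨y, hy, hE⟩
        exact ⟨(x, r, y), mem_arcs.2 ⟨(C.mem_edges _ _ _).2 hE, (hvs y).2 hy, rfl⟩, rfl⟩
    split_ifs with hx
    · rw [subblockKey_of_ne_zero (hiff.1 hx)]
    · have := not_not.1 (fun hc => hx (hiff.2 hc))
      rw [this, subblockKey, if_pos rfl]
  rw [hc] at hB₂
  set c : V → Option (Bool × Degree) :=
    fun x => subblockKey (G.supE x r (Ys \ Y's)) (G.supE x r Y's) with hcdef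
  have hv₂' : ∀ x, (s₂.vertex x).block = (s.vertex x).block := fun x => by rw [hv₂, hv₁]
  have hsb₂' : ∀ b, (s₂.block b).superBlocks = (s.block b).superBlocks := fun b => by
    rw [hsb₂, hblk₁]
  have hedge₂ : s₂.edge = s.edge := by rw [e₂, hedge₁]
  have hbe₂ : s₂.blockEdge = s₁.blockEdge := by rw [e₂]
  have hSP₂ : s₂.superPartition = s.superPartition := by rw [e₂, e₁]
  have hSB₂ : s₂.superBlock = s.superBlock := by rw [e₂, e₁]
  have hn₂ : s₂.nextSuperBlock = s.nextSuperBlock := by rw [e₂, e₁]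
  have hsup₂ : SupInv s₂ fun _ _ => False :=
    h.sup.congr (by rw [e₂, e₁]) (by rw [e₂, e₁]) hSP₂ hSB₂ hn₂ hsb₂'
  have hQ₂ : superBlocksOf s₂ = superBlocksOf s := by unfold superBlocksOf; rw [hSP₂]
  -- the new super-block
  obtain ⟨t, s₃, ht, htY, hs₃, e₃, hsup₃, hQ₃⟩ := createSuperBlock_spec hsup₂ (r := r) (Y := Y)
    (Y' := Y') (by rw [hQ₂]; exact hY) (by rw [hSB₂]; exact hY') (by rw [hSB₂]; exact hlen)
  have hv₃ : s₃.vertex = s₂.vertex := by rw [e₃]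
  have hedge₃ : s₃.edge = s.edge := by rw [e₃, hedge₂]
  have hbe₃ : s₃.blockEdge = s₁.blockEdge := by rw [e₃, hbe₂]
  have hpart₃ : s₃.partition = s₂.partition := by rw [e₃]
  have hS₃ : Static C s₃ := by
    refine ⟨fun y => ?_, ?_, ?_, ?_⟩
    · rw [hv₃, hcom₂, hv₁, h.static.coming]
    · rw [hedge₃]; exact h.static.label
    · rw [hedge₃]; exact h.static.origin
    · rw [hedge₃]; exact h.static.degree
  have hblock₃ : ∀ b, (s₃.block b).vertices = (s₂.block b).vertices ∧
      (s₃.block b).departing₁ = (s₂.block b).departing₁ ∧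
      (s₃.block b).departing₂ = (s₂.block b).departing₂ := fun b => by
    rw [e₃]
    by_cases hb : b = Y'
    · subst hb; simp
    · simp [hb]
  have hB₃ : BlkInv s₃ c (departing s₃) :=
    hB₂.congr (fun x => by rw [hv₃]) hpart₃ (fun b _ => (hblock₃ b).1) fun b _ => by
      unfold departing
      rw [(hblock₃ b).2.1, (hblock₃ b).2.2]
  have hsb₃ : ∀ r' x, superBlockOf s₃ r' x = if r' = r ∧ (s.vertex x).block = some Y' then
      some s.nextSuperBlock else superBlockOf s r' x := fun r' x => by
    unfold superBlockOf
    rw [hv₃, hv₂']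
    obtain ⟨b, -, hb⟩ := h.blk.exists_block x
    rw [hb, Option.bind_some, Option.bind_some, e₃]
    by_cases hbY : b = Y'
    · subst hbY
      by_cases hr : r' = r
      · subst hr; simp [hn₂]
      · simp [hr, hsb₂']
    · simp [hbY, hsb₂']
  -- the new blocks
  have hEE : ∀ e ∈ L, ∃ bE, (s₃.edge e).blockEdge = some bE := fun e he => by
    obtain ⟨bE, -, hbE⟩ := h.edge.exists_blockEdge e (mem_arcs.1 he).1
    exact ⟨bE, by rw [hedge₃, hbE]⟩
  obtain ⟨s₄, hs₄, c₄, hF, hsup₄, hB₄, hker, hkey, hnone⟩ :=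
    forComingEdges_splitBlock_spec C hS₃ hsup₃ hB₃ hnd (r := r) hEE
  -- Origins of arcs have lost their keys in the loop, and the other vertices never had one.
  have hc₄ : c₄ = fun _ => none := by
    funext x
    rcases hkey x with hx | hx
    · exact hx
    · by_cases hex : ∃ e ∈ L, e.1 = x
      · obtain ⟨e, he, rfl⟩ := hex
        exact hnone e he
      · rw [hx, ← hc]
        simp only [hex, if_false]
  subst hc₄
  have hedge₄ : s₄.edge = departEdges s₃ L := hF.edge
  have hbe₄ : s₄.blockEdge = s₁.blockEdge := hF.blockEdge.trans hbe₃
  have hsb₄ : ∀ r' x, superBlockOf s₄ r' x = if r' = r ∧ (s.vertex x).block = some Y' then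
      some s.nextSuperBlock else superBlockOf s r' x := fun r' x =>
    (hF.superBlockOf r' x).trans (hsb₃ r' x)
  have hQ₄ : ∀ r' sb, sb ∈ superBlocksOf s₄ r' ↔
      sb ∈ superBlocksOf s r' ∨ (r' = r ∧ sb = s.nextSuperBlock) := fun r' sb => by
    rw [(hF.perm r').mem_iff]
    change sb ∈ superBlocksOf s₃ r' ↔ _
    rw [hQ₃, hQ₂, hn₂]
  have hS₄ : Static C s₄ := by
    refine ⟨fun y => (hF.coming y).trans (hS₃.coming y), fun e => ?_, fun e => ?_, fun e => ?_⟩ <;>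
      rw [hedge₄] <;> unfold departEdges <;> split_ifs
    exacts [hS₃.2 e, hS₃.2 e, hS₃.3 e, hS₃.3 e, hS₃.4 e, hS₃.4 e]
  have hedge₄' : ∀ e, (s₄.edge e).blockEdge = if e ∈ L then
      (s.edge e).blockEdge.bind fun bE => (s₁.blockEdge bE).departing
      else (s.edge e).blockEdge := fun e => by
    rw [hedge₄]
    unfold departEdges
    split_ifs
    · rw [hbe₃, hedge₃]
    · rw [hedge₃]
  have hblk₄ : ∀ x x', (s₄.vertex x).block = (s₄.vertex x').block ↔
      (s.vertex x).block = (s.vertex x').block ∧ G.supE x r Y's = G.supE x' r Y's ∧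
      G.supE x r (Ys \ Y's) = G.supE x' r (Ys \ Y's) := fun x x' => by
    have h1 := hker x x'
    simp only [and_true, hv₃, hv₂'] at h1
    rw [h1]
    refine and_congr_right fun hb => ?_
    rw [hcdef]
    refine subblockKey_eq_iff ?_
    rw [← FuzzyGraph.supE_union, ← FuzzyGraph.supE_union,
      Set.sdiff_union_of_subset (show Y's ⊆ Ys from fun y hy => hsub y hy)]
    -- Stability is stated for the super-block of a vertex, so some vertex of `Y` is needed to apply
    -- it. It yields that the suprema on all of `Y` agree, which is the equality of maxima in
    -- `subblockKey_eq_iff`.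
    obtain ⟨y₀, hy₀⟩ := h.nonempty r Y hY
    have := h.stable x x' hb r y₀
    rwa [hy₀] at this
  -- the auxiliary information
  have hEE₄ : ∀ e ∈ L, ∃ bE, (s₄.edge e).blockEdge = some bE := fun e he => by
    obtain ⟨bE, dbE, h1, h2, -⟩ := hD.maxKey_eq h hvs hsub he
    exact ⟨dbE, by rw [hedge₄', if_pos he, h1, Option.bind_some, h2]⟩
  obtain ⟨s₅, hs₅, e₅, hv₅, hcom₅, hproc₅, hmap₅, hsrc₅, hdep₅, hclear₅⟩ :=
    clearAuxiliaryInfo_spec C hS₄ hnd (r := r) hEE₄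
  have hedge₅ : s₅.edge = s₄.edge := by rw [e₅]
  have hblk₅ : s₅.block = s₄.block := by rw [e₅]
  have hSP₅ : s₅.superPartition = s₄.superPartition := by rw [e₅]
  have hsb₅ : ∀ r' x, superBlockOf s₅ r' x = if r' = r ∧ (s.vertex x).block = some Y' then
      some s.nextSuperBlock else superBlockOf s r' x := fun r' x => by
    rw [← hsb₄]
    unfold superBlockOf
    rw [hv₅, hblk₅]
  have hR : SplitResult G s s₅ Y' Y r := by
    refine ⟨fun x x' => ?_, fun r' hr x => ?_, fun x hx => ?_, fun x hx => ?_, hfresh r⟩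
    · rw [hv₅, hv₅, hblk₄]
    · rw [hsb₅, if_neg fun hc => hr hc.1]
    · rw [hsb₅, if_neg fun hc => hx hc.2]
    · rw [hsb₅, if_pos ⟨rfl, hx⟩]
  refine ⟨s₅, ?_, h.of_splitResult hsub hR ?_ ?_ ?_ ?_ ?_ ?_, hR⟩
  · have hdo : doSplitting C Y' vs Y r s₂ = some s₄ := by
      unfold doSplitting
      rw [ht, Option.bind_some, htY, Option.bind_some, hs₃, Option.bind_some]
      exact hs₄
    simp only [split, ← hvsdef]
    rw [hs₁, Option.bind_some, hs₂, Option.bind_some, hdo, Option.bind_some, hs₅]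
  · refine ⟨fun y => (hcom₅ y).trans (hS₄.coming y), ?_, ?_, ?_⟩
    · rw [hedge₅]; exact hS₄.label
    · rw [hedge₅]; exact hS₄.origin
    · rw [hedge₅]; exact hS₄.degree
  · refine h.edge.of_departed hD (fun e he => (mem_arcs.1 he).1) ?_ ?_ ?_ ?_ ?_ ?_ ?_
    · have : s₃.nextBlockEdge = s₁.nextBlockEdge := by rw [e₃, e₂]
      rw [e₅]
      exact hF.nextBlockEdge.trans this
    · rw [hedge₅]; exact hedge₄'
    · intro e he e' he' hl
      have hmem : ∀ e ∈ C.edges, e ∈ L ↔ e.2.1 = r ∧ (s.vertex e.2.2).block = some Y' :=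
        fun e he => by
          rw [hL, mem_arcs, hvs]
          exact ⟨fun h => ⟨h.2.2, h.2.1⟩, fun h => ⟨he, h.2, h.1⟩⟩
      have hiff' : e' ∈ L ↔ e.2.1 = r ∧ (s.vertex e'.2.2).block = some Y' := by
        rw [hmem e' he', hl]
      have hYe : ∀ y, e.2.1 = r ∧ (s.vertex y).block = some Y' →
          superBlockOf s e.2.1 y = some Y := fun y hy => by rw [hy.1]; exact hsub y hy.2
      rw [hsb₅, hsb₅, hmem e he, hiff']
      by_cases h1 : e.2.1 = r ∧ (s.vertex e.2.2).block = some Y' <;>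
        by_cases h2 : e.2.1 = r ∧ (s.vertex e'.2.2).block = some Y'
      · rw [if_pos h1, if_pos h2, hYe _ h1, hYe _ h2]
        simp [h1, h2]
      · rw [if_pos h1, if_neg h2]
        exact iff_of_false (fun hc => hfresh _ _ hc.symm) fun hc => h2 (hc.2.1 h1)
      · rw [if_neg h1, if_pos h2]
        exact iff_of_false (fun hc => hfresh _ _ hc) fun hc => h1 (hc.2.2 h2)
      · rw [if_neg h1, if_neg h2]
        simp only [h1, h2, and_true]
    · intro b; rw [hmap₅, hbe₄]
    · intro b hb; exact hsrc₅ b (by rw [hbe₄, hb])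
    · intro b hb; exact hdep₅ b (by rw [hbe₄, hb])
    · intro e he bE hbE
      rw [hedge₅] at hbE
      have := hclear₅ e he bE hbE
      rw [hbe₄] at this
      exact this
  · exact hsup₄.congr (by rw [e₅]) (by rw [e₅]) hSP₅ (by rw [e₅]) (by rw [e₅])
      fun b => by rw [hblk₅]
  · exact hB₄.congr hv₅ (by rw [e₅]) (fun b _ => by rw [hblk₅]) fun b _ => by
      unfold departing; rw [hblk₅]
  -- The vertices that were marked are origins of arcs, and the clearing loop resets the flag for
  -- each of these.
  · intro x
    by_contra hx
    obtain ⟨h1, h2⟩ := hproc₅ x (by simpa using hx)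
    rw [hF.processed] at h1
    change (s₃.vertex x).processed = true at h1
    rw [hv₃] at h1
    obtain ⟨e, he, hex⟩ := hproc₂ x h1
    exact h2 e he hex
  · intro r' sb hs
    have hs' : sb ∈ superBlocksOf s₄ r' := by
      unfold superBlocksOf at hs ⊢
      rwa [hSP₅] at hs
    rcases (hQ₄ r' sb).1 hs' with hs' | ⟨rfl, rfl⟩
    · by_cases hsY : r' = r ∧ sb = Y
      · obtain ⟨rfl, rfl⟩ := hsY
        -- `Y` has at least two blocks, without repetition, so it keeps one besides `Y'` and stays
        -- non-empty.
        have hex : ∃ b ∈ (s.superBlock sb).blocks, b ≠ Y' := by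
          by_contra! hc
          have : (s.superBlock sb).blocks ⊆ [Y'] := fun b hb => by simp [hc b hb]
          have := ((h.sup.blocks_nodup r' sb hY).subperm this).length_le
          simp only [List.length_singleton] at this
          omega
        obtain ⟨b, hb, hbY⟩ := hex
        obtain ⟨hbp, hbs⟩ := (h.sup.mem_blocks r' sb hY b).1 hb
        obtain ⟨x, hx⟩ := h.blk.nonempty b hbp
        refine ⟨x, ?_⟩
        rw [hR.superBlockOf_of_notMem x (by rw [hx]; simpa using hbY), superBlockOf, hx,
          Option.bind_some, hbs]
      · obtain ⟨x, hx⟩ := h.nonempty r' sb hs'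
        refine ⟨x, ?_⟩
        rw [hsb₅, if_neg, hx]
        rintro ⟨rfl, hxY⟩
        exact hsY ⟨rfl, Option.some_injective _ (hx.symm.trans (hsub x hxY))⟩
    · obtain ⟨x, hx⟩ := h.blk.nonempty Y' hY'p
      exact ⟨x, hR.superBlockOf_of_mem x hx⟩

end CompCB2

end

section

namespace CompCB2

variable {V VL EL : Type*} {G : FuzzyGraph V VL EL} [DecidableEq V] [DecidableEq EL]

/-! ## Initialization -/

omit [DecidableEq EL] in
-- The blank state already contains the values that the constructor assigns.
theorem constructVertices_blank (C : Choices G) :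
    constructVertices C blank = some blank := by
  obtain ⟨s', hs', rfl⟩ := forEach_spec (l := C.vertices)
    (body := fun x (s : State V EL) => some (newVertex x s)) (fun _ s => s = blank) rfl
    (by
      rintro D x R s - rfl
      refine ⟨_, rfl, ?_⟩
      have hu : Function.update (blank : State V EL).vertex x ⟨none, [], false⟩ = blank.vertex :=
        Function.update_eq_self_iff.2 rfl
      exact congrArg (fun v => { (blank : State V EL) with vertex := v }) hu)
  exact hs'

/-- The state after the construction of the edges. -/
def withEdges (C : Choices G) : State V EL :=
  { blank with
    vertex := fun y => ⟨none, C.edges.filter fun e => e.2.2 = y, false⟩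
    edge := fun e => ⟨e.2.1, e.1, e.2.2, G.degree e, none⟩ }

theorem constructEdges_blank (C : Choices G) :
    constructEdges C blank = some (withEdges C) := by
  obtain ⟨s', hs', rfl⟩ := forEach_spec (l := C.edges)
    (body := fun e s => some (newEdge e.2.1 e.1 e.2.2 (G.E e.1 e.2.1 e.2.2) s))
    (fun D s => s = { blank with
      vertex := fun y => ⟨none, D.filter fun e => e.2.2 = y, false⟩
      edge := fun e => ⟨e.2.1, e.1, e.2.2, if e ∈ D then G.degree e else 0, none⟩ })
    (s := blank) (by simp [blank]) (by
      rintro D ⟨x, r, y⟩ R s - rfl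
      refine ⟨_, rfl, ?_⟩
      simp only [newEdge, modVertex, modEdge]
      congr 1
      · funext z
        by_cases hz : z = y
        · subst hz; simp
        · simp [hz, Ne.symm hz]
      · funext e
        by_cases he : e = (x, r, y)
        · subst he; simp
        · simp [he])
  refine hs'.trans ?_
  suffices hf : (fun e : V × EL × V => (⟨e.2.1, e.1, e.2.2,
      if e ∈ C.edges then G.degree e else 0, none⟩ : Edge V EL)) = (withEdges C).edge from
    congrArg (fun f => some { withEdges C with edge := f }) hf
  funext e
  change _ = (⟨_, _, _, G.degree e, _⟩ : Edge V EL)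
  split_ifs with he
  · rfl
  -- `Static` speaks of all triples, also of those that are not edges. Their entries keep the blank
  -- degree `0`, which is their degree in `G`.
  · have : G.degree e = 0 := by
      by_contra hc
      exact he ((C.mem_edges e.1 e.2.1 e.2.2).2
        (lt_of_le_of_ne unitInterval.nonneg' (Ne.symm hc)))
    rw [this]

theorem constructPartitions_spec (C : Choices G) (s : State V EL) :
    ∃ s', constructPartitions C s = some s' ∧
      s' = { s with
        partition := []
        superBlock := s'.superBlock
        nextSuperBlock := s'.nextSuperBlock
        superPartition := s'.superPartition
        msb := s'.msb } ∧
      ∀ r, ∃ sb < s'.nextSuperBlock, s'.msb r = some sb ∧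
        s'.superPartition r = ⟨[], [sb]⟩ ∧ s'.superBlock sb = ⟨[], some r⟩ := by
  obtain ⟨s', hs', h1, h2⟩ := forEach_spec_nodup C.labels_nodup (body := fun r s =>
      let s := newSuperPartition r s
      let sb := s.nextSuperBlock
      let s := newSuperBlock r s
      some { s with msb := Function.update s.msb r (some sb) })
    (fun D s' => s' = { s with
        partition := []
        superBlock := s'.superBlock
        nextSuperBlock := s'.nextSuperBlock
        superPartition := s'.superPartition
        msb := s'.msb } ∧
      ∀ r ∈ D, ∃ sb < s'.nextSuperBlock, s'.msb r = some sb ∧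
        s'.superPartition r = ⟨[], [sb]⟩ ∧ s'.superBlock sb = ⟨[], some r⟩)
    (s := { s with partition := [], msb := fun _ => none }) ⟨rfl, by simp⟩ (by
      rintro D r s' - hrD - ⟨h1, h2⟩
      refine ⟨_, rfl, ?_, fun r' hr' => ?_⟩
      · simp only [newSuperPartition, newSuperBlock, addSuperBlock, modSuperPartition,
          modSuperBlock, Function.update_self, List.length_nil, Nat.not_lt_zero, if_false]
        rw [h1]
      · simp only [newSuperPartition, newSuperBlock, addSuperBlock, modSuperPartition,
          modSuperBlock, Function.update_self, List.length_nil, Nat.not_lt_zero, if_false,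
          List.nil_append]
        by_cases hr : r' = r
        · subst hr
          exact ⟨s'.nextSuperBlock, by simp⟩
        · obtain ⟨sb, h3, h4, h5, h6⟩ := h2 r' (by simpa [hr] using hr')
          exact ⟨sb, by simp [hr, h3.ne, h4, h5, h6, h3.trans (Nat.lt_succ_self _)]⟩)
  exact ⟨s', hs', h1, fun r => h2 r (C.mem_labels r)⟩

/-- The block-edges of the pairs with the property `p` have been created. -/
structure BlockEdgesCreated (s : State V EL) (p : V → EL → Prop) (s' : State V EL) : Prop where
  eq : s' = { s with nextBlockEdge := s'.nextBlockEdge, blockEdges := s'.blockEdges }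
  ne_none : ∀ x r, p x r → s'.blockEdges x r ≠ none
  lt : ∀ x r bE, s'.blockEdges x r = some bE → bE < s'.nextBlockEdge
  inj : ∀ x r x' r' bE, s'.blockEdges x r = some bE → s'.blockEdges x' r' = some bE →
    x = x' ∧ r = r'

/-- Addresses in use lie below `nextBlockEdge`, so the new one preserves injectivity. The table of
block-edges itself does not change, because its entries are empty block-edges from the start. -/
theorem BlockEdgesCreated.create {s s' : State V EL} {p p' : V → EL → Prop}
    (h : BlockEdgesCreated s p s') (hs : ∀ b, s.blockEdge b = ⟨0, none, none⟩) (x : V) (r : EL)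
    (hp : ∀ x' r', p' x' r' → p x' r' ∨ (x' = x ∧ r' = r)) :
    BlockEdgesCreated s p' { newBlockEdge none s' with
      blockEdges := Function.update (newBlockEdge none s').blockEdges x
        (Function.update ((newBlockEdge none s').blockEdges x) r (some s'.nextBlockEdge)) } := by
  have hget : ∀ x' r', Function.update s'.blockEdges x
      (Function.update (s'.blockEdges x) r (some s'.nextBlockEdge)) x' r' =
      if x' = x ∧ r' = r then some s'.nextBlockEdge else s'.blockEdges x' r' := fun x' r' => by
    by_cases hx : x' = x
    · subst hx
      by_cases hr : r' = r
      · subst hr; simp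
      · simp [hr]
    · simp [hx]
  have hbe : Function.update s'.blockEdge s'.nextBlockEdge ⟨0, none, none⟩ = s.blockEdge := by
    have : s'.blockEdge = s.blockEdge := by rw [h.eq]
    rw [this, Function.update_eq_self_iff, hs]
  constructor
  · simp only [newBlockEdge, modBlockEdge]
    rw [hbe, h.eq]
  · intro x' r' hpp
    change Function.update s'.blockEdges x
      (Function.update (s'.blockEdges x) r (some s'.nextBlockEdge)) x' r' ≠ none
    rw [hget]
    split_ifs with hc
    · simp
    · exact h.ne_none x' r' ((hp x' r' hpp).resolve_right hc)
  · intro x' r' bE hb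
    change Function.update s'.blockEdges x
      (Function.update (s'.blockEdges x) r (some s'.nextBlockEdge)) x' r' = _ at hb
    change bE < s'.nextBlockEdge + 1
    rw [hget] at hb
    split_ifs at hb with hc
    · rw [← Option.some_injective _ hb]; exact Nat.lt_succ_self _
    · exact (h.lt x' r' bE hb).trans (Nat.lt_succ_self _)
  · intro x₁ r₁ x₂ r₂ bE h1 h2
    change Function.update s'.blockEdges x
      (Function.update (s'.blockEdges x) r (some s'.nextBlockEdge)) x₁ r₁ = _ at h1
    change Function.update s'.blockEdges x
      (Function.update (s'.blockEdges x) r (some s'.nextBlockEdge)) x₂ r₂ = _ at h2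
    rw [hget] at h1 h2
    split_ifs at h1 h2 with hc hc' hc'
    · exact ⟨hc.1.trans hc'.1.symm, hc.2.trans hc'.2.symm⟩
    · exact absurd (Option.some_injective _ h1) (h.lt x₂ r₂ bE h2).ne'
    · exact absurd (Option.some_injective _ h2) (h.lt x₁ r₁ bE h1).ne'
    · exact h.inj x₁ r₁ x₂ r₂ bE h1 h2

theorem constructBlockEdges_spec (C : Choices G) {s : State V EL}
    (hs : ∀ b, s.blockEdge b = ⟨0, none, none⟩) :
    ∃ s', constructBlockEdges C s = some s' ∧ BlockEdgesCreated s (fun _ _ => True) s' := by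
  obtain ⟨s', hs', h⟩ := forEach_spec (l := C.vertices)
    (body := fun x => forEach C.labels fun r s =>
      let bE := s.nextBlockEdge
      let s := newBlockEdge none s
      some { s with
        blockEdges := Function.update s.blockEdges x
          (Function.update (s.blockEdges x) r (some bE)) })
    (fun D s' => BlockEdgesCreated s (fun x _ => x ∈ D) s')
    (s := { s with blockEdges := fun _ _ => none })
    ⟨rfl, by simp, by simp, by simp⟩ (by
      rintro D x R s' - h
      obtain ⟨s'', hs'', h'⟩ := forEach_spec (l := C.labels)
        (body := fun r s =>
          let bE := s.nextBlockEdge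
          let s := newBlockEdge none s
          some { s with
            blockEdges := Function.update s.blockEdges x
              (Function.update (s.blockEdges x) r (some bE)) })
        (fun D' s' => BlockEdgesCreated s (fun x' r => x' ∈ D ∨ (x' = x ∧ r ∈ D')) s')
        (s := s') (by simpa using h) (by
          rintro D' r R' s' - h
          refine ⟨_, rfl, h.create hs x r ?_⟩
          rintro x' r' (h1 | ⟨rfl, h1⟩)
          · exact Or.inl (Or.inl h1)
          · rcases List.mem_append.1 h1 with h1 | h1
            · exact Or.inl (Or.inr ⟨rfl, h1⟩)
            · exact Or.inr ⟨rfl, List.mem_singleton.1 h1⟩)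
      exact ⟨s'', hs'', { h' with ne_none := fun x' r hx => h'.ne_none x' r (by
        simpa [C.mem_labels] using hx) }⟩)
  exact ⟨s', hs', { h with ne_none := fun x r _ => h.ne_none x r (C.mem_vertices x) }⟩

theorem fillBlockEdges_spec (C : Choices G) {s : State V EL} (hS : Static C s)
    (hs : ∀ b, s.blockEdge b = ⟨0, none, none⟩) (hbE : ∀ x r, s.blockEdges x r ≠ none) :
    ∃ s', fillBlockEdges C s = some s' ∧
      s' = { s with edge := s'.edge, blockEdge := s'.blockEdge } ∧ Static C s' ∧
      (∀ e ∈ C.edges, (s'.edge e).blockEdge = s.blockEdges e.1 e.2.1) ∧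
      ∀ b, s'.blockEdge b = ⟨degrees C fun e => s.blockEdges e.1 e.2.1 = some b, none, none⟩ := by
  obtain ⟨s', hs', h1, h2, h3, h4⟩ := forEach_spec_nodup C.edges_nodup (body := fun e s =>
      let s := modEdge e
        (fun E => { E with blockEdge := s.blockEdges (s.edge e).origin (s.edge e).label }) s
      (s.edge e).blockEdge.bind fun bE => some (pushKey bE (s.edge e).degree s))
    (fun D s' => s' = { s with edge := s'.edge, blockEdge := s'.blockEdge } ∧ Static C s' ∧
      (∀ e ∈ D, (s'.edge e).blockEdge = s.blockEdges e.1 e.2.1) ∧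
      ∀ b, s'.blockEdge b =
        ⟨degrees C fun e => s.blockEdges e.1 e.2.1 = some b ∧ e ∈ D, none, none⟩)
    (s := s) ⟨rfl, hS, by simp, fun b => by rw [hs, degrees_eq_zero]; simp⟩ (by
      rintro D e s' he heD - ⟨h1, h2, h3, h4⟩
      obtain ⟨bE, hb⟩ := Option.ne_none_iff_exists'.1 (hbE e.1 e.2.1)
      have hbes : s'.blockEdges = s.blockEdges := by rw [h1]
      set s₁ := modEdge e (fun E => { E with
        blockEdge := s'.blockEdges (s'.edge e).origin (s'.edge e).label }) s' with hs₁
      have hself : s₁.edge e = { s'.edge e with blockEdge := some bE } := by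
        simp [hs₁, modEdge, h2.origin, h2.label, hbes, hb]
      have hother : ∀ e', e' ≠ e → s₁.edge e' = s'.edge e' := fun e' h => by
        simp [hs₁, modEdge, h]
      have hdeg : (s₁.edge e).degree = G.degree e := by rw [hself]; exact h2.degree e
      refine ⟨pushKey bE (G.degree e) s₁, ?_, ?_, ⟨h2.coming, fun e' => ?_, fun e' => ?_,
        fun e' => ?_⟩, fun e' he' => ?_, fun b => ?_⟩
      · dsimp only
        rw [hdeg, hself]
        rfl
      · simp only [pushKey, modBlockEdge, hs₁, modEdge]
        rw [h1]
      · by_cases hee : e' = e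
        · subst hee; exact (congrArg Edge.label hself).trans (h2.label e')
        · exact (congrArg Edge.label (hother e' hee)).trans (h2.label e')
      · by_cases hee : e' = e
        · subst hee; exact (congrArg Edge.origin hself).trans (h2.origin e')
        · exact (congrArg Edge.origin (hother e' hee)).trans (h2.origin e')
      · by_cases hee : e' = e
        · subst hee; exact (congrArg Edge.degree hself).trans (h2.degree e')
        · exact (congrArg Edge.degree (hother e' hee)).trans (h2.degree e')
      · by_cases hee : e' = e
        · subst hee; exact (congrArg Edge.blockEdge hself).trans hb.symm
        · exact (congrArg Edge.blockEdge (hother e' hee)).trans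
            (h3 e' (by simpa [hee] using he'))
      · by_cases hbb : b = bE
        · subst hbb
          have h5 : degrees C (fun e' => s.blockEdges e'.1 e'.2.1 = some b ∧ e' ∈ D ++ [e]) =
              G.degree e ::ₘ degrees C (fun e' => s.blockEdges e'.1 e'.2.1 = some b ∧ e' ∈ D) := by
            refine degrees_insert C he (fun hc => heD hc.2) fun e' _ => ?_
            by_cases hee : e' = e
            · subst hee; simp [hb]
            · simp [hee]
          rw [h5]
          simp [pushKey, modBlockEdge, hs₁, modEdge, h4]
        · have h5 : degrees C (fun e' => s.blockEdges e'.1 e'.2.1 = some b ∧ e' ∈ D ++ [e]) =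
              degrees C (fun e' => s.blockEdges e'.1 e'.2.1 = some b ∧ e' ∈ D) := by
            refine degrees_congr C fun e' _ => and_congr_right fun h6 => ?_
            have : e' ≠ e := by
              rintro rfl
              exact hbb (Option.some_injective _ (h6.symm.trans hb))
            simp [this]
          rw [h5]
          simp [pushKey, modBlockEdge, hs₁, modEdge, hbb, h4])
  refine ⟨s', hs', h1, h2, h3, fun b => ?_⟩
  rw [h4, degrees_congr C (q := fun e => s.blockEdges e.1 e.2.1 = some b)]
  intro e he
  simp [he]

/-- The blocks for the lists in `D` have been created. -/
structure BlocksCreated (s : State V EL) (D : List (List V)) (s' : State V EL) : Prop where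
  eq : s' = { s with
    vertex := s'.vertex
    block := s'.block
    nextBlock := s'.nextBlock
    partition := s'.partition
    superBlock := s'.superBlock
    superPartition := s'.superPartition }
  sup : SupInv s' fun _ _ => False
  perm : ∀ r, (superBlocksOf s' r).Perm (superBlocksOf s r)
  coming : ∀ x, (s'.vertex x).comingEdges = (s.vertex x).comingEdges
  processed : ∀ x, (s'.vertex x).processed = (s.vertex x).processed
  vertices_nodup : ∀ b ∈ s'.partition, (s'.block b).vertices.Nodup
  mem_vertices : ∀ b ∈ s'.partition, ∀ x, x ∈ (s'.block b).vertices ↔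
    (s'.vertex x).block = some b
  vertices_ne_nil : ∀ b ∈ s'.partition, (s'.block b).vertices ≠ []
  departing : ∀ b ∈ s'.partition, CompCB2.departing s' b = fun _ => none
  superBlocks : ∀ b ∈ s'.partition, (s'.block b).superBlocks = s.msb
  mem_partition : ∀ x b, (s'.vertex x).block = some b → b ∈ s'.partition
  block_ne_none : ∀ x, (s'.vertex x).block ≠ none ↔ ∃ X ∈ D, x ∈ X
  block_eq : ∀ x x', ((s'.vertex x).block ≠ none ∧ (s'.vertex x).block = (s'.vertex x').block) ↔
    ∃ X ∈ D, x ∈ X ∧ x' ∈ X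

/-- By `hdisj` no vertex of `X` has a block yet, so assigning the new block takes no vertex away
from an earlier one. -/
theorem BlocksCreated.create (C : Choices G) {s s' : State V EL} {D : List (List V)}
    (h : BlocksCreated s D s') {X : List V} (hX : X.Nodup) (hne : X ≠ [])
    (hdisj : ∀ x ∈ X, ∀ X' ∈ D, x ∉ X')
    (hm : ∀ r, ∃ sb ∈ superBlocksOf s r, s.msb r = some sb) :
    ∃ s'', newBlock C X (some s'.msb) s' = some s'' ∧ BlocksCreated s (D ++ [X]) s'' := by
  have hmsb : s'.msb = s.msb := by rw [h.eq]
  obtain ⟨SB, SP, s'', hs'', e, hsup, hperm⟩ := newBlock_spec C h.sup X (m := s'.msb) fun r => by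
    obtain ⟨sb, h1, h2⟩ := hm r
    exact ⟨sb, (h.perm r).mem_iff.2 h1, by rw [hmsb, h2]⟩
  have hpart : ∀ b, b ∈ s''.partition ↔ b ∈ s'.partition ∨ b = s'.nextBlock := fun b => by
    rw [e]; simp
  have hnew : ∀ b ∈ s'.partition, b ≠ s'.nextBlock := fun b hb => (h.sup.partition_lt b hb).ne
  have hblock : ∀ b ∈ s'.partition, s''.block b = s'.block b := fun b hb => by
    rw [e]; simp [hnew b hb]
  have hblockn : s''.block s'.nextBlock = ⟨X, s'.msb, ∅, ∅⟩ := by rw [e]; simp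
  have hv : ∀ x, (s''.vertex x).block =
      if x ∈ X then some s'.nextBlock else (s'.vertex x).block := fun x => by
    rw [e]; dsimp only; split_ifs <;> rfl
  have hXnone : ∀ x ∈ X, (s'.vertex x).block = none := fun x hx => by
    by_contra hc
    obtain ⟨X', h1, h2⟩ := (h.block_ne_none x).1 hc
    exact hdisj x hx X' h1 h2
  refine ⟨s'', hs'', ?_, hsup, fun r => (hperm r).trans (h.perm r), fun x => ?_, fun x => ?_,
    fun b hb => ?_, fun b hb x => ?_, fun b hb => ?_, fun b hb => ?_, fun b hb => ?_,
    fun x b hb => ?_, fun x => ?_, fun x x' => ?_⟩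
  · rw [e, h.eq]
  · rw [← h.coming, e]; dsimp only; split_ifs <;> rfl
  · rw [← h.processed, e]; dsimp only; split_ifs <;> rfl
  · rcases (hpart b).1 hb with hb | rfl
    · rw [hblock b hb]; exact h.vertices_nodup b hb
    · rw [hblockn]; exact hX
  · rw [hv]
    rcases (hpart b).1 hb with hb | rfl
    · rw [hblock b hb, h.mem_vertices b hb]
      split_ifs with hx
      · simp [hXnone x hx, (hnew b hb).symm]
      · rfl
    · rw [hblockn]
      split_ifs with hx
      · simp [hx]
      · exact iff_of_false hx fun hc => hnew _ (h.mem_partition x _ hc) rfl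
  · rcases (hpart b).1 hb with hb | rfl
    · rw [hblock b hb]; exact h.vertices_ne_nil b hb
    · rw [hblockn]; exact hne
  · rcases (hpart b).1 hb with hb | rfl
    · rw [← h.departing b hb]
      unfold CompCB2.departing
      rw [hblock b hb]
    · unfold CompCB2.departing
      rw [hblockn]
      simp
  · rcases (hpart b).1 hb with hb | rfl
    · rw [hblock b hb]; exact h.superBlocks b hb
    · rw [hblockn]; exact hmsb
  · rw [hv] at hb
    rw [hpart]
    split_ifs at hb with hx
    · exact Or.inr (Option.some_injective _ hb).symm
    · exact Or.inl (h.mem_partition x b hb)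
  · rw [hv]
    simp only [List.mem_append, List.mem_singleton, or_and_right, exists_or, exists_eq_left,
      ← h.block_ne_none]
    split_ifs with hx <;> simp [hx]
  · rw [hv, hv]
    simp only [List.mem_append, List.mem_singleton, or_and_right, exists_or, exists_eq_left,
      ← h.block_eq]
    split_ifs with hx hx' hx'
    · simp [hx, hx']
    · simp only [hx', and_false, or_false, hXnone x hx, ne_eq, not_true, false_and, iff_false,
        not_and]
      exact fun _ hc => hnew _ (h.mem_partition x' _ hc.symm) rfl
    · simp only [hx, false_and, or_false, hXnone x' hx', ne_eq]
      constructor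
      · rintro ⟨-, hc⟩
        exact absurd rfl (hnew _ (h.mem_partition x _ hc))
      · rintro ⟨h1, h2⟩
        exact absurd h2 h1
    · simp [hx]

/-- Each label has only one super-block at first, so a single block-edge collects all edges with
given origin and label, and its greatest key is the supremum over all of `V`. The initial lists are
therefore the classes of `initialSetoid`, and stability with respect to the only super-block is part
of that relation. -/
theorem setUp_spec [Nonempty V] (C : Choices G) : ∃ s, setUp C blank = some s ∧ Inv C s ∧
    (∀ x x', (s.vertex x).block = (s.vertex x').block ↔ G.initialSetoid x x') ∧
    ∀ r x x', superBlockOf s r x = superBlockOf s r x' := by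
  obtain ⟨s₁, hs₁, e₁, hmsb⟩ := constructPartitions_spec C (withEdges C)
  have hbe₁ : ∀ b, s₁.blockEdge b = ⟨0, none, none⟩ := fun b => by rw [e₁]; rfl
  obtain ⟨s₂, hs₂, hE⟩ := constructBlockEdges_spec C hbe₁
  have e₂ := hE.eq
  have hS₂ : Static C s₂ := by
    rw [e₂, e₁]
    exact ⟨fun _ => rfl, fun _ => rfl, fun _ => rfl, fun _ => rfl⟩
  have hbe₂ : ∀ b, s₂.blockEdge b = ⟨0, none, none⟩ := fun b => by rw [e₂]; exact hbe₁ b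
  obtain ⟨s₃, hs₃, e₃, hS₃, hedge, hbe⟩ := fillBlockEdges_spec C hS₂ hbe₂
    fun x r => hE.ne_none x r trivial
  have hv₃ : ∀ x, (s₃.vertex x).block = none := fun x => by rw [e₃, e₂, e₁]; rfl
  have hp₃ : ∀ x, (s₃.vertex x).processed = false := fun x => by rw [e₃, e₂, e₁]; rfl
  have hpart₃ : s₃.partition = [] := by rw [e₃, e₂, e₁]
  have hmsb₃ : s₃.msb = s₁.msb := by rw [e₃, e₂]
  have hSP₃ : s₃.superPartition = s₁.superPartition := by rw [e₃, e₂]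
  have hSB₃ : s₃.superBlock = s₁.superBlock := by rw [e₃, e₂]
  have hn₃ : s₃.nextSuperBlock = s₁.nextSuperBlock := by rw [e₃, e₂]
  have hbes₃ : s₃.blockEdges = s₂.blockEdges := by rw [e₃]
  choose sb hsblt hsbmsb hsbSP hsbSB using hmsb
  have hQ₃ : ∀ r, superBlocksOf s₃ r = [sb r] := fun r => by
    unfold superBlocksOf
    rw [hSP₃, hsbSP]
    rfl
  have hsup₃ : SupInv s₃ fun _ _ => False := by
    refine ⟨by simp [hpart₃], by simp [hpart₃], fun r => by simp [hQ₃], fun r b hb => ?_,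
      fun r b hb => ?_, fun r b hb => ?_, fun r b hb => ?_, fun r b hb => ?_, by simp [hpart₃]⟩ <;>
      rw [hQ₃, List.mem_singleton] at hb <;> subst hb
    · rw [hn₃]; exact hsblt r
    · rw [hSB₃, hsbSB]
    · rw [hSB₃, hsbSB]; exact List.nodup_nil
    · simp [hSB₃, hsbSB, hpart₃]
    · simp [hSB₃, hsbSB, hSP₃, hsbSP]
  -- the lists that represent the initial blocks
  set key : V → EL → Option Degree :=
    fun x r => (s₃.blockEdges x r).map fun bE => (s₃.blockEdge bE).maxKey with hkeydef
  have hkey : ∀ x r, key x r = some (G.supE x r Set.univ) := fun x r => by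
    obtain ⟨bE, hbE⟩ := Option.ne_none_iff_exists'.1 (hE.ne_none x r trivial)
    rw [hkeydef]
    dsimp only
    rw [hbes₃, hbE, Option.map_some]
    congr 1
    refine BlockEdge.maxKey_eq_supE C (congrArg BlockEdge.map (hbe bE)) fun e he => ?_
    constructor
    · intro h
      obtain ⟨h1, h2⟩ := hE.inj _ _ _ _ _ h hbE
      exact ⟨h1, h2, trivial⟩
    · rintro ⟨rfl, rfl, -⟩
      exact hbE
  obtain ⟨s, hs, hB⟩ := forEach_spec (l := C.classes key)
    (body := fun X s => newBlock C X (some s.msb) s)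
    (fun D s => BlocksCreated s₃ D s) (s := s₃)
    (by
      refine ⟨rfl, hsup₃, fun _ => .refl _, fun _ => rfl, fun _ => rfl, ?_, ?_, ?_, ?_, ?_, ?_,
        ?_, ?_⟩ <;> simp [hpart₃, hv₃])
    (by
      intro D X R s hl hD
      have hnd := C.classes_nodup key
      rw [hl, List.flatten_append, List.flatten_cons, List.nodup_append, List.nodup_append] at hnd
      refine hD.create C hnd.2.1.1 (fun hX => C.classes_nonempty key ?_) (fun x hx X' hX' hx' => ?_)
        fun r => ⟨sb r, by rw [hQ₃]; simp, by rw [hmsb₃, hsbmsb]⟩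
      · rw [hl, hX]; simp
      · exact hnd.2.2 x (List.mem_flatten.2 ⟨X', hX', hx'⟩) x (by simp [hx]) rfl)
  have hne : ∀ x, (s.vertex x).block ≠ none := fun x => by
    obtain ⟨X, hX, hx, -⟩ := (C.mem_classes key x x).2 ⟨rfl, fun _ => rfl⟩
    exact (hB.block_ne_none x).2 ⟨X, hX, hx⟩
  have hblk : ∀ x x', (s.vertex x).block = (s.vertex x').block ↔ G.initialSetoid x x' :=
    fun x x' => by
      have := hB.block_eq x x'
      rw [C.mem_classes key x x', and_iff_right (hne x)] at this
      rw [this]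
      simp only [hkey, Option.some.injEq]
      rfl
  have hsbof : ∀ r x, superBlockOf s r x = some (sb r) := fun r x => by
    obtain ⟨b, hb⟩ := Option.ne_none_iff_exists'.1 (hne x)
    rw [superBlockOf, hb, Option.bind_some, hB.superBlocks b (hB.mem_partition x b hb), hmsb₃,
      hsbmsb]
  have hedge_s : s.edge = s₃.edge := by rw [hB.eq]
  have hbe_s : s.blockEdge = s₃.blockEdge := by rw [hB.eq]
  have hnext : s.nextBlockEdge = s₂.nextBlockEdge := by rw [hB.eq, e₃]
  refine ⟨s, ?_, ?_, hblk, fun r x x' => by rw [hsbof, hsbof]⟩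
  · unfold setUp
    rw [constructVertices_blank, Option.bind_some, constructEdges_blank, Option.bind_some, hs₁,
      Option.bind_some, hs₂, Option.bind_some, hs₃, Option.bind_some]
    exact hs
  · refine ⟨⟨fun y => (hB.coming y).trans (hS₃.coming y), ?_, ?_, ?_⟩, ⟨?_, ?_, ?_, ?_, ?_⟩,
      hB.sup, ⟨?_, hB.vertices_nodup, ?_, ?_, ?_, ?_, ?_, ?_⟩, ?_, ?_, ?_, ?_, ?_⟩
    · rw [hedge_s]; exact hS₃.label
    · rw [hedge_s]; exact hS₃.origin
    · rw [hedge_s]; exact hS₃.degree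
    · intro e he
      obtain ⟨bE, hbE⟩ := Option.ne_none_iff_exists'.1 (hE.ne_none e.1 e.2.1 trivial)
      exact ⟨bE, by rw [hnext]; exact hE.lt _ _ _ hbE, by rw [hedge_s, hedge e he, hbE]⟩
    · intro e he e' he'
      rw [hedge_s, hedge e he, hedge e' he', hsbof, hsbof]
      obtain ⟨bE, hbE⟩ := Option.ne_none_iff_exists'.1 (hE.ne_none e.1 e.2.1 trivial)
      constructor
      · intro h
        obtain ⟨h1, h2⟩ := hE.inj _ _ _ _ _ hbE (h ▸ hbE)
        exact ⟨h1, h2, rfl⟩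
      · rintro ⟨h1, h2, -⟩
        rw [h1, h2]
    · intro e he bE hbE
      rw [hbe_s, hbe, hedge_s]
      exact degrees_congr C fun e' he' => by rw [hedge e' he']
    · intro e he bE hbE
      rw [hbe_s, hbe]
    · intro e he bE hbE
      rw [hbe_s, hbe]
    · intro x
      obtain ⟨b, hb⟩ := Option.ne_none_iff_exists'.1 (hne x)
      exact ⟨b, hB.mem_partition x b hb, hb⟩
    · intro b hb x
      simpa using hB.mem_vertices b hb x
    · intro b hb k l hl
      simp [hB.departing b hb] at hl
    · intro b hb k l hl
      simp [hB.departing b hb] at hl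
    · intro b hb k l hl
      simp [hB.departing b hb] at hl
    · intro b hb k hk x hx
      simp
    · intro b hb
      obtain ⟨x, hx⟩ := List.exists_mem_of_ne_nil _ (hB.vertices_ne_nil b hb)
      exact ⟨x, (hB.mem_vertices b hb x).1 hx⟩
    · intro x
      rw [hB.processed, hp₃]
    · intro r b hb
      rw [(hB.perm r).mem_iff, hQ₃, List.mem_singleton] at hb
      obtain ⟨x⟩ := ‹Nonempty V›
      exact ⟨x, by rw [hsbof, hb]⟩
    · intro x x' hx r y
      have : {z | superBlockOf s r z = superBlockOf s r y} = Set.univ := by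
        ext z; simp [hsbof]
      rw [this]
      exact ((hblk x x').1 hx).2 r
    · exact fun x x' hx => ((hblk x x').1 hx).1
    · intro R hR x x' hx
      exact (hblk x x').2 ⟨hR.2.1 x x' hx, fun r => hR.supE_eq (fun _ _ _ => Iff.rfl) hx r⟩

end CompCB2

end

section

namespace CompCB2

variable {V VL EL : Type*} {G : FuzzyGraph V VL EL}

/-! ## The main loops -/

/-- The partition into blocks, as an equivalence relation. -/
abbrev blockSetoid (s : State V EL) : Setoid V := Setoid.ker fun x => (s.vertex x).block

/-- The partition into the super-blocks of `ℚ[r]`, as an equivalence relation. -/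
abbrev superBlockSetoid (s : State V EL) (r : EL) : Setoid V := Setoid.ker (superBlockOf s r)

theorem SplitResult.isSplitPartition {s s' : State V EL} {Y' Y : ℕ} {r : EL}
    (hR : SplitResult G s s' Y' Y r) :
    IsSplitPartition G {y | (s.vertex y).block = some Y'} {y | superBlockOf s r y = some Y} r
      (blockSetoid s).classes (blockSetoid s').classes :=
  isSplitPartition_classes hR.block_eq_iff

/-- The number of triples of an edge label and two vertices in the same super-block. -/
def weight (s : State V EL) : ℕ :=
  {p : EL × V × V | superBlockOf s p.1 p.2.1 = superBlockOf s p.1 p.2.2}.ncard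

variable [DecidableEq V] [DecidableEq EL]

theorem Inv.exists_superBlock {C : Choices G} {s : State V EL} (h : Inv C s) (r : EL) (x : V) :
    ∃ b ∈ s.partition, ∃ sb ∈ superBlocksOf s r, (s.vertex x).block = some b ∧
      superBlockOf s r x = some sb ∧ b ∈ (s.superBlock sb).blocks := by
  obtain ⟨b, hb, hx⟩ := h.blk.exists_block x
  obtain ⟨sb, hs, he⟩ := h.sup.exists_superBlock b hb r id
  exact ⟨b, hb, sb, hs, hx, by rw [superBlockOf, hx, Option.bind_some, he],
    (h.sup.mem_blocks r sb hs b).2 ⟨hb, he⟩⟩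

theorem Inv.blockSet_eq {C : Choices G} {s : State V EL} (h : Inv C s) {b : ℕ}
    (hb : b ∈ s.partition) : blockSet s b = {x | (s.vertex x).block = some b} := by
  ext x
  simpa [blockSet] using h.blk.mem_vertices b hb x

theorem Inv.superBlockSet_eq {C : Choices G} {s : State V EL} (h : Inv C s) {r : EL} {sb : ℕ}
    (hs : sb ∈ superBlocksOf s r) : superBlockSet s sb = {x | superBlockOf s r x = some sb} := by
  ext x
  simp only [superBlockSet, Set.mem_iUnion, exists_prop, Set.mem_ofPred_eq]
  constructor
  · rintro ⟨b, hb, hx⟩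
    obtain ⟨hbp, hbs⟩ := (h.sup.mem_blocks r sb hs b).1 hb
    rw [h.blockSet_eq hbp] at hx
    rw [superBlockOf, show (s.vertex x).block = some b from hx, Option.bind_some, hbs]
  · intro hx
    obtain ⟨b, hb, sb', hs', hxb, hx', hmem⟩ := h.exists_superBlock r x
    obtain rfl := Option.some_injective _ (hx'.symm.trans hx)
    exact ⟨b, hmem, by rw [h.blockSet_eq hb]; exact hxb⟩

/-- Every block and every super-block contains a vertex, so they are the fibres of the maps from
vertices to their addresses. The simulation can thus be argued with equivalence relations instead of
lists. -/
theorem Inv.config_eq {C : Choices G} {s : State V EL} (h : Inv C s) :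
    config s = ⟨(blockSetoid s).classes, fun r => (superBlockSetoid s r).classes⟩ := by
  unfold config
  congr 1
  · ext X
    constructor
    · rintro ⟨b, hb, rfl⟩
      obtain ⟨x, hx⟩ := h.blk.nonempty b hb
      exact ⟨x, by rw [h.blockSet_eq hb, ← hx]; rfl⟩
    · rintro ⟨x, rfl⟩
      obtain ⟨b, hb, hx⟩ := h.blk.exists_block x
      exact ⟨b, hb, by rw [h.blockSet_eq hb, ← hx]; rfl⟩
  · funext r
    ext X
    constructor
    · rintro ⟨sb, hs, rfl⟩
      obtain ⟨x, hx⟩ := h.nonempty r sb hs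
      exact ⟨x, by rw [h.superBlockSet_eq hs, ← hx]; rfl⟩
    · rintro ⟨x, rfl⟩
      obtain ⟨b, hb, sb, hs, -, hx, -⟩ := h.exists_superBlock r x
      exact ⟨sb, hs, by rw [h.superBlockSet_eq hs, ← hx]; rfl⟩

theorem Inv.ncard_block {C : Choices G} {s : State V EL} (h : Inv C s) {b : ℕ}
    (hb : b ∈ s.partition) :
    {x | (s.vertex x).block = some b}.ncard = (s.block b).vertices.length := by
  rw [← h.blockSet_eq hb, ← List.toFinset_card_of_nodup (h.blk.vertices_nodup b hb),
    ← Set.ncard_coe_finset]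
  congr 1
  ext x
  simp [blockSet]

/-- The choice of the smaller one of two blocks of a super-block. -/
theorem exists_smallerBlock (C : Choices G) {s : State V EL} {Y : ℕ}
    (hnd : (s.superBlock Y).blocks.Nodup) (hlen : 1 < (s.superBlock Y).blocks.length) :
    ∃ Y' Z, smallerBlock C Y s = some Y' ∧ Y' ∈ (s.superBlock Y).blocks ∧
      Z ∈ (s.superBlock Y).blocks ∧ Y' ≠ Z ∧
      (s.block Y').vertices.length ≤ (s.block Z).vertices.length := by
  unfold smallerBlock
  match hb : (s.superBlock Y).blocks with
  | [] => simp [hb] at hlen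
  | [_] => simp [hb] at hlen
  | b₁ :: b₂ :: l =>
    have hne : b₁ ≠ b₂ := by
      rw [hb] at hnd
      intro hc
      simp [hc] at hnd
    dsimp only
    split_ifs with h1 h2 h3
    · exact ⟨b₁, b₂, rfl, by simp, by simp, hne, h1.le⟩
    · exact ⟨b₂, b₁, rfl, by simp, by simp, hne.symm, h2.le⟩
    · exact ⟨b₁, b₂, rfl, by simp, by simp, hne, not_lt.1 h2⟩
    · exact ⟨b₂, b₁, rfl, by simp, by simp, hne.symm, not_lt.1 h1⟩

theorem Inv.withChanged {C : Choices G} {s : State V EL} (h : Inv C s) (c : Bool) :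
    Inv C { s with changed := c } :=
  ⟨⟨h.static.1, h.static.2, h.static.3, h.static.4⟩,
    ⟨h.edge.1, h.edge.2, h.edge.3, h.edge.4, h.edge.5⟩,
    h.sup.congr rfl rfl rfl rfl rfl fun _ => rfl,
    h.blk.congr (fun _ => rfl) rfl (fun _ _ => rfl) fun _ _ => rfl,
    h.processed, h.nonempty, h.stable, h.label, h.coarse⟩

/-- A compound super-block contains another block `Z` that is at least as large as the chosen `Y'`.
It provides everything that a step of CompCB requires: `Y'` is a proper subset of `Y`, it has at
most half of its size, and `Y` is not itself a block. It also provides the pair that the split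
separates. -/
theorem splitFirst_spec [Finite V] [Finite EL] (C : Choices G) {s : State V EL} (h : Inv C s)
    {r : EL} (hr : (s.superPartition r).compound ≠ []) :
    ∃ s', splitFirst C r s = some s' ∧ Inv C s' ∧ s'.changed = true ∧ weight s' < weight s ∧
      CompCB.Step G (config s) (config s') := by
  obtain ⟨Y, l, hYl⟩ := List.exists_cons_of_ne_nil hr
  have hYc : Y ∈ (s.superPartition r).compound := by rw [hYl]; simp
  have hY : Y ∈ superBlocksOf s r := List.mem_append_left _ hYc
  have hlen := (h.sup.mem_compound r Y hY).1 hYc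
  obtain ⟨Y', Z, hsm, hY', hZ, hne, hle⟩ :=
    exists_smallerBlock C (h.sup.blocks_nodup r Y hY) hlen
  obtain ⟨s₁, hs₁, h₁, hR⟩ := split_spec C h hY hY' hlen
  obtain ⟨hY'p, hY's⟩ := (h.sup.mem_blocks r Y hY Y').1 hY'
  obtain ⟨hZp, hZs⟩ := (h.sup.mem_blocks r Y hY Z).1 hZ
  have hsub : ∀ x, (s.vertex x).block = some Y' → superBlockOf s r x = some Y := fun x hx => by
    rw [superBlockOf, hx, Option.bind_some, hY's]
  have hsubZ : ∀ x, (s.vertex x).block = some Z → superBlockOf s r x = some Y := fun x hx => by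
    rw [superBlockOf, hx, Option.bind_some, hZs]
  obtain ⟨y, hy⟩ := h.blk.nonempty Y' hY'p
  obtain ⟨z, hz⟩ := h.blk.nonempty Z hZp
  have hzY' : (s.vertex z).block ≠ some Y' := by
    rw [hz]; simpa using hne.symm
  have h' : Inv C { s₁ with changed := true } := h₁.withChanged true
  refine ⟨{ s₁ with changed := true }, ?_, h', rfl, ?_, ?_⟩
  · simp only [splitFirst, hYl, List.head?_cons, Option.bind_some, hsm, hs₁]
  · refine Set.ncard_lt_ncard ⟨?_, fun hc => ?_⟩ (Set.toFinite _)
    · rintro ⟨r', x, x'⟩ hx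
      change superBlockOf s₁ r' x = superBlockOf s₁ r' x' at hx
      change superBlockOf s r' x = superBlockOf s r' x'
      by_cases hrr : r' = r
      · subst hrr
        have hmem : x ∈ {z | superBlockOf s₁ r' z = superBlockOf s₁ r' x'} := hx
        by_cases hx' : (s.vertex x').block = some Y'
        · rw [hR.superBlock_of_mem hx'] at hmem
          rw [hsub x hmem, hsub x' hx']
        · by_cases hxY : superBlockOf s r' x' = some Y
          · rw [hR.superBlock_of_mem_sdiff hx' hxY] at hmem
            rw [show superBlockOf s r' x = some Y from hmem.1, hxY]
          · rw [hR.superBlock_of_notMem hsub hxY] at hmem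
            exact hmem
      · rwa [hR.superBlockOf_of_ne r' hrr, hR.superBlockOf_of_ne r' hrr] at hx
    -- A vertex `y` of `Y'` and a vertex `z` of `Z` shared the super-block `Y` and are now
    -- separated, so the inclusion of the sets of triples is strict.
    · have : (r, z, y) ∈ {p : EL × V × V |
          superBlockOf s p.1 p.2.1 = superBlockOf s p.1 p.2.2} := by
        change superBlockOf s r z = superBlockOf s r y
        rw [hsub y hy, hsubZ z hz]
      have := hc this
      change superBlockOf s₁ r z = superBlockOf s₁ r y at this
      rw [hR.superBlockOf_of_mem y hy, hR.superBlockOf_of_notMem z hzY'] at this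
      exact hR.fresh z this
  · rw [h.config_eq, h'.config_eq]
    refine ⟨r, {x | superBlockOf s r x = some Y}, {x | (s.vertex x).block = some Y'}, ?_, ?_, ?_,
      ⟨fun x hx => hsub x hx, fun hc => hzY' (hc (hsubZ z hz))⟩, ?_, hR.isSplitPartition, ?_⟩
    -- If `ℚ_r` were `ℙ`, then `Y` would be one block, although it contains vertices of two blocks.
    · intro hc
      have hmem : {x | superBlockOf s r x = some Y} ∈ (superBlockSetoid s r).classes :=
        ⟨y, by rw [← hsub y hy]; rfl⟩
      dsimp only at hc
      rw [hc] at hmem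
      obtain ⟨x, hx⟩ := hmem
      have h1 : y ∈ {x | superBlockOf s r x = some Y} := hsub y hy
      have h2 : z ∈ {x | superBlockOf s r x = some Y} := hsubZ z hz
      rw [hx] at h1 h2
      exact hzY' ((show (s.vertex z).block = (s.vertex x).block from h2).trans
        ((show (s.vertex y).block = (s.vertex x).block from h1).symm.trans hy))
    · exact ⟨y, by rw [← hsub y hy]; rfl⟩
    · exact ⟨y, by rw [← hy]; rfl⟩
    -- `Y'` and `Z` are disjoint parts of `Y`, and `Y'` is not larger than `Z`.
    · have hdisj : Disjoint {x | (s.vertex x).block = some Y'} {x | (s.vertex x).block = some Z} :=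
        Set.disjoint_left.2 fun x h1 h2 =>
          hne (Option.some_injective _ ((show _ = _ from h1).symm.trans h2))
      have hunion : {x | (s.vertex x).block = some Y'} ∪ {x | (s.vertex x).block = some Z} ⊆
          {x | superBlockOf s r x = some Y} := by
        rintro x (hx | hx)
        · exact hsub x hx
        · exact hsubZ x hx
      have hcard := Set.ncard_le_ncard hunion (Set.toFinite _)
      rw [Set.ncard_union_eq hdisj (Set.toFinite _) (Set.toFinite _), h.ncard_block hY'p,
        h.ncard_block hZp] at hcard
      rw [h.ncard_block hY'p]
      omega
    · funext r'
      by_cases hrr : r' = r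
      · subst hrr
        rw [Function.update_self]
        have hclass : ∀ x, {w | superBlockSetoid s₁ r' w x} =
          {w | superBlockOf s₁ r' w = superBlockOf s₁ r' x} := fun _ => rfl
        have hclass' : ∀ x, {w | superBlockSetoid s r' w x} =
          {w | superBlockOf s r' w = superBlockOf s r' x} := fun _ => rfl
        change (superBlockSetoid s₁ r').classes = _
        ext B
        constructor
        · rintro ⟨x, rfl⟩
          rw [hclass]
          by_cases hx : (s.vertex x).block = some Y'
          · rw [hR.superBlock_of_mem hx]
            exact Or.inr (Or.inl rfl)
          · by_cases hxY : superBlockOf s r' x = some Y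
            · rw [hR.superBlock_of_mem_sdiff hx hxY]
              exact Or.inr (Or.inr rfl)
            · rw [hR.superBlock_of_notMem hsub hxY]
              refine Or.inl ⟨⟨x, rfl⟩, fun hc => hxY ?_⟩
              have : x ∈ {w | superBlockOf s r' w = superBlockOf s r' x} := rfl
              rw [show {w | superBlockOf s r' w = superBlockOf s r' x} = _ from hc] at this
              exact this
        · rintro (⟨⟨x, rfl⟩, hB⟩ | rfl | rfl)
          · refine ⟨x, ?_⟩
            rw [hclass, hclass', hR.superBlock_of_notMem hsub]
            intro hxY
            exact hB (by rw [hclass', hxY]; rfl)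
          · exact ⟨y, by rw [hclass, hR.superBlock_of_mem hy]⟩
          · exact ⟨z, by rw [hclass, hR.superBlock_of_mem_sdiff hzY' (hsubZ z hz)]⟩
      · rw [Function.update_of_ne hrr]
        have : superBlockOf { s₁ with changed := true } r' = superBlockOf s r' :=
          funext fun x => hR.superBlockOf_of_ne r' hrr x
        simp only [superBlockSetoid, this]

/-- Runs of the main loop of CompCB from what `s'` represents extend to runs from what `s`
represents, by the configurations that are represented by the states in `t`. -/
def Simulates (G : FuzzyGraph V VL EL) (s : State V EL) (t : List (State V EL))
    (s' : State V EL) : Prop :=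
  ∀ t' c, While (fun c : Config V EL => ∃ r, c.Q r ≠ c.P)
      (fun c t c' => CompCB.Step G c c' ∧ t = [c']) (config s') t' c →
    While (fun c : Config V EL => ∃ r, c.Q r ≠ c.P)
      (fun c t c' => CompCB.Step G c c' ∧ t = [c']) (config s) (t.map config ++ t') c

omit [DecidableEq V] in
theorem Simulates.refl (s : State V EL) : Simulates G s [] s := fun _ _ h => h

omit [DecidableEq V] in
theorem Simulates.trans {s s' s'' : State V EL} {t t' : List (State V EL)}
    (h : Simulates G s t s') (h' : Simulates G s' t' s'') : Simulates G s (t ++ t') s'' :=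
  fun t₀ c hw => by
    rw [List.map_append, List.append_assoc]
    exact h _ _ (h' _ _ hw)

omit [DecidableEq V] in
theorem Simulates.of_step {s s' : State V EL} (h : CompCB.Step G (config s) (config s')) :
    Simulates G s [s'] s' := fun _ _ hw =>
  While.iter _ _ _ [config s'] _ (by
    obtain ⟨r, Y, Y', hr, -⟩ := h
    exact ⟨r, hr⟩) ⟨h, rfl⟩ hw

/-- Induction on `weight`. The final alternative keeps track of whether any split took place, which
the outer loop needs in order to interpret `changed`. -/
theorem innerLoop_spec [Finite V] [Finite EL] (C : Choices G) (r : EL) {s : State V EL}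
    (h : Inv C s) : ∃ t s', InnerLoop C r s t s' ∧ Inv C s' ∧ Simulates G s t s' ∧
      ((t = [] ∧ s' = s ∧ (s.superPartition r).compound = []) ∨
        (weight s' < weight s ∧ s'.changed = true)) := by
  induction hw : weight s using Nat.strong_induction_on generalizing s with
  | _ n ih =>
    by_cases hr : (s.superPartition r).compound = []
    · exact ⟨[], s, While.exit s (not_not.2 hr), h, .refl s, Or.inl ⟨rfl, rfl, hr⟩⟩
    · obtain ⟨s₁, hs₁, h₁, hc₁, hw₁, hst⟩ := splitFirst_spec C h hr
      obtain ⟨t, s', hl, h', hsim, hor⟩ := ih _ (hw ▸ hw₁) h₁ rfl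
      refine ⟨_, s', While.iter s s₁ s' [s₁] t hr ⟨hs₁, rfl⟩ hl, h',
        (Simulates.of_step hst).trans hsim, Or.inr ?_⟩
      rcases hor with ⟨-, rfl, -⟩ | ⟨hlt, hc⟩
      · exact ⟨hw ▸ hw₁, hc₁⟩
      · exact ⟨hw ▸ hlt.trans hw₁, hc⟩

theorem forEach_innerLoop_spec [Finite V] [Finite EL] (C : Choices G) (l : List EL)
    {s : State V EL} (h : Inv C s) : ∃ t s', ForEach (InnerLoop C) l s t s' ∧ Inv C s' ∧
      Simulates G s t s' ∧
      ((t = [] ∧ s' = s ∧ ∀ r ∈ l, (s.superPartition r).compound = []) ∨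
        (weight s' < weight s ∧ s'.changed = true)) := by
  induction l generalizing s with
  | nil => exact ⟨[], s, ⟨rfl, rfl⟩, h, .refl s, Or.inl ⟨rfl, rfl, by simp⟩⟩
  | cons r l ih =>
    obtain ⟨t₁, s₁, hl₁, h₁, hsim₁, hor₁⟩ := innerLoop_spec C r h
    obtain ⟨t₂, s₂, hl₂, h₂, hsim₂, hor₂⟩ := ih h₁
    refine ⟨t₁ ++ t₂, s₂, ⟨t₁, s₁, t₂, hl₁, hl₂, rfl⟩, h₂, hsim₁.trans hsim₂, ?_⟩
    rcases hor₁ with ⟨rfl, rfl, hr⟩ | ⟨hw₁, hc₁⟩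
    · rcases hor₂ with ⟨rfl, rfl, hl⟩ | h
      · exact Or.inl ⟨rfl, rfl, by simpa [hr] using hl⟩
      · exact Or.inr h
    · rcases hor₂ with ⟨rfl, rfl, -⟩ | ⟨hw₂, hc₂⟩
      · exact Or.inr ⟨hw₁, hc₁⟩
      · exact Or.inr ⟨hw₂.trans hw₁, hc₂⟩

/-- A split for one label may add blocks to super-blocks of labels treated earlier in the same pass,
so the end of a pass alone does not ensure that all `compound` lists are empty. A pass without any
split leaves the state unchanged, and then every list was found empty in this same state. All other
passes decrease `weight`. -/
theorem outerLoop_spec [Finite V] [Finite EL] (C : Choices G) {s : State V EL} (h : Inv C s)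
    (hc : s.changed = true) : ∃ t s', OuterLoop C s t s' ∧ Inv C s' ∧ Simulates G s t s' ∧
      ∀ r, (s'.superPartition r).compound = [] := by
  induction hw : weight s using Nat.strong_induction_on generalizing s with
  | _ n ih =>
    obtain ⟨t₁, s₁, hl₁, h₁, hsim₁, hor₁⟩ := forEach_innerLoop_spec C C.labels
      (h.withChanged false)
    rcases hor₁ with ⟨rfl, rfl, hr⟩ | ⟨hw₁, hc₁⟩
    · exact ⟨_, _, While.iter s _ _ [] [] hc hl₁ (While.exit _ (by simp)), h₁, .refl s,
        fun r => hr r (C.mem_labels r)⟩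
    · obtain ⟨t₂, s₂, hl₂, h₂, hsim₂, hr⟩ := ih _ (hw ▸ hw₁) h₁ hc₁ rfl
      exact ⟨_, s₂, While.iter s s₁ s₂ t₁ t₂ hc hl₁ hl₂, h₂,
        Simulates.trans (s := s) hsim₁ hsim₂, hr⟩

/-! ## The result -/

theorem InnerLoop.det {C : Choices G} {r : EL} {s s₁ s₂ : State V EL}
    {t₁ t₂ : List (State V EL)} (h₁ : InnerLoop C r s t₁ s₁) (h₂ : InnerLoop C r s t₂ s₂) :
    t₁ = t₂ ∧ s₁ = s₂ := by
  unfold InnerLoop at h₁ h₂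
  refine While.det ?_ h₁ h₂
  rintro s t₁ s₁ t₂ s₂ ⟨hs₁, rfl⟩ ⟨hs₂, rfl⟩
  obtain rfl := Option.some_injective _ (hs₁.symm.trans hs₂)
  exact ⟨rfl, rfl⟩

theorem OuterLoop.det {C : Choices G} {s s₁ s₂ : State V EL}
    {t₁ t₂ : List (State V EL)} (h₁ : OuterLoop C s t₁ s₁) (h₂ : OuterLoop C s t₂ s₂) :
    t₁ = t₂ ∧ s₁ = s₂ := by
  unfold OuterLoop at h₁ h₂
  refine While.det ?_ h₁ h₂
  intro s t₁ s₁ t₂ s₂ hs₁ hs₂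
  refine ForEach.det ?_ hs₁ hs₂
  intros
  exact InnerLoop.det ‹_› ‹_›

theorem Run.det {C : Choices G} {t₁ t₂ : List (State V EL)} {s₁ s₂ : State V EL}
    (h₁ : Run C t₁ s₁) (h₂ : Run C t₂ s₂) : t₁ = t₂ ∧ s₁ = s₂ := by
  obtain ⟨s₀, hs₀, h₁⟩ := h₁
  obtain ⟨s₀', hs₀', h₂⟩ := h₂
  obtain rfl := Option.some_injective _ (hs₀.symm.trans hs₀')
  rcases h₁ with ⟨hl, rfl, rfl⟩ | ⟨hl, t₁, rfl, h₁⟩ <;>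
    rcases h₂ with ⟨hl', rfl, rfl⟩ | ⟨hl', t₂, rfl, h₂⟩
  · exact ⟨rfl, rfl⟩
  · contradiction
  · contradiction
  · obtain ⟨rfl, rfl⟩ := h₁.det h₂
    exact ⟨rfl, rfl⟩

/-- If the blocks are the super-blocks, then they are the classes of the largest bisimulation. -/
theorem Inv.output_spec [Finite V] [Nonempty V] {C : Choices G} {s : State V EL} (h : Inv C s)
    (hs : ∀ r x y, superBlockOf s r x = superBlockOf s r y →
      (s.vertex x).block = (s.vertex y).block) :
    G.IsLargestBisimulationPartition {X | ∃ vl ∈ output s, X = {x | x ∈ vl}} ∧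
      (output s).flatten.Nodup := by
  constructor
  · have hP : {X | ∃ vl ∈ output s, X = {x | x ∈ vl}} = (blockSetoid s).classes := by
      refine Eq.trans ?_ (congrArg Config.P h.config_eq)
      ext X
      simp [output, config, blockSet]
    rw [hP]
    refine FuzzyGraph.isLargestBisimulationPartition_classes (blockSetoid s) h.label
      (fun x x' hx r y => ?_) h.coarse
    have : {z | blockSetoid s z y} = {z | superBlockOf s r z = superBlockOf s r y} := by
      ext z
      exact ⟨fun hz => superBlockOf_eq_of_block_eq hz r, fun hz => hs r z y hz⟩
    rw [this]
    exact h.stable x x' hx r y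
  · unfold output
    rw [List.nodup_flatten, List.forall_mem_map, List.pairwise_map]
    refine ⟨h.blk.vertices_nodup, h.sup.partition_nodup.imp_of_mem fun {b b'} hb hb' hne => ?_⟩
    intro x hx hx'
    exact hne (Option.some_injective _ (((h.blk.mem_vertices b hb x).1 hx).1.symm.trans
      ((h.blk.mem_vertices b' hb' x).1 hx').1))

theorem Inv.block_eq_of_compound_eq_nil {C : Choices G} {s : State V EL} (h : Inv C s) {r : EL}
    (hr : (s.superPartition r).compound = []) {x y : V}
    (hxy : superBlockOf s r x = superBlockOf s r y) :
    (s.vertex x).block = (s.vertex y).block := by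
  obtain ⟨b, -, sb, hs, hx, hxs, hb⟩ := h.exists_superBlock r x
  obtain ⟨b', -, sb', hs', hy, hys, hb'⟩ := h.exists_superBlock r y
  obtain rfl : sb = sb' := Option.some_injective _ (by rw [← hxs, ← hys, hxy])
  have hlen : (s.superBlock sb).blocks.length ≤ 1 := by
    by_contra hc
    have := (h.sup.mem_compound r sb hs).2 (not_le.1 hc)
    simp [hr] at this
  rw [hx, hy]
  match hbl : (s.superBlock sb).blocks with
  | [] => simp [hbl] at hb
  | [a] =>
    rw [hbl, List.mem_singleton] at hb hb'
    rw [hb, hb']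
  | _ :: _ :: _ => simp [hbl] at hlen

theorem Inv.partition_length_eq_one_iff [Nonempty V] {C : Choices G} {s : State V EL}
    (h : Inv C s) : s.partition.length = 1 ↔
      ∀ x y, (s.vertex x).block = (s.vertex y).block := by
  constructor
  · intro hl x y
    obtain ⟨b, hb⟩ := List.length_eq_one_iff.1 hl
    obtain ⟨b₁, h1, hx⟩ := h.blk.exists_block x
    obtain ⟨b₂, h2, hy⟩ := h.blk.exists_block y
    rw [hb, List.mem_singleton] at h1 h2
    rw [hx, hy, h1, h2]
  · intro hall
    obtain ⟨x⟩ := ‹Nonempty V›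
    obtain ⟨b, hb, hx⟩ := h.blk.exists_block x
    have hsub : s.partition ⊆ [b] := fun b' hb' => by
      obtain ⟨y, hy⟩ := h.blk.nonempty b' hb'
      rw [List.mem_singleton]
      exact Option.some_injective _ (by rw [← hy, ← hx, hall])
    have h1 := (h.sup.partition_nodup.subperm hsub).length_le
    have h2 := List.length_pos_of_mem hb
    simp only [List.length_singleton] at h1
    omega

omit [DecidableEq V] [DecidableEq EL] in
theorem classes_eq_singleton_univ_iff [Nonempty V] (A : Setoid V) :
    A.classes = {Set.univ} ↔ ∀ x y, A x y := by
  constructor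
  · intro h x y
    have : {z | A z y} ∈ A.classes := A.mem_classes y
    rw [h, Set.mem_singleton_iff] at this
    have hx : x ∈ {z | A z y} := by rw [this]; trivial
    exact hx
  · intro h
    ext B
    rw [Set.mem_singleton_iff]
    constructor
    · rintro ⟨y, rfl⟩
      ext x
      simp [h x y]
    · rintro rfl
      obtain ⟨y⟩ := ‹Nonempty V›
      exact ⟨y, by ext x; simp [h x y]⟩

/-- The early return corresponds to the early return of CompCB, since one block in `ℙ` means that
all vertices are `initialSetoid`-equivalent. Otherwise the simulation is completed at the end: every
super-block has become a single block, so the guard of CompCB fails exactly where the program stops.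
-/
theorem exists_run [Finite V] [Nonempty V] [Finite EL] (C : Choices G) : ∃ t s, Run C t s ∧
    G.IsLargestBisimulationPartition {X | ∃ vl ∈ output s, X = {x | x ∈ vl}} ∧
    (output s).flatten.Nodup ∧ CompCB.Run G (t.map config) (config s) := by
  obtain ⟨s₀, hs₀, h₀, hblk, hsb⟩ := setUp_spec C
  have hset : blockSetoid s₀ = G.initialSetoid := Setoid.ext hblk
  have hstart : config s₀ = CompCB.start G := by
    rw [h₀.config_eq, hset]
    unfold CompCB.start
    congr 1
    funext r
    rw [classes_eq_singleton_univ_iff]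
    exact hsb r
  have hone : s₀.partition.length = 1 ↔ (CompCB.start G).P = {Set.univ} := by
    rw [h₀.partition_length_eq_one_iff]
    change _ ↔ G.initialSetoid.classes = _
    rw [classes_eq_singleton_univ_iff, ← hset]
    rfl
  by_cases hl : s₀.partition.length = 1
  · obtain ⟨h1, h2⟩ := h₀.output_spec fun r x y _ => h₀.partition_length_eq_one_iff.1 hl x y
    exact ⟨[s₀], s₀, ⟨s₀, hs₀, Or.inl ⟨hl, rfl, rfl⟩⟩, h1, h2,
      Or.inl ⟨hone.1 hl, by rw [← hstart]; rfl, hstart⟩⟩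
  · obtain ⟨t, s, hloop, h, hsim, hr⟩ := outerLoop_spec C (h₀.withChanged true) rfl
    have hfin : ∀ r x y, superBlockOf s r x = superBlockOf s r y →
        (s.vertex x).block = (s.vertex y).block := fun r x y hxy =>
      h.block_eq_of_compound_eq_nil (hr r) hxy
    obtain ⟨h1, h2⟩ := h.output_spec hfin
    refine ⟨s₀ :: t, s, ⟨s₀, hs₀, Or.inr ⟨hl, t, rfl, hloop⟩⟩, h1, h2,
      Or.inr ⟨fun hc => hl (hone.2 hc), t.map config, by rw [← hstart]; rfl, ?_⟩⟩
    rw [← hstart, ← List.append_nil (t.map config)]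
    -- The abstract run after the last recorded state is empty, because there `ℚ_r = ℙ` for all `r`.
    refine hsim _ _ (While.exit _ ?_)
    rintro ⟨r, hne⟩
    refine hne ?_
    rw [h.config_eq]
    refine congrArg Setoid.classes (Setoid.ext fun x y => ?_)
    exact ⟨hfin r x y, fun hxy => superBlockOf_eq_of_block_eq hxy r⟩

end CompCB2

end

end CrispBisim

end

open CrispBisim in
-- Determinism transfers the properties of the one run that was constructed to every run.
theorem mainTheorem7 {V VL EL : Type*} [Finite V] [Nonempty V] [Finite VL] [Finite EL]
    [DecidableEq V] [DecidableEq EL] (G : FuzzyGraph V VL EL) (C : Choices G) :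
    (∃ t s, CompCB2.Run C t s) ∧
    ∀ t s, CompCB2.Run C t s →
      G.IsLargestBisimulationPartition {X | ∃ vl ∈ CompCB2.output s, X = {x | x ∈ vl}} ∧
      (CompCB2.output s).flatten.Nodup ∧
      CompCB.Run G (t.map CompCB2.config) (CompCB2.config s) := by
  obtain ⟨t, s, hrun, h₁, h₂, h₃⟩ := CompCB2.exists_run C
  refine ⟨⟨t, s, hrun⟩, fun t' s' hrun' => ?_⟩
  obtain ⟨rfl, rfl⟩ := hrun.det hrun'
  exact ⟨h₁, h₂, h₃⟩
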